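/- **Setting.** Let $\epsilon>0$ (so $\epsilon^{-1}$ is the speed of light), let $0\le\rho_*<\rho^*\le\infty$, and let $p\in C^\infty((\rho_*,\rho^*))$ satisfy $p(\rho)>0$ and $0<p'(\rho)<\epsilon^{-2}$ for all $\rho\in(\rho_*,\rho^*)$. Let $\bar\rho$, $\bar v$ be constants with (H1) $\quad\bar\rho\in(\rho_*,\rho^*)$, $\ \bar v\in(0,\epsilon^{-1})$. Put $N(\rho)=\exp\int_{\bar\rho}^{\rho}\frac{ds}{s+\epsilon^2p(s)}$, $c(\rho)=\sqrt{p'(\rho)}$, $h(\rho)=\frac{\rho+\epsilon^2p(\rho)}{N(\rho)}$. For a velocity $v=(v_1,v_2)$ with $|v|<\epsilon^{-1}$ let $\Gamma=(1-\epsilon^2|v|^2)^{-1/2}$ and $w=\Gamma v$. With the unknown $U=(p,hw_1,hw_2)^{\mathsf T}$ the relativistic Euler equations read $A_0(U)\partial_tU+A_1(U)\partial_1U+A_2(U)\partial_2U=0$, where $$A_0=\begin{pmatrix}\Gamma(1-\epsilon^4c^2|v|^2)&2\epsilon^2Nc^2v_1&2\epsilon^2Nc^2v_2\\0&\Gamma(1-\epsilon^2v_1^2)&-\epsilon^2\Gamma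 v_1v_2\\0&-\epsilon^2\Gamma v_1v_2&\Gamma(1-\epsilon^2v_2^2)\end{pmatrix},$$ $$A_1=\begin{pmatrix}\Gamma v_1(1-\epsilon^4c^2|v|^2)&Nc^2(1+\epsilon^2v_1^2)&\epsilon^2v_1v_2Nc^2\\N^{-1}(1-\epsilon^2v_1^2)&\Gamma v_1(1-\epsilon^2v_1^2)&-\epsilon^2\Gamma v_1^2v_2\\-\epsilon^2v_1v_2N^{-1}&-\epsilon^2\Gamma v_1^2v_2&\Gamma v_1(1-\epsilon^2v_2^2)\end{pmatrix},$$ $$A_2=\begin{pmatrix}\Gamma v_2(1-\epsilon^4c^2|v|^2)&\epsilon^2v_1v_2Nc^2&Nc^2(1+\epsilon^2v_2^2)\\-\epsilon^2v_1v_2N^{-1}&\Gamma v_2(1-\epsilon^2v_1^2)&-\epsilon^2\Gamma v_1v_2^2\\N^{-1}(1-\epsilon^2v_2^2)&-\epsilon^2\Gamma v_1v_2^2&\Gamma v_2(1-\epsilon^2v_2^2)\end{pmatrix}.$$ Let $\bar c=c(\bar\rho)$, $\bar h=h(\bar\rho)$, $\bar\Gamma=(1-\epsilon^2\bar v^2)^{-1/2}$,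 and let $\bar U^\pm=(p(\bar\rho),\pm\bar h\bar\Gamma\bar v,0)^{\mathsf T}$ be the two constant states of the rectilinear vortex sheet. Assume (H2) $\quad\dfrac{|\bar v|}{\bar c}>\dfrac{\sqrt2}{\sqrt{1+\epsilon^2\bar c^2}}$. Let $\Omega=\{(t,x_1,x_2)\in\mathbb R^3:x_2>0\}$, with boundary identified with $\mathbb R^2\ni(t,x_1)$. For $V=(V^+,V^-)$ with $V^\pm=(V_1^\pm,V_2^\pm,V_3^\pm)$ on $\Omega$ and $\psi$ on $\mathbb R^2$, the problem linearized around $\bar U^\pm$ and the flat front has the operators $$\mathbb L'_\pm=A_0(\bar U^\pm)\partial_t+A_1(\bar U^\pm)\partial_1\pm A_2(\bar U^\pm)\partial_2\quad\text{in }\Omega,$$ $$\mathbb B'(V^{\mathrm{nc}},\psi)=\begin{pmatrix}2\bar v\,\partial_1\psi-(\bar h\bar\Gamma)^{-1}(V_3^+-V_3^-)\\ \partial_t\psi+\bar v\,\partial_1\psi-(\bar h\bar\Gamma)^{-1}V_3^+\\ V_1^+-V_1^-\end{pmatrix}\quad\text{on }\{x_2=0\},$$ where $V^{\mathrm{nc}}=(V_1^+,V_3^+,V_1^-,V_3^-)$.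 For $\gamma\ge1$ and $s\ge0$ let $\|u\|_{s,\gamma}^2=\frac1{(2\pi)^2}\int_{\mathbb R^2}(\gamma^2+|\xi|^2)^s|\hat u(\xi)|^2\,d\xi$, $\|u\|_{H^s_\gamma(\mathbb R^2)}=\|e^{-\gamma t}u\|_{s,\gamma}$, $\|u\|_{L^2_\gamma(\mathbb{R}^2)}=\|e^{-\gamma t}u\|_{L^2(\mathbb{R}^2)}$, $\|u\|_{L^2_\gamma(\Omega)}=\|e^{-\gamma t}u\|_{L^2(\Omega)}$ and $\|u\|^2_{L^2(H^s_\gamma)}=\int_0^\infty\|u(\cdot,x_2)\|^2_{H^s_\gamma(\mathbb R^2)}\,dx_2$; squared norms of vectors are sums over the components, and $\|\mathbb L'_\pm V^\pm\|^2$ means the sum over both signs. The space $H^2_\gamma$ on $\Omega$ or $\mathbb R^2$ consists of the (complex-valued) functions $u$ with $e^{-\gamma t}u\in H^2$. **Theorem.** Under (H1) and (H2) there is a constant $C$, depending only on $\epsilon,p,\bar\rho,\bar v$ (in particular not on $\gamma$, $V$, $\psi$), such that for all $\gamma\ge1$ and all $(V,\psi)\in H^2_\gamma(\Omega)\times H^2_\gamma(\mathbb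 R^2)$, $$\gamma\|V\|^2_{L^2_\gamma(\Omega)}+\|V^{\mathrm{nc}}|_{x_2=0}\|^2_{L^2_\gamma(\mathbb R^2)}+\|\psi\|^2_{H^1_\gamma(\mathbb R^2)}\le C\Big(\gamma^{-3}\|\mathbb L'_\pm V^\pm\|^2_{L^2(H^1_\gamma)}+\gamma^{-2}\|\mathbb B'(V^{\mathrm{nc}}|_{x_2=0},\psi)\|^2_{H^1_\gamma(\mathbb R^2)}\Big).$$ -/

import Mathlib

open MeasureTheory Set Filter Topology FourierTransform
open scoped ENNReal NNReal Matrix ContDiff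

noncomputable section

namespace VortexSheet

/-! ### Points, weak derivatives, traces, weighted Sobolev norms -/

/-- Boundary points `y = (t, x₁) ∈ ℝ²`. -/
abbrev Bd : Type := EuclideanSpace ℝ (Fin 2)

/-- Space-time points `((t, x₁), x₂) ∈ ℝ³`. -/
abbrev Sp : Type := Bd × ℝ

/-- The half-space `Ω = {x₂ > 0}`. -/
def Om : Set Sp := {x | 0 < x.2}

/-- Unit vectors of the variables `t` and `x₁`. -/
def et : Bd := EuclideanSpace.single 0 1
def e1 : Bd := EuclideanSpace.single 1 1

/-- `w` is the distributional derivative of `u` in the direction `e` on the open set `O`. -/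
def IsWeakDeriv {E : Type*} [NormedAddCommGroup E] [NormedSpace ℝ E] [MeasureSpace E]
    (O : Set E) (e : E) (u w : E → ℂ) : Prop :=
  LocallyIntegrableOn u O volume ∧ LocallyIntegrableOn w O volume ∧
    ∀ φ : E → ℝ, ContDiff ℝ ∞ φ → HasCompactSupport φ → tsupport φ ⊆ O →
      ∫ x in O, fderiv ℝ φ x e • u x = -∫ x in O, φ x • w x

open Classical in
/-- The distributional derivative of `u` in the direction `e` on `O`, as a function
(unique almost everywhere on `O`; `0` if the derivative is not a locally integrable function). -/
def weakDeriv {E : Type*} [NormedAddCommGroup E] [NormedSpace ℝ E] [MeasureSpace E]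
    (O : Set E) (e : E) (u : E → ℂ) : E → ℂ :=
  if h : ∃ w, IsWeakDeriv O e u w then h.choose else 0

/-- `u ∈ H^k(O)`: `u ∈ L²(O)` and, for `k ≥ 1`, all first distributional derivatives of `u` are in
`H^{k-1}(O)`. -/
def MemH {E : Type*} [NormedAddCommGroup E] [NormedSpace ℝ E] [MeasureSpace E]
    (O : Set E) : ℕ → (E → ℂ) → Prop
  | 0, u => MemLp u 2 (volume.restrict O)
  | k + 1, u => MemLp u 2 (volume.restrict O) ∧
      ∀ e : E, ∃ w, IsWeakDeriv O e u w ∧ MemH O k w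

/-- The function `e^{-γt} u` on `ℝ²`. -/
def wtBd (γ : ℝ) (u : Bd → ℂ) : Bd → ℂ := fun y => Real.exp (-γ * y 0) • u y

/-- The function `e^{-γt} u` on `ℝ³`. -/
def wtSp (γ : ℝ) (u : Sp → ℂ) : Sp → ℂ := fun x => Real.exp (-γ * x.1 0) • u x

/-- `ψ ∈ H^k_γ(ℝ²)`. -/
def MemHBd (γ : ℝ) (k : ℕ) (ψ : Bd → ℂ) : Prop := MemH (univ : Set Bd) k (wtBd γ ψ)

/-- `u ∈ H^k_γ(Ω)`. -/
def MemHOm (γ : ℝ) (k : ℕ) (u : Sp → ℂ) : Prop := MemH Om k (wtSp γ u)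

/-- `g` is the trace on `{x₂ = 0}` of the function `u` on `Ω`, in the sense of Green's formula:
`u` and its derivative `∂₂u` are integrable on the bounded parts of `Ω`, and
`∫_Ω (u ∂₂φ + φ ∂₂u) = -∫_{ℝ²} g φ|_{x₂=0}` for all test functions `φ` on the closed half-space. -/
def IsTrace (u : Sp → ℂ) (g : Bd → ℂ) : Prop :=
  LocallyIntegrable u (volume.restrict Om) ∧ LocallyIntegrable g volume ∧
    ∃ w : Sp → ℂ, LocallyIntegrable w (volume.restrict Om) ∧
      ∀ φ : Sp → ℝ, ContDiff ℝ ∞ φ → HasCompactSupport φ →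
        ∫ x in Om, (fderiv ℝ φ x (0, 1) • u x + φ x • w x) = -∫ y : Bd, φ (y, 0) • g y

open Classical in
/-- The trace `u|_{x₂=0}` (unique almost everywhere; `0` if there is none). -/
def trace (u : Sp → ℂ) : Bd → ℂ := if h : ∃ g, IsTrace u g then h.choose else 0

open Classical in
/-- The square of the norm `‖u‖_{s,γ}` of `H^s(ℝ²)`, for `s ≥ 0`, that is
`(2π)⁻² ∫ (γ² + |ξ|²)^s |û(ξ)|² dξ` where `û(ξ) = ∫ e^{-i x·ξ} u(x) dx`. Since the `L²` Fourier
transform `𝓕` used here is normalised by `𝓕 u (ξ) = û(2πξ)`, the integral becomes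
`∫ (γ² + |2πξ|²)^s |𝓕 u (ξ)|² dξ`. The value is `∞` if `u` is not in `L²(ℝ²)`. -/
def sobSq (s γ : ℝ) (u : Bd → ℂ) : ℝ≥0∞ :=
  if h : MemLp u 2 volume then
    ∫⁻ ξ : Bd, ENNReal.ofReal ((γ ^ 2 + ‖(2 * Real.pi) • ξ‖ ^ 2) ^ s) *
      ‖(𝓕 (h.toLp u) : Lp ℂ 2 (volume : Measure Bd)) ξ‖ₑ ^ 2
  else ∞

/-- `‖u‖²_{H^s_γ(ℝ²)}` for `s ≥ 0`. -/
def hBdSq (s γ : ℝ) (u : Bd → ℂ) : ℝ≥0∞ := sobSq s γ (wtBd γ u)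

/-- `‖u‖²_{L²_γ(ℝ²)}`. -/
def l2BdSq (γ : ℝ) (u : Bd → ℂ) : ℝ≥0∞ := ∫⁻ y, ‖wtBd γ u y‖ₑ ^ 2

/-- `‖u‖²_{L²_γ(Ω)}`. -/
def l2OmSq (γ : ℝ) (u : Sp → ℂ) : ℝ≥0∞ := ∫⁻ x in Om, ‖wtSp γ u x‖ₑ ^ 2

/-- `‖u‖²_{L²(H^s_γ)}`, the square of the norm of `L²(ℝ₊; H^s_γ(ℝ²))`, for `s ≥ 0`. -/
def l2hSq (s γ : ℝ) (u : Sp → ℂ) : ℝ≥0∞ := ∫⁻ x₂ in Ioi (0 : ℝ), hBdSq s γ (fun y => u (y, x₂))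

/-! ### The relativistic fluid and the background vortex sheet -/

/-- The data: `ε⁻¹` is the speed of light, `p` the pressure law on the interval `(ρlo, ρhi)`,
`ρbar` the background density and `±vbar` the background tangential velocities. -/
structure Sheet where
  ε : ℝ
  ρlo : ℝ
  ρhi : EReal
  p : ℝ → ℝ
  ρbar : ℝ
  vbar : ℝ

namespace Sheet

variable (S : Sheet)

/-- The interval `(ρlo, ρhi)`; the right end may be `∞`. -/
def dom : Set ℝ := {ρ | S.ρlo < ρ ∧ (ρ : EReal) < S.ρhi}

/-- The standing assumptions on the fluid (barotropic law with sound speed positive and below the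
speed of light), and the physical constraints on the background state. -/
structure Physical : Prop where
  eps_pos : 0 < S.ε
  lo_nonneg : 0 ≤ S.ρlo
  smooth : ContDiffOn ℝ ∞ S.p S.dom
  p_pos : ∀ ρ ∈ S.dom, 0 < S.p ρ
  dp_pos : ∀ ρ ∈ S.dom, 0 < deriv S.p ρ
  dp_lt : ∀ ρ ∈ S.dom, deriv S.p ρ < (S.ε ^ 2)⁻¹
  rho_mem : S.ρbar ∈ S.dom
  vbar_pos : 0 < S.vbar
  vbar_lt : S.vbar < S.ε⁻¹

/-- Particle number density `N(ρ)`. -/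
def N (ρ : ℝ) : ℝ := Real.exp (∫ s in S.ρbar..ρ, 1 / (s + S.ε ^ 2 * S.p s))

/-- Sound speed `c(ρ)`. -/
def c (ρ : ℝ) : ℝ := Real.sqrt (deriv S.p ρ)

/-- `h(ρ)`. -/
def h (ρ : ℝ) : ℝ := (ρ + S.ε ^ 2 * S.p ρ) / S.N ρ

/-- The density as a function of the pressure. -/
def rho (P : ℝ) : ℝ := Function.invFunOn S.p S.dom P

/-! The unknowns are `U = (U 0, U 1, U 2) = (p, h w₁, h w₂)`, where `w = Γ v`. -/

def w1 (U : Fin 3 → ℝ) : ℝ := U 1 / S.h (S.rho (U 0))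
def w2 (U : Fin 3 → ℝ) : ℝ := U 2 / S.h (S.rho (U 0))

/-- Lorentz factor. -/
def Gam (U : Fin 3 → ℝ) : ℝ := Real.sqrt (1 + S.ε ^ 2 * (S.w1 U ^ 2 + S.w2 U ^ 2))

/-- Components of the velocity `v = w / Γ`. -/
def v1 (U : Fin 3 → ℝ) : ℝ := S.w1 U / S.Gam U
def v2 (U : Fin 3 → ℝ) : ℝ := S.w2 U / S.Gam U

/-- The coefficient matrices of the relativistic Euler equations
`A₀(U)∂ₜU + A₁(U)∂₁U + A₂(U)∂₂U = 0`, first in terms of `ε, Γ, N, c, v₁, v₂`. -/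
def matA0 (ε Γ N c v₁ v₂ : ℝ) : Matrix (Fin 3) (Fin 3) ℝ :=
  !![Γ * (1 - ε ^ 4 * c ^ 2 * (v₁ ^ 2 + v₂ ^ 2)), 2 * ε ^ 2 * N * c ^ 2 * v₁,
        2 * ε ^ 2 * N * c ^ 2 * v₂;
     0, Γ * (1 - ε ^ 2 * v₁ ^ 2), -ε ^ 2 * Γ * v₁ * v₂;
     0, -ε ^ 2 * Γ * v₁ * v₂, Γ * (1 - ε ^ 2 * v₂ ^ 2)]

def matA1 (ε Γ N c v₁ v₂ : ℝ) : Matrix (Fin 3) (Fin 3) ℝ :=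
  !![Γ * v₁ * (1 - ε ^ 4 * c ^ 2 * (v₁ ^ 2 + v₂ ^ 2)), N * c ^ 2 * (1 + ε ^ 2 * v₁ ^ 2),
        ε ^ 2 * v₁ * v₂ * N * c ^ 2;
     N⁻¹ * (1 - ε ^ 2 * v₁ ^ 2), Γ * v₁ * (1 - ε ^ 2 * v₁ ^ 2), -ε ^ 2 * Γ * v₁ ^ 2 * v₂;
     -ε ^ 2 * v₁ * v₂ * N⁻¹, -ε ^ 2 * Γ * v₁ ^ 2 * v₂, Γ * v₁ * (1 - ε ^ 2 * v₂ ^ 2)]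

def matA2 (ε Γ N c v₁ v₂ : ℝ) : Matrix (Fin 3) (Fin 3) ℝ :=
  !![Γ * v₂ * (1 - ε ^ 4 * c ^ 2 * (v₁ ^ 2 + v₂ ^ 2)), ε ^ 2 * v₁ * v₂ * N * c ^ 2,
        N * c ^ 2 * (1 + ε ^ 2 * v₂ ^ 2);
     -ε ^ 2 * v₁ * v₂ * N⁻¹, Γ * v₂ * (1 - ε ^ 2 * v₁ ^ 2), -ε ^ 2 * Γ * v₁ * v₂ ^ 2;
     N⁻¹ * (1 - ε ^ 2 * v₂ ^ 2), -ε ^ 2 * Γ * v₁ * v₂ ^ 2, Γ * v₂ * (1 - ε ^ 2 * v₂ ^ 2)]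

def A0 (U : Fin 3 → ℝ) : Matrix (Fin 3) (Fin 3) ℝ :=
  matA0 S.ε (S.Gam U) (S.N (S.rho (U 0))) (S.c (S.rho (U 0))) (S.v1 U) (S.v2 U)

def A1 (U : Fin 3 → ℝ) : Matrix (Fin 3) (Fin 3) ℝ :=
  matA1 S.ε (S.Gam U) (S.N (S.rho (U 0))) (S.c (S.rho (U 0))) (S.v1 U) (S.v2 U)

def A2 (U : Fin 3 → ℝ) : Matrix (Fin 3) (Fin 3) ℝ :=
  matA2 S.ε (S.Gam U) (S.N (S.rho (U 0))) (S.c (S.rho (U 0))) (S.v1 U) (S.v2 U)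

/-- Background sound speed, `h`, Lorentz factor. -/
def cbar : ℝ := S.c S.ρbar
def hbar : ℝ := S.h S.ρbar
def Gbar : ℝ := 1 / Real.sqrt (1 - S.ε ^ 2 * S.vbar ^ 2)

/-- The background state `(p̄, ± h̄ w̄, 0)` with `w̄ = Γ̄ v̄`; the sign `σ` is `1` or `-1`. -/
def Ubar (σ : ℝ) : Fin 3 → ℝ := ![S.p S.ρbar, σ * (S.hbar * (S.Gbar * S.vbar)), 0]

/-- The Mach number of the background state. -/
def mach : ℝ := |S.vbar| / S.cbar

/-- The critical Mach number. -/
def machCrit : ℝ := Real.sqrt 2 / Real.sqrt (1 + S.ε ^ 2 * S.cbar ^ 2)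

/-! ### The linearized operators -/

/-- The vector of distributional derivatives in the direction `e` on `Ω`. -/
def grad (e : Sp) (V : Sp → Fin 3 → ℂ) (x : Sp) : Fin 3 → ℂ :=
  fun i => weakDeriv Om e (fun z => V z i) x

/-- The interior operator `L'_± = A₀(Ū^±)∂ₜ + A₁(Ū^±)∂₁ ± A₂(Ū^±)∂₂` on `Ω` (`σ = ±1`). -/
def linL (σ : ℝ) (V : Sp → Fin 3 → ℂ) (x : Sp) : Fin 3 → ℂ :=
  (S.A0 (S.Ubar σ)).map Complex.ofReal *ᵥ grad (et, 0) V x +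
    (S.A1 (S.Ubar σ)).map Complex.ofReal *ᵥ grad (e1, 0) V x +
      (σ • S.A2 (S.Ubar σ)).map Complex.ofReal *ᵥ grad (0, 1) V x

/-- The coefficient of `∇ψ = (∂ₜψ, ∂₁ψ)` in the linearized boundary operator. -/
def bMat : Matrix (Fin 3) (Fin 2) ℝ :=
  !![0, 2 * S.vbar;
     1, S.vbar;
     0, 0]

/-- The coefficient of `V^nc = (V₁⁺, V₃⁺, V₁⁻, V₃⁻)` in the linearized boundary operator. -/
def BMat : Matrix (Fin 3) (Fin 4) ℝ :=
  !![0, -(S.hbar * S.Gbar)⁻¹, 0, (S.hbar * S.Gbar)⁻¹;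
     0, -(S.hbar * S.Gbar)⁻¹, 0, 0;
     1, 0, -1, 0]

/-- The boundary operator `B'(V^nc, ψ) = b̄ ∇ψ + B̄ V^nc` on `ℝ²`. -/
def linB (Vnc : Bd → Fin 4 → ℂ) (ψ : Bd → ℂ) (y : Bd) : Fin 3 → ℂ :=
  S.bMat.map Complex.ofReal *ᵥ ![weakDeriv univ et ψ y, weakDeriv univ e1 ψ y] +
    S.BMat.map Complex.ofReal *ᵥ Vnc y

end Sheet

/-- The trace on `{x₂ = 0}` of the noncharacteristic part `(V₁⁺, V₃⁺, V₁⁻, V₃⁻)`. -/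
def trNc (Vp Vm : Sp → Fin 3 → ℂ) (y : Bd) : Fin 4 → ℂ :=
  ![trace (fun x => Vp x 0) y, trace (fun x => Vp x 2) y,
    trace (fun x => Vm x 0) y, trace (fun x => Vm x 2) y]

/-! ### The operators above are the linearization of the nonlinear problem

The nonlinear operators are written in terms of the values of the unknowns and of their first
derivatives at a point; `U_θ = Ū + θV`, `Φ_θ = ± x₂ + θΨ`, `φ_θ = θψ`. -/

namespace Sheet

variable (S : Sheet)

/-- Nonlinear interior operator
`A₀(U)∂ₜU + A₁(U)∂₁U + (∂₂Φ)⁻¹ (A₂(U) - ∂ₜΦ A₀(U) - ∂₁Φ A₁(U)) ∂₂U`. -/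
def nonlinL (U Ut U1 U2 : Fin 3 → ℝ) (Φt Φ1 Φ2 : ℝ) : Fin 3 → ℝ :=
  S.A0 U *ᵥ Ut + S.A1 U *ᵥ U1 + (1 / Φ2) • ((S.A2 U - Φt • S.A0 U - Φ1 • S.A1 U) *ᵥ U2)

/-- Nonlinear boundary operator
`([v₁]∂₁φ - [v₂], ∂ₜφ + v₁⁺∂₁φ - v₂⁺, p⁺ - p⁻)`. -/
def nonlinB (Up Um : Fin 3 → ℝ) (φt φ1 : ℝ) : Fin 3 → ℝ :=
  ![(S.v1 Up - S.v1 Um) * φ1 - (S.v2 Up - S.v2 Um), φt + S.v1 Up * φ1 - S.v2 Up, Up 0 - Um 0]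

variable {S}

theorem isOpen_dom : IsOpen S.dom := by
  have h1 : IsOpen {ρ : ℝ | S.ρlo < ρ} := isOpen_lt continuous_const continuous_id
  have h2 : IsOpen {ρ : ℝ | (ρ : EReal) < S.ρhi} :=
    isOpen_lt continuous_coe_real_ereal continuous_const
  exact h1.inter h2

theorem ordConnected_dom : S.dom.OrdConnected :=
  ⟨fun _ hx _ hy _ hz => ⟨lt_of_lt_of_le hx.1 hz.1,
    lt_of_le_of_lt (EReal.coe_le_coe_iff.2 hz.2) hy.2⟩⟩

theorem Physical.strictMonoOn (hS : S.Physical) : StrictMonoOn S.p S.dom :=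
  strictMonoOn_of_deriv_pos ordConnected_dom.convex hS.smooth.continuousOn
    (fun x hx => hS.dp_pos x (interior_subset hx))

theorem Physical.rho_p (hS : S.Physical) {ρ : ℝ} (hρ : ρ ∈ S.dom) : S.rho (S.p ρ) = ρ :=
  hS.strictMonoOn.injOn.leftInvOn_invFunOn hρ

theorem Physical.continuousAt_rho (hS : S.Physical) : ContinuousAt S.rho (S.p S.ρbar) := by
  have hd : S.dom ∈ 𝓝 S.ρbar := isOpen_dom.mem_nhds hS.rho_mem
  have hsd : HasStrictDerivAt S.p (deriv S.p S.ρbar) S.ρbar :=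
    (hS.smooth.contDiffAt hd).hasStrictDerivAt (by simp)
  have hne := (hS.dp_pos _ hS.rho_mem).ne'
  have hmap : map S.p (𝓝 S.ρbar) = 𝓝 (S.p S.ρbar) := hsd.map_nhds_eq hne
  have hev : ∀ᶠ ρ in 𝓝 S.ρbar, S.rho (S.p ρ) = ρ :=
    Filter.mem_of_superset hd (fun ρ hρ => hS.rho_p hρ)
  unfold ContinuousAt
  rw [hS.rho_p hS.rho_mem, ← hmap, tendsto_map'_iff]
  exact tendsto_id.congr' (hev.mono fun ρ hρ => hρ.symm)

theorem Physical.denom_pos (hS : S.Physical) {ρ : ℝ} (hρ : ρ ∈ S.dom) :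
    0 < ρ + S.ε ^ 2 * S.p ρ := by
  have := hS.p_pos ρ hρ
  have := hS.lo_nonneg
  have := hρ.1
  have := hS.eps_pos
  have : 0 < ρ := by linarith
  positivity

theorem Physical.continuousAt_p (hS : S.Physical) : ContinuousAt S.p S.ρbar :=
  hS.smooth.continuousOn.continuousAt (isOpen_dom.mem_nhds hS.rho_mem)

theorem Physical.continuousAt_c (hS : S.Physical) : ContinuousAt S.c S.ρbar :=
  ((hS.smooth.continuousOn_deriv_of_isOpen isOpen_dom (by simp)).continuousAt
    (isOpen_dom.mem_nhds hS.rho_mem)).sqrt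

theorem Physical.continuousAt_N (hS : S.Physical) : ContinuousAt S.N S.ρbar := by
  have hc : ContinuousOn (fun s => 1 / (s + S.ε ^ 2 * S.p s)) S.dom :=
    continuousOn_const.div
      (continuousOn_id.add (continuousOn_const.mul hS.smooth.continuousOn))
      (fun s hs => (hS.denom_pos hs).ne')
  have hd : HasDerivAt (fun ρ => ∫ s in S.ρbar..ρ, 1 / (s + S.ε ^ 2 * S.p s)) _ S.ρbar :=
    intervalIntegral.integral_hasDerivAt_right (by simp)
      (hc.stronglyMeasurableAtFilter isOpen_dom _ hS.rho_mem)
      (hc.continuousAt (isOpen_dom.mem_nhds hS.rho_mem))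
  exact hd.continuousAt.rexp

theorem N_rhobar : S.N S.ρbar = 1 := by simp [N]

theorem Physical.hbar_pos (hS : S.Physical) : 0 < S.hbar := by
  have := hS.denom_pos hS.rho_mem
  simpa [hbar, h, N_rhobar] using this

theorem Physical.continuousAt_h (hS : S.Physical) : ContinuousAt S.h S.ρbar :=
  (continuousAt_id.add (continuousAt_const.mul hS.continuousAt_p)).div hS.continuousAt_N
    (by simp [N_rhobar])

theorem Physical.rad_pos (hS : S.Physical) : 0 < 1 - S.ε ^ 2 * S.vbar ^ 2 := by
  have h0 := hS.eps_pos
  have h1 := hS.vbar_pos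
  have h3 : S.ε * S.vbar < 1 := by
    have := mul_lt_mul_of_pos_left hS.vbar_lt h0
    rwa [mul_inv_cancel₀ h0.ne'] at this
  have h4 : 0 < S.ε * S.vbar := by positivity
  nlinarith

theorem Physical.Gbar_pos (hS : S.Physical) : 0 < S.Gbar := by
  have := hS.rad_pos
  unfold Gbar
  positivity

theorem Physical.Gbar_sq (hS : S.Physical) :
    1 + S.ε ^ 2 * (S.Gbar * S.vbar) ^ 2 = S.Gbar ^ 2 := by
  have h := hS.rad_pos
  have hs : S.Gbar ^ 2 = 1 / (1 - S.ε ^ 2 * S.vbar ^ 2) := by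
    rw [Gbar, div_pow, Real.sq_sqrt h.le, one_pow]
  rw [mul_pow, hs]
  field_simp
  ring

theorem sq_eq_one_of {σ : ℝ} (hσ : σ = 1 ∨ σ = -1) : σ ^ 2 = 1 := by
  rcases hσ with rfl | rfl <;> norm_num

theorem Physical.rho_Ubar (hS : S.Physical) (σ : ℝ) : S.rho (S.Ubar σ 0) = S.ρbar := by
  simpa [Ubar] using hS.rho_p hS.rho_mem

theorem Physical.w1_Ubar (hS : S.Physical) (σ : ℝ) :
    S.w1 (S.Ubar σ) = σ * (S.Gbar * S.vbar) := by
  have := hS.hbar_pos.ne'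
  rw [w1, hS.rho_Ubar, ← hbar]
  simp only [Ubar, Matrix.cons_val_one, Matrix.cons_val_zero]
  field_simp

theorem w2_Ubar (σ : ℝ) : S.w2 (S.Ubar σ) = 0 := by
  simp [w2, Ubar]

theorem Physical.Gam_Ubar (hS : S.Physical) {σ : ℝ} (hσ : σ = 1 ∨ σ = -1) :
    S.Gam (S.Ubar σ) = S.Gbar := by
  rw [Gam, hS.w1_Ubar, w2_Ubar, mul_pow, sq_eq_one_of hσ, one_mul, zero_pow two_ne_zero, add_zero,
    hS.Gbar_sq, Real.sqrt_sq hS.Gbar_pos.le]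

theorem Physical.v1_Ubar (hS : S.Physical) {σ : ℝ} (hσ : σ = 1 ∨ σ = -1) :
    S.v1 (S.Ubar σ) = σ * S.vbar := by
  have := hS.Gbar_pos.ne'
  rw [v1, hS.w1_Ubar, hS.Gam_Ubar hσ]
  field_simp

theorem v2_Ubar (σ : ℝ) : S.v2 (S.Ubar σ) = 0 := by
  simp [v2, w2_Ubar]

theorem Gam_pos (U : Fin 3 → ℝ) : 0 < S.Gam U := by
  unfold Gam
  positivity

theorem Physical.contAt_comp_rho (hS : S.Physical) (σ : ℝ) {f : ℝ → ℝ}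
    (hf : ContinuousAt f S.ρbar) :
    ContinuousAt (fun U : Fin 3 → ℝ => f (S.rho (U 0))) (S.Ubar σ) := by
  have h1 : ContinuousAt (fun U : Fin 3 → ℝ => S.rho (U 0)) (S.Ubar σ) :=
    ContinuousAt.comp (f := fun U : Fin 3 → ℝ => U 0) (g := S.rho)
      (by simpa [Ubar] using hS.continuousAt_rho) (continuous_apply 0).continuousAt
  exact ContinuousAt.comp (f := fun U : Fin 3 → ℝ => S.rho (U 0)) (g := f)
    (by simpa only [hS.rho_Ubar] using hf) h1

theorem Physical.h_ne (hS : S.Physical) (σ : ℝ) : S.h (S.rho (S.Ubar σ 0)) ≠ 0 := by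
  rw [hS.rho_Ubar]
  exact hS.hbar_pos.ne'

theorem Physical.contAt_Gam (hS : S.Physical) (σ : ℝ) : ContinuousAt S.Gam (S.Ubar σ) := by
  have hh := hS.contAt_comp_rho σ hS.continuousAt_h
  have h0 := hS.h_ne σ
  have a1 : ContinuousAt S.w1 (S.Ubar σ) := (continuous_apply 1).continuousAt.div hh h0
  have a2 : ContinuousAt S.w2 (S.Ubar σ) := (continuous_apply 2).continuousAt.div hh h0
  unfold Gam
  fun_prop

theorem Physical.contAt_v1 (hS : S.Physical) (σ : ℝ) : ContinuousAt S.v1 (S.Ubar σ) :=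
  ((continuous_apply 1).continuousAt.div (hS.contAt_comp_rho σ hS.continuousAt_h)
    (hS.h_ne σ)).div (hS.contAt_Gam σ) (Gam_pos _).ne'

theorem Physical.contAt_v2 (hS : S.Physical) (σ : ℝ) : ContinuousAt S.v2 (S.Ubar σ) :=
  ((continuous_apply 2).continuousAt.div (hS.contAt_comp_rho σ hS.continuousAt_h)
    (hS.h_ne σ)).div (hS.contAt_Gam σ) (Gam_pos _).ne'

theorem Physical.contAt_A (hS : S.Physical) (σ : ℝ) : ContinuousAt S.A0 (S.Ubar σ) ∧
    ContinuousAt S.A1 (S.Ubar σ) ∧ ContinuousAt S.A2 (S.Ubar σ) := by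
  have hN := hS.contAt_comp_rho σ hS.continuousAt_N
  have hc := hS.contAt_comp_rho σ hS.continuousAt_c
  have hG := hS.contAt_Gam σ
  have h1 := hS.contAt_v1 σ
  have h2 := hS.contAt_v2 σ
  have hN0 : S.N (S.rho (S.Ubar σ 0)) ≠ 0 := (Real.exp_pos _).ne'
  have hi := hN.inv₀ hN0
  refine ⟨?_, ?_, ?_⟩ <;> refine continuousAt_pi.2 fun i => continuousAt_pi.2 fun j => ?_ <;>
    fin_cases i <;> fin_cases j <;>
    simp only [A0, A1, A2, matA0, matA1, matA2, Matrix.of_apply, Matrix.cons_val, Fin.mk_one,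
      Fin.zero_eta, Fin.reduceFinMk, Fin.isValue] <;>
    fun_prop

/-- If `K` is continuous at `0`, then `θ ↦ θ K(θ)` has derivative `K(0)` at `0`. -/
theorem hasDerivAt_smul_zero {K : ℝ → Fin 3 → ℝ} (hK : ContinuousAt K 0) :
    HasDerivAt (fun θ : ℝ => θ • K θ) (K 0) 0 := by
  rw [hasDerivAt_iff_tendsto_slope]
  refine (hK.tendsto.mono_left nhdsWithin_le_nhds).congr' ?_
  filter_upwards [self_mem_nhdsWithin] with θ hθ
  have hθ : θ ≠ 0 := hθ
  simp [slope, hθ]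

theorem Physical.contAt_line (σ : ℝ) (V : Fin 3 → ℝ) {X : Type*} [TopologicalSpace X]
    {F : (Fin 3 → ℝ) → X} (hF : ContinuousAt F (S.Ubar σ)) :
    ContinuousAt (fun θ : ℝ => F (S.Ubar σ + θ • V)) 0 :=
  ContinuousAt.comp (f := fun θ : ℝ => S.Ubar σ + θ • V) (g := F) (by simpa using hF)
    (by fun_prop)

/-- The linearization at the background state of the interior operator. -/
theorem Physical.hasDerivAt_nonlinL (hS : S.Physical) {σ : ℝ} (hσ : σ = 1 ∨ σ = -1)
    (V Vt V1 V2 : Fin 3 → ℝ) (Ψt Ψ1 Ψ2 : ℝ) :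
    HasDerivAt (fun θ : ℝ => S.nonlinL (S.Ubar σ + θ • V) (θ • Vt) (θ • V1) (θ • V2)
        (θ * Ψt) (θ * Ψ1) (σ + θ * Ψ2))
      (S.A0 (S.Ubar σ) *ᵥ Vt + S.A1 (S.Ubar σ) *ᵥ V1 + (σ • S.A2 (S.Ubar σ)) *ᵥ V2) 0 := by
  obtain ⟨c0, c1, c2⟩ := hS.contAt_A σ
  have c0 := Physical.contAt_line σ V c0
  have c1 := Physical.contAt_line σ V c1
  have c2 := Physical.contAt_line σ V c2
  have hne : σ + 0 * Ψ2 ≠ 0 := by rcases hσ with rfl | rfl <;> norm_num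
  have hinv : ContinuousAt (fun θ : ℝ => 1 / (σ + θ * Ψ2)) 0 :=
    continuousAt_const.div (by fun_prop) hne
  have mv : ∀ {M : ℝ → Matrix (Fin 3) (Fin 3) ℝ} (W : Fin 3 → ℝ), ContinuousAt M 0 →
      ContinuousAt (fun θ => M θ *ᵥ W) 0 := fun {M} W hM =>
    ContinuousAt.comp (f := M) (g := fun A : Matrix (Fin 3) (Fin 3) ℝ => A *ᵥ W)
      (Continuous.matrix_mulVec continuous_id continuous_const).continuousAt hM
  have hK : ContinuousAt (fun θ : ℝ => S.nonlinL (S.Ubar σ + θ • V) Vt V1 V2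
      (θ * Ψt) (θ * Ψ1) (σ + θ * Ψ2)) 0 :=
    ((mv Vt c0).add (mv V1 c1)).add (hinv.smul (mv V2
      ((c2.sub ((continuousAt_id.mul (continuousAt_const (y := Ψt))).smul c0)).sub
        ((continuousAt_id.mul (continuousAt_const (y := Ψ1))).smul c1))))
  have key := hasDerivAt_smul_zero hK
  convert key using 1
  · funext θ
    simp only [nonlinL, Matrix.mulVec_smul, smul_add]
    rw [smul_comm θ]
  · rcases hσ with rfl | rfl <;> simp [nonlinL, Matrix.neg_mulVec]

/-- The linearization at the background state of the boundary operator. -/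
theorem Physical.hasDerivAt_nonlinB (hS : S.Physical) (Vp Vm : Fin 3 → ℝ) (ψt ψ1 : ℝ) :
    HasDerivAt (fun θ : ℝ => S.nonlinB (S.Ubar 1 + θ • Vp) (S.Ubar (-1) + θ • Vm)
        (θ * ψt) (θ * ψ1))
      (S.bMat *ᵥ ![ψt, ψ1] + S.BMat *ᵥ ![Vp 0, Vp 2, Vm 0, Vm 2]) 0 := by
  have hG : ∀ (σ : ℝ) (V : Fin 3 → ℝ), ContinuousAt (fun θ : ℝ =>
      ((S.h (S.rho ((S.Ubar σ + θ • V) 0))) * S.Gam (S.Ubar σ + θ • V))⁻¹) 0 := fun σ V =>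
    Physical.contAt_line σ V (F := fun U => (S.h (S.rho (U 0)) * S.Gam U)⁻¹)
      (((hS.contAt_comp_rho σ hS.continuousAt_h).mul (hS.contAt_Gam σ)).inv₀
        (mul_ne_zero (hS.h_ne σ) (Gam_pos _).ne'))
  have hv : ∀ (σ : ℝ) (V : Fin 3 → ℝ), ContinuousAt (fun θ : ℝ => S.v1 (S.Ubar σ + θ • V)) 0 :=
    fun σ V => Physical.contAt_line σ V (hS.contAt_v1 σ)
  have a1 := hv 1 Vp
  have a2 := hv (-1) Vm
  have b1 := hG 1 Vp
  have b2 := hG (-1) Vm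
  have hK : ContinuousAt (fun θ : ℝ =>
      ![(S.v1 (S.Ubar 1 + θ • Vp) - S.v1 (S.Ubar (-1) + θ • Vm)) * ψ1 -
          (((S.h (S.rho ((S.Ubar 1 + θ • Vp) 0))) * S.Gam (S.Ubar 1 + θ • Vp))⁻¹ * Vp 2 -
          ((S.h (S.rho ((S.Ubar (-1) + θ • Vm) 0))) * S.Gam (S.Ubar (-1) + θ • Vm))⁻¹ * Vm 2),
        ψt + S.v1 (S.Ubar 1 + θ • Vp) * ψ1 -
          ((S.h (S.rho ((S.Ubar 1 + θ • Vp) 0))) * S.Gam (S.Ubar 1 + θ • Vp))⁻¹ * Vp 2,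
        Vp 0 - Vm 0]) 0 := by
    refine continuousAt_pi.2 fun i => ?_
    fin_cases i
    · exact ((a1.sub a2).mul continuousAt_const).sub
        ((b1.mul continuousAt_const).sub (b2.mul continuousAt_const))
    · exact (continuousAt_const.add (a1.mul continuousAt_const)).sub (b1.mul continuousAt_const)
    · exact continuousAt_const
  have key := hasDerivAt_smul_zero hK
  convert key using 1
  · funext θ
    have e : ∀ (σ : ℝ) (V : Fin 3 → ℝ), S.v2 (S.Ubar σ + θ • V) =
        θ * (((S.h (S.rho ((S.Ubar σ + θ • V) 0))) * S.Gam (S.Ubar σ + θ • V))⁻¹ * V 2) := by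
      intro σ V
      have : (S.Ubar σ + θ • V) 2 = θ * V 2 := by simp [Ubar]
      rw [v2, w2, this, div_div, div_eq_mul_inv]
      ring
    funext i
    fin_cases i
    · simp only [nonlinB, e]
      simp
      ring
    · simp only [nonlinB, e]
      simp
      ring
    · simp only [nonlinB]
      simp [Ubar]
      ring
  · have g1 := hS.Gam_Ubar (σ := 1) (Or.inl rfl)
    have g2 := hS.Gam_Ubar (σ := -1) (Or.inr rfl)
    have u1 := hS.v1_Ubar (σ := 1) (Or.inl rfl)
    have u2 := hS.v1_Ubar (σ := -1) (Or.inr rfl)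
    have r1 := hS.rho_Ubar 1
    have r2 := hS.rho_Ubar (-1)
    simp only [zero_smul, add_zero, g1, g2, u1, u2, r1, r2]
    funext i
    fin_cases i
    · simp [bMat, BMat, hbar]
      ring
    · simp [bMat, BMat, hbar]
      ring
    · simp [bMat, BMat, hbar]
      ring

end Sheet

end VortexSheet

end

/-!
# The linearized relativistic vortex sheet: the a priori estimate with constant coefficients

The coefficients are constant, so after multiplication by `exp (-γ t)` and Fourier transformation in
`(t, x₁)` the estimate decouples into estimates, uniform in the frequency, for systems of ordinary
differential equations in the normal variable (`exists_frequency_bound`). Plancherel's theorem then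
gives the result by integration over the frequencies.

Let `τ = γ + i δ` and `η` be dual to `t` and `x₁`, let `Λ` be the size of `(τ, η)`, and let
`κ = Γ² (c⁻² - ε²)`, where `Γ`, `c`, `v` are the Lorentz factor, the sound speed and the flow speed
of the background. The pressure `u` and the normal velocity `z` on the two sides involve the normal
wave numbers `r±` with `r±² = η² + ε² τ² + κ (τ ± i v η)²`, whose real parts are at least
`√(ε² + κ) γ` (`exists_sqrt_re_ge`). The combinations `r± u± ∓ Γ (τ ± i v η) z±` are growing modes:
their equation is `g' = r± g + source`, and since the solution is square integrable, their boundary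
values are controlled by the sources (`exists_growing_trace_bound`).

These two relations and the three boundary conditions are five linear equations for the traces
`u±`, `z±` and the front `ψ`. Their determinant is, up to a constant factor,
`Δ = r₊ (τ - i v η)² + r₋ (τ + i v η)²`, and it satisfies
`Δ (η² + ε² τ² + r₊ r₋) = Q (r₊ + r₋)` with a homogeneous quartic `Q` in `(τ, η)`. The supersonic
hypothesis is equivalent to `2 < κ v²`, and under it `Q` has four distinct imaginary roots
`τ = ± i l₁ η, ± i l₂ η` (`exists_quartic_roots`); the sum `r₊ + r₋` contributes one more, `τ = 0`.
As these are simple, `|Δ| ≥ C⁻¹ γ Λ²` (`exists_le_norm_lopatinskii`), so the boundary values are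
estimated with the loss of one factor `Λ / γ` (`exists_boundary_bound`), which is the loss of one
derivative in the theorem. The energy estimate of the symmetrized system (`exists_energy_bound`)
extends the bound to the interior.

The passage to the Fourier side has to respect that derivatives and traces are weak: the partial
Fourier transform turns tangential weak derivatives into multiplications
(`partialFourier_tangential`), and Green's formula, which defines the trace, says that the transform
is absolutely continuous in the normal variable with the transformed trace as its boundary value
(`partialFourier_normal`).
-/

noncomputable section

namespace VortexSheet

/-! ### Normal wave numbers and the Lopatinskii determinant -/

/-- The root with positive real part of the characteristic equation in the normal variable: its real
part grows at least linearly in `Re τ`, uniformly in the frequency. The condition `|ε v| < 1`, a flow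
slower than light, makes the real and imaginary parts of the equation compatible with this bound
through the inequality `(ε² + κ) q ≤ m²`. -/
theorem exists_sqrt_re_ge {ε κ v : ℝ} (hκ : 0 < κ) (hv : ε ^ 2 * v ^ 2 < 1)
    {τ : ℂ} (hτ : 0 < τ.re) (η : ℝ) :
    ∃ r : ℂ, r ^ 2 = (η : ℂ) ^ 2 + ε ^ 2 * τ ^ 2 + κ * (τ + Complex.I * v * η) ^ 2 ∧
      Real.sqrt (ε ^ 2 + κ) * τ.re ≤ r.re := by
  obtain ⟨r, hr, hr0⟩ : ∃ r : ℂ, r ^ 2 =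
      (η : ℂ) ^ 2 + ε ^ 2 * τ ^ 2 + κ * (τ + Complex.I * v * η) ^ 2 ∧ 0 ≤ r.re := by
    obtain ⟨r, hr⟩ := IsAlgClosed.exists_pow_nat_eq
      ((η : ℂ) ^ 2 + ε ^ 2 * τ ^ 2 + κ * (τ + Complex.I * v * η) ^ 2) two_pos
    rcases le_total 0 r.re with h | h
    · exact ⟨r, hr, h⟩
    · exact ⟨-r, by rw [neg_sq, hr], by simpa using h⟩
  refine ⟨r, hr, ?_⟩
  have hre := congrArg Complex.re hr
  have him := congrArg Complex.im hr
  simp [pow_two] at hre him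
  set a := r.re
  set b := r.im
  set g := τ.re
  set d := τ.im
  set m : ℝ := ε ^ 2 * d + κ * (d + v * η) with hm
  set q : ℝ := ε ^ 2 * d ^ 2 + κ * (d + v * η) ^ 2 - η ^ 2 with hq
  have hθ : 0 < ε ^ 2 + κ := by positivity
  have h1 : a ^ 2 - b ^ 2 = (ε ^ 2 + κ) * g ^ 2 - q := by rw [hq]; linarith
  have h2 : a * b = g * m := by rw [hm]; linarith
  have h3 : (ε ^ 2 + κ) * q ≤ m ^ 2 := by
    have : m ^ 2 - (ε ^ 2 + κ) * q = η ^ 2 * (ε ^ 2 + κ * (1 - ε ^ 2 * v ^ 2)) := by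
      rw [hm, hq]; ring
    have : 0 ≤ η ^ 2 * (ε ^ 2 + κ * (1 - ε ^ 2 * v ^ 2)) := by
      have : 0 ≤ κ * (1 - ε ^ 2 * v ^ 2) := mul_nonneg hκ.le (by linarith)
      positivity
    linarith
  -- With `r = a + i b`, eliminating `b` from the real and imaginary parts of the equation gives a
  -- quadratic relation for `a ^ 2`, which is solved through this factorization.
  have h4 : 0 ≤ (a ^ 2 - (ε ^ 2 + κ) * g ^ 2) * ((ε ^ 2 + κ) * a ^ 2 + m ^ 2) := by
    have e : (a ^ 2 - (ε ^ 2 + κ) * g ^ 2) * ((ε ^ 2 + κ) * a ^ 2 + m ^ 2) =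
        a ^ 2 * (m ^ 2 - (ε ^ 2 + κ) * q) := by
      have : b ^ 2 = a ^ 2 - ((ε ^ 2 + κ) * g ^ 2 - q) := by linarith
      have h5 : a ^ 2 * (a ^ 2 - ((ε ^ 2 + κ) * g ^ 2 - q)) = g ^ 2 * m ^ 2 := by
        rw [← this, ← mul_pow, h2, mul_pow]
      linear_combination (ε ^ 2 + κ) * h5
    rw [e]
    exact mul_nonneg (sq_nonneg _) (by linarith)
  have ha : 0 < a := by
    refine lt_of_le_of_ne hr0 fun h0 => ?_
    rw [← h0] at h2 h1
    have hm0 : m = 0 := by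
      have : g * m = 0 := by linarith
      exact (mul_eq_zero.1 this).resolve_left hτ.ne'
    rw [hm0] at h3
    nlinarith [mul_pos hθ (pow_pos hτ 2), sq_nonneg b]
  have h5 : (ε ^ 2 + κ) * g ^ 2 ≤ a ^ 2 := by
    by_contra hlt
    push Not at hlt
    have : 0 < (ε ^ 2 + κ) * a ^ 2 + m ^ 2 := by positivity
    nlinarith
  refine (pow_le_pow_iff_left₀ (by positivity) ha.le two_ne_zero).1 ?_
  rw [mul_pow, Real.sq_sqrt hθ.le]
  exact h5

/-- The quartic factor of the Lopatinskii determinant has, in the supersonic regime `2 < κ v²`, only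
the purely imaginary simple roots `τ = ±i l₁ η`, `τ = ±i l₂ η`. As a quadratic in `τ²` it has
positive coefficients (its constant term by the supersonic condition) and positive discriminant. -/
theorem exists_quartic_roots {ε κ v : ℝ} (hκ : 0 < κ) (hv0 : 0 < v)
    (hv : ε ^ 2 * v ^ 2 < 1) (hm : 2 < κ * v ^ 2) :
    ∃ l₁ l₂ : ℝ, 0 < l₁ ∧ 0 < l₂ ∧ l₁ ≠ l₂ ∧ ∀ τ η : ℂ,
      2 * (τ ^ 2 - v ^ 2 * η ^ 2) * (η ^ 2 + ε ^ 2 * τ ^ 2) + κ * (τ ^ 2 + v ^ 2 * η ^ 2) ^ 2 =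
        (κ + 2 * ε ^ 2) * (τ ^ 2 + l₁ ^ 2 * η ^ 2) * (τ ^ 2 + l₂ ^ 2 * η ^ 2) := by
  set A : ℝ := κ + 2 * ε ^ 2 with hA
  set B : ℝ := 1 - ε ^ 2 * v ^ 2 + κ * v ^ 2 with hB
  set Q : ℝ := v ^ 2 * (κ * v ^ 2 - 2) with hQ
  have hA0 : 0 < A := by positivity
  have hB0 : 0 < B := by nlinarith
  have hQ0 : 0 < Q := mul_pos (by positivity) (by linarith)
  have hdisc : 0 < B ^ 2 - A * Q := by
    have : B ^ 2 - A * Q = (1 + ε ^ 2 * v ^ 2) ^ 2 + 4 * (κ * v ^ 2) * (1 - ε ^ 2 * v ^ 2) := by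
      rw [hA, hB, hQ]; ring
    rw [this]
    have : 0 < κ * v ^ 2 * (1 - ε ^ 2 * v ^ 2) := mul_pos (by linarith) (by linarith)
    nlinarith [sq_nonneg (1 + ε ^ 2 * v ^ 2)]
  set s := Real.sqrt (B ^ 2 - A * Q) with hs
  have hs0 : 0 < s := Real.sqrt_pos.2 hdisc
  have hs2 : s ^ 2 = B ^ 2 - A * Q := Real.sq_sqrt hdisc.le
  have hsB : s < B := by nlinarith [mul_pos hA0 hQ0]
  have h1 : 0 < (B - s) / A := div_pos (by linarith) hA0
  have h2 : 0 < (B + s) / A := div_pos (by linarith) hA0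
  refine ⟨Real.sqrt ((B - s) / A), Real.sqrt ((B + s) / A), Real.sqrt_pos.2 h1, Real.sqrt_pos.2 h2,
    ?_, fun τ η => ?_⟩
  · intro h
    have := (Real.sqrt_inj h1.le h2.le).1 h
    rw [div_left_inj' hA0.ne'] at this
    linarith
  · have e1 : ((Real.sqrt ((B - s) / A) : ℝ) : ℂ) ^ 2 = ((B - s) / A : ℝ) := by
      rw [← Complex.ofReal_pow, Real.sq_sqrt h1.le]
    have e2 : ((Real.sqrt ((B + s) / A) : ℝ) : ℂ) ^ 2 = ((B + s) / A : ℝ) := by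
      rw [← Complex.ofReal_pow, Real.sq_sqrt h2.le]
    rw [e1, e2]
    have hA' : (A : ℂ) ≠ 0 := by exact_mod_cast hA0.ne'
    have e3 : (κ + 2 * ε ^ 2 : ℂ) = A := by rw [hA]; push_cast; ring
    have e4 : (s : ℂ) ^ 2 = (B : ℂ) ^ 2 - A * Q := by exact_mod_cast hs2
    have e5 : (B : ℂ) = 1 - ε ^ 2 * v ^ 2 + κ * v ^ 2 := by rw [hB]; push_cast; ring
    have e6 : (Q : ℂ) = v ^ 2 * (κ * v ^ 2 - 2) := by rw [hQ]; push_cast; ring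
    have e7 : (A : ℂ) * (τ ^ 2 + ((B - s) / A : ℝ) * η ^ 2) * (τ ^ 2 + ((B + s) / A : ℝ) * η ^ 2) =
        A * τ ^ 4 + 2 * B * τ ^ 2 * η ^ 2 + Q * η ^ 4 := by
      push_cast
      field_simp
      linear_combination (-η ^ 4) * e4
    rw [e3, e7, e5, e6, ← e3]
    ring

/-- Distinct purely imaginary slopes: `τ - iλη` and `τ - iμη` are not both small. -/
theorem eventually_le_factor_add_factor {l m : ℝ} (hlm : l ≠ m) :
    ∀ᶠ c in 𝓝[>] (0 : ℝ), ∀ (τ : ℂ) (η Λ : ℝ), Λ ≤ ‖τ‖ + |η| →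
      c * Λ ≤ ‖τ - Complex.I * l * η‖ + ‖τ - Complex.I * m * η‖ := by
  have hd : 0 < |l - m| := abs_pos.2 (sub_ne_zero.2 hlm)
  set K : ℝ := 1 + (1 + |l|) / |l - m| with hK
  have hK0 : 0 < K := by positivity
  have : ∀ᶠ c in 𝓝[>] (0 : ℝ), c < K⁻¹ :=
    (gt_mem_nhds (inv_pos.2 hK0)).filter_mono nhdsWithin_le_nhds |>.mono fun _ h => h
  filter_upwards [this, self_mem_nhdsWithin] with c hc hc0 τ η Λ hΛ
  have hc0 : 0 < c := hc0
  set x := ‖τ - Complex.I * l * η‖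
  set y := ‖τ - Complex.I * m * η‖
  have h1 : |l - m| * |η| ≤ x + y := by
    have : (|l - m| * |η|) = ‖(τ - Complex.I * m * η) - (τ - Complex.I * l * η)‖ := by
      rw [show (τ - Complex.I * m * η) - (τ - Complex.I * l * η) =
        Complex.I * ((l - m : ℝ) * (η : ℝ) : ℂ) by push_cast; ring]
      simp only [norm_mul, Complex.norm_I, Complex.norm_real, one_mul, Real.norm_eq_abs]
    rw [this, add_comm]
    exact norm_sub_le _ _
  have h2 : ‖τ‖ ≤ x + |l| * |η| := by
    have h := norm_add_le (τ - Complex.I * l * η) (Complex.I * l * η)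
    simpa using h
  have hx : 0 ≤ x := norm_nonneg _
  have hy : 0 ≤ y := norm_nonneg _
  have h3 : |η| ≤ (x + y) / |l - m| := by rw [le_div_iff₀ hd]; linarith
  have h4 : Λ ≤ K * (x + y) := by
    calc Λ ≤ (x + y) + (1 + |l|) * |η| := by nlinarith
      _ ≤ (x + y) + (1 + |l|) * ((x + y) / |l - m|) := by gcongr
      _ = K * (x + y) := by rw [hK]; ring
  by_cases hΛ0 : 0 ≤ Λ
  · calc c * Λ ≤ K⁻¹ * (K * (x + y)) := by gcongr
      _ = x + y := by field_simp
  · nlinarith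

/-- A product of factors `τ - iλη` with distinct real `λ` vanishes only to first order at the
boundary `Re τ = 0`. -/
theorem exists_le_prod_factors (s : Finset ℝ) (hs : s.Nonempty) :
    ∃ c > 0, ∀ (τ : ℂ) (η Λ : ℝ), 0 < τ.re → ‖τ‖ ≤ Λ → Λ ≤ ‖τ‖ + |η| →
      c * τ.re * Λ ^ (s.card - 1) ≤ ∏ l ∈ s, ‖τ - Complex.I * l * η‖ := by
  have h : ∀ᶠ c in 𝓝[>] (0 : ℝ), ∀ p ∈ s.offDiag, ∀ (τ : ℂ) (η Λ : ℝ), Λ ≤ ‖τ‖ + |η| →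
      c * Λ ≤ ‖τ - Complex.I * p.1 * η‖ + ‖τ - Complex.I * p.2 * η‖ :=
    (Finset.eventually_all _).2 fun p hp =>
      eventually_le_factor_add_factor (Finset.mem_offDiag.1 hp).2.2
  obtain ⟨c, hc, hc0⟩ := (h.and self_mem_nhdsWithin).exists
  have hc0 : 0 < c := hc0
  have hn : s.card = s.card - 1 + 1 := (Nat.succ_pred_eq_of_pos hs.card_pos).symm
  refine ⟨min ((c / 2) ^ s.card) ((c / 2) ^ (s.card - 1)), by positivity,
    fun τ η Λ hτ h1 h2 => ?_⟩
  have hre : τ.re ≤ Λ := (Complex.re_le_norm τ).trans h1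
  have hΛ : 0 < Λ := hτ.trans_le hre
  have hfac : ∀ l : ℝ, τ.re ≤ ‖τ - Complex.I * l * η‖ := fun l => by
    have := Complex.re_le_norm (τ - Complex.I * l * η)
    simpa using this
  -- At most one factor is smaller than `c / 2 * Λ`, and every factor is at least `Re τ`.
  by_cases hall : ∀ l ∈ s, c / 2 * Λ ≤ ‖τ - Complex.I * l * η‖
  · calc _ ≤ (c / 2) ^ s.card * τ.re * Λ ^ (s.card - 1) := by gcongr; exact min_le_left _ _
      _ ≤ (c / 2) ^ s.card * Λ * Λ ^ (s.card - 1) := by gcongr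
      _ = (c / 2 * Λ) ^ s.card := by
        rw [mul_pow, mul_assoc, ← pow_succ', ← hn]
      _ = ∏ l ∈ s, c / 2 * Λ := by simp
      _ ≤ _ := Finset.prod_le_prod (fun _ _ => by positivity) hall
  · push Not at hall
    obtain ⟨l, hl, hlt⟩ := hall
    rw [← Finset.mul_prod_erase s _ hl]
    calc _ ≤ (c / 2) ^ (s.card - 1) * τ.re * Λ ^ (s.card - 1) := by gcongr; exact min_le_right _ _
      _ = τ.re * (c / 2 * Λ) ^ (s.card - 1) := by rw [mul_pow]; ring
      _ = τ.re * ∏ m ∈ s.erase l, c / 2 * Λ := by simp [Finset.card_erase_of_mem hl]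
      _ ≤ _ := by
        refine mul_le_mul (hfac l) (Finset.prod_le_prod (fun _ _ => by positivity) ?_)
          (by positivity) (norm_nonneg _)
        intro m hm
        have := hc (l, m) (Finset.mem_offDiag.2
          ⟨hl, Finset.mem_of_mem_erase hm, (Finset.ne_of_mem_erase hm).symm⟩) τ η Λ h2
        simp only at this
        linarith

theorem norm_add_I_mul_le {τ : ℂ} {η Λ v : ℝ} (hv : 0 ≤ v) (h1 : ‖τ‖ ≤ Λ) (h2 : |η| ≤ Λ) :
    ‖τ + Complex.I * v * η‖ ≤ (1 + v) * Λ ∧ ‖τ - Complex.I * v * η‖ ≤ (1 + v) * Λ := by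
  have h : ‖Complex.I * v * η‖ = v * |η| := by simp [abs_of_nonneg hv]
  have h3 : v * |η| ≤ v * Λ := by gcongr
  exact ⟨(norm_add_le _ _).trans (by rw [h]; linarith),
    (norm_sub_le _ _).trans (by rw [h]; linarith)⟩

theorem norm_root_le {ε κ v : ℝ} (hκ : 0 < κ) {τ D r : ℂ} {η Λ : ℝ}
    (h1 : ‖τ‖ ≤ Λ) (h2 : |η| ≤ Λ) (hD : ‖D‖ ≤ (1 + v) * Λ)
    (hr : r ^ 2 = (η : ℂ) ^ 2 + ε ^ 2 * τ ^ 2 + κ * D ^ 2) :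
    ‖r‖ ≤ Real.sqrt (1 + ε ^ 2 + κ * (1 + v) ^ 2) * Λ := by
  have hΛ : 0 ≤ Λ := (norm_nonneg _).trans h1
  refine (pow_le_pow_iff_left₀ (norm_nonneg _) (by positivity) two_ne_zero).1 ?_
  rw [← norm_pow, hr, mul_pow, Real.sq_sqrt (by positivity)]
  calc _ ≤ ‖(η : ℂ) ^ 2‖ + ‖(ε : ℂ) ^ 2 * τ ^ 2‖ + ‖(κ : ℂ) * D ^ 2‖ := norm_add₃_le
    _ = |η| ^ 2 + ε ^ 2 * ‖τ‖ ^ 2 + κ * ‖D‖ ^ 2 := by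
      simp [abs_of_pos hκ]
    _ ≤ Λ ^ 2 + ε ^ 2 * Λ ^ 2 + κ * ((1 + v) * Λ) ^ 2 := by gcongr
    _ = _ := by ring

/-- The Lopatinskii determinant `r₊ (τ - i v η)² + r₋ (τ + i v η)²`, homogeneous of degree three,
vanishes at most to first order as `Re τ → 0`. Its zeros have the slopes `0, ±l₁, ±l₂`: the last four
come from the quartic factor, and `τ = 0` from `r₊ + r₋`, since
`(r₊ + r₋)(r₊ - r₋) = 4 i v κ η τ`. -/
theorem exists_le_norm_lopatinskii {ε κ v : ℝ} (hκ : 0 < κ) (hv0 : 0 < v)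
    (hv : ε ^ 2 * v ^ 2 < 1) (hm : 2 < κ * v ^ 2) :
    ∃ c > 0, ∀ (τ : ℂ) (η Λ : ℝ) (rp rm : ℂ), 0 < τ.re → ‖τ‖ ≤ Λ → |η| ≤ Λ → Λ ≤ ‖τ‖ + |η| →
      rp ^ 2 = (η : ℂ) ^ 2 + ε ^ 2 * τ ^ 2 + κ * (τ + Complex.I * v * η) ^ 2 →
      rm ^ 2 = (η : ℂ) ^ 2 + ε ^ 2 * τ ^ 2 + κ * (τ - Complex.I * v * η) ^ 2 →
      Real.sqrt (ε ^ 2 + κ) * τ.re ≤ rp.re → Real.sqrt (ε ^ 2 + κ) * τ.re ≤ rm.re →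
      c * τ.re * Λ ^ 2 ≤
        ‖rp * (τ - Complex.I * v * η) ^ 2 + rm * (τ + Complex.I * v * η) ^ 2‖ := by
  obtain ⟨l₁, l₂, hl₁, hl₂, hl, hQ⟩ := exists_quartic_roots hκ hv0 hv hm
  obtain ⟨c₁, hc₁, hprod⟩ := exists_le_prod_factors {0, l₁, -l₁, l₂, -l₂} (by simp)
  set a : ℝ := κ + 2 * ε ^ 2 with ha
  have ha0 : 0 < a := by positivity
  set θ : ℝ := Real.sqrt (ε ^ 2 + κ)
  have hθ : 0 < θ := Real.sqrt_pos.2 (by positivity)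
  set M : ℝ := 1 + ε ^ 2 + κ * (1 + v) ^ 2 with hM
  have hM1 : 1 ≤ M := by
    have : 0 ≤ ε ^ 2 + κ * (1 + v) ^ 2 := by positivity
    linarith
  have hM0 : 0 < M := by linarith
  set e₀ : ℝ := 1 / (2 * (1 + (l₁ + l₂))) with he₀
  have he₀0 : 0 < e₀ := by positivity
  set c₂ : ℝ := min (a * c₁ * (2 * v * κ * e₀ / M)) (a * (1 / 2) ^ 4 * (2 * θ)) with hc₂
  have hc₂0 : 0 < c₂ := by positivity
  refine ⟨c₂ / (2 * M), by positivity, fun τ η Λ rp rm hτ h1 h2 h3 hrp hrm hp hmr => ?_⟩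
  have hΛ : 0 < Λ := hτ.trans_le ((Complex.re_le_norm τ).trans h1)
  obtain ⟨hD1, hD2⟩ := norm_add_I_mul_le hv0.le h1 h2
  have hsM : Real.sqrt M ≤ M := by
    rw [Real.sqrt_le_left hM0.le]; nlinarith
  have n1 := norm_root_le hκ h1 h2 hD1 hrp
  have n2 := norm_root_le hκ h1 h2 hD2 hrm
  have hsq : Real.sqrt M ^ 2 = M := Real.sq_sqrt hM0.le
  rw [← hM] at n1 n2
  set Q : ℂ := 2 * (τ ^ 2 - v ^ 2 * η ^ 2) * (η ^ 2 + ε ^ 2 * τ ^ 2) +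
    κ * (τ ^ 2 + v ^ 2 * η ^ 2) ^ 2 with hQdef
  set Δ := rp * (τ - Complex.I * v * η) ^ 2 + rm * (τ + Complex.I * v * η) ^ 2 with hΔ
  -- The determinant times its bounded cofactor factors through the quartic.
  have key : Δ * (η ^ 2 + ε ^ 2 * τ ^ 2 + rp * rm) = Q * (rp + rm) := by
    have hI : Complex.I ^ 2 = -1 := Complex.I_sq
    have e1 : (τ - Complex.I * v * η) ^ 2 + (τ + Complex.I * v * η) ^ 2 =
        2 * (τ ^ 2 - v ^ 2 * η ^ 2) := by linear_combination 2 * v ^ 2 * η ^ 2 * hI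
    have e2 : (τ - Complex.I * v * η) * (τ + Complex.I * v * η) = τ ^ 2 + v ^ 2 * η ^ 2 := by
      linear_combination -v ^ 2 * η ^ 2 * hI
    rw [hΔ, hQdef, ← e1, ← e2]
    linear_combination (τ - Complex.I * v * η) ^ 2 * rm * hrp +
      (τ + Complex.I * v * η) ^ 2 * rp * hrm
  have hcof : ‖(η : ℂ) ^ 2 + ε ^ 2 * τ ^ 2 + rp * rm‖ ≤ 2 * M * Λ ^ 2 := by
    calc _ ≤ ‖(η : ℂ) ^ 2‖ + ‖(ε : ℂ) ^ 2 * τ ^ 2‖ + ‖rp * rm‖ := norm_add₃_le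
      _ = |η| ^ 2 + ε ^ 2 * ‖τ‖ ^ 2 + ‖rp‖ * ‖rm‖ := by simp
      _ ≤ Λ ^ 2 + ε ^ 2 * Λ ^ 2 + (Real.sqrt M * Λ) * (Real.sqrt M * Λ) := by gcongr
      _ = (1 + ε ^ 2 + M) * Λ ^ 2 := by linear_combination Λ ^ 2 * hsq
      _ ≤ _ := by
        have : 0 ≤ κ * (1 + v) ^ 2 := by positivity
        gcongr
        linarith
  suffices h : c₂ * τ.re * Λ ^ 4 ≤ ‖Q‖ * ‖rp + rm‖ by
    have h5 : ‖Q‖ * ‖rp + rm‖ ≤ ‖Δ‖ * (2 * M * Λ ^ 2) := by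
      rw [← norm_mul, ← key, norm_mul]
      gcongr
    have h6 : c₂ * τ.re * Λ ^ 4 ≤ ‖Δ‖ * (2 * M * Λ ^ 2) := h.trans h5
    have h7 : c₂ / (2 * M) * τ.re * Λ ^ 2 = c₂ * τ.re * Λ ^ 4 / (2 * M * Λ ^ 2) := by
      field_simp
    rw [h7, div_le_iff₀ (by positivity)]
    exact h6
  have hQn : ‖Q‖ = a * (‖τ - Complex.I * l₁ * η‖ * ‖τ - Complex.I * (-l₁ : ℝ) * η‖ *
      (‖τ - Complex.I * l₂ * η‖ * ‖τ - Complex.I * (-l₂ : ℝ) * η‖)) := by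
    have hf : ∀ l : ℝ, τ ^ 2 + (l : ℂ) ^ 2 * η ^ 2 =
        (τ - Complex.I * l * η) * (τ - Complex.I * (-l : ℝ) * η) := fun l => by
      push_cast
      linear_combination (l : ℂ) ^ 2 * η ^ 2 * Complex.I_sq
    rw [hQdef, hQ, hf, hf]
    have : ‖(κ + 2 * ε ^ 2 : ℂ)‖ = a := by
      rw [show (κ + 2 * ε ^ 2 : ℂ) = (a : ℝ) by rw [ha]; push_cast; ring, Complex.norm_real,
        Real.norm_of_nonneg ha0.le]
    simp only [norm_mul, this]
    ring
  -- For `|η|` comparable to `Λ` the factor `r₊ + r₋` contributes the fifth root `τ = 0`; for small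
  -- `|η|` the quartic is elliptic and `Re (r₊ + r₋)` supplies the power of `Re τ`.
  rcases le_or_gt (e₀ * Λ) |η| with hη | hη
  · have h5 := hprod τ η Λ hτ h1 h3
    have p₁ := neg_lt_zero.2 hl₁
    have p₂ := neg_lt_zero.2 hl₂
    have d₁ : (0 : ℝ) ∉ ({l₁, -l₁, l₂, -l₂} : Finset ℝ) := by
      simp only [Finset.mem_insert, Finset.mem_singleton, not_or]
      exact ⟨hl₁.ne, p₁.ne', hl₂.ne, p₂.ne'⟩
    have d₂ : l₁ ∉ ({-l₁, l₂, -l₂} : Finset ℝ) := by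
      simp only [Finset.mem_insert, Finset.mem_singleton, not_or]
      exact ⟨(p₁.trans hl₁).ne', hl, (p₂.trans hl₁).ne'⟩
    have d₃ : -l₁ ∉ ({l₂, -l₂} : Finset ℝ) := by
      simp only [Finset.mem_insert, Finset.mem_singleton, not_or]
      exact ⟨(p₁.trans hl₂).ne, neg_injective.ne hl⟩
    have d₄ : l₂ ∉ ({-l₂} : Finset ℝ) := by
      simp only [Finset.mem_singleton]
      exact (p₂.trans hl₂).ne'
    have hcard : ({0, l₁, -l₁, l₂, -l₂} : Finset ℝ).card = 5 := by
      rw [Finset.card_insert_of_notMem d₁, Finset.card_insert_of_notMem d₂,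
        Finset.card_insert_of_notMem d₃, Finset.card_insert_of_notMem d₄, Finset.card_singleton]
    rw [hcard, Finset.prod_insert d₁, Finset.prod_insert d₂, Finset.prod_insert d₃,
      Finset.prod_insert d₄, Finset.prod_singleton] at h5
    have h6 : a * c₁ * τ.re * Λ ^ 4 ≤ ‖τ‖ * ‖Q‖ := by
      rw [hQn]
      simp only [Complex.ofReal_zero, mul_zero, zero_mul, sub_zero] at h5
      calc a * c₁ * τ.re * Λ ^ 4 = a * (c₁ * τ.re * Λ ^ (5 - 1)) := by norm_num; ring
        _ ≤ _ := mul_le_mul_of_nonneg_left h5 ha0.le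
        _ = _ := by ring
    have h7 : 2 * v * κ * e₀ / M * ‖τ‖ ≤ ‖rp + rm‖ := by
      have e : (rp + rm) * (rp - rm) = (4 * v * κ : ℝ) * (Complex.I * η * τ) := by
        push_cast
        linear_combination hrp - hrm
      have e' : ‖rp + rm‖ * ‖rp - rm‖ = 4 * v * κ * (|η| * ‖τ‖) := by
        rw [← norm_mul, e, norm_mul, Complex.norm_real, Real.norm_of_nonneg (by positivity)]
        simp
      have h8 : ‖rp - rm‖ ≤ 2 * M * Λ := by
        calc _ ≤ ‖rp‖ + ‖rm‖ := norm_sub_le _ _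
          _ ≤ Real.sqrt M * Λ + Real.sqrt M * Λ := add_le_add n1 n2
          _ ≤ M * Λ + M * Λ := by gcongr
          _ = _ := by ring
      have h9 : 4 * v * κ * (e₀ * Λ * ‖τ‖) ≤ ‖rp + rm‖ * (2 * M * Λ) := by
        calc _ ≤ 4 * v * κ * (|η| * ‖τ‖) := by gcongr
          _ = _ := e'.symm
          _ ≤ _ := by gcongr
      have : 2 * v * κ * e₀ / M * ‖τ‖ = 4 * v * κ * (e₀ * Λ * ‖τ‖) / (2 * M * Λ) := by
        field_simp; ring
      rw [this, div_le_iff₀ (by positivity)]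
      exact h9
    calc c₂ * τ.re * Λ ^ 4 ≤ a * c₁ * (2 * v * κ * e₀ / M) * τ.re * Λ ^ 4 := by
          gcongr; exact min_le_left _ _
      _ = 2 * v * κ * e₀ / M * (a * c₁ * τ.re * Λ ^ 4) := by ring
      _ ≤ 2 * v * κ * e₀ / M * (‖τ‖ * ‖Q‖) := by gcongr
      _ = ‖Q‖ * (2 * v * κ * e₀ / M * ‖τ‖) := by ring
      _ ≤ _ := by gcongr
  · have hfac : ∀ l : ℝ, |l| ≤ l₁ + l₂ → 1 / 2 * Λ ≤ ‖τ - Complex.I * l * η‖ := fun l hl => by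
      have h5 : ‖τ‖ ≤ ‖τ - Complex.I * l * η‖ + |l| * |η| := by
        have h := norm_add_le (τ - Complex.I * l * η) (Complex.I * l * η)
        simpa using h
      have h6 : (1 + |l|) * |η| ≤ 1 / 2 * Λ := by
        calc (1 + |l|) * |η| ≤ (1 + (l₁ + l₂)) * (e₀ * Λ) := by gcongr
          _ = _ := by rw [he₀]; field_simp
      linarith
    have hQ4 : a * (1 / 2 * Λ) ^ 4 ≤ ‖Q‖ := by
      rw [hQn, show (1 / 2 * Λ) ^ 4 =
        (1 / 2 * Λ) * (1 / 2 * Λ) * ((1 / 2 * Λ) * (1 / 2 * Λ)) by ring]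
      have i1 := hfac l₁ (by rw [abs_of_pos hl₁]; linarith)
      have i2 := hfac (-l₁) (by rw [abs_neg, abs_of_pos hl₁]; linarith)
      have i3 := hfac l₂ (by rw [abs_of_pos hl₂]; linarith)
      have i4 := hfac (-l₂) (by rw [abs_neg, abs_of_pos hl₂]; linarith)
      gcongr
    have hsum : 2 * θ * τ.re ≤ ‖rp + rm‖ := by
      have := Complex.re_le_norm (rp + rm)
      rw [Complex.add_re] at this
      linarith
    calc c₂ * τ.re * Λ ^ 4 ≤ a * (1 / 2) ^ 4 * (2 * θ) * τ.re * Λ ^ 4 := by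
          gcongr; exact min_le_right _ _
      _ = a * (1 / 2 * Λ) ^ 4 * (2 * θ * τ.re) := by ring
      _ ≤ _ := by gcongr

/-! ### The boundary conditions at one frequency -/

/-- Bound on the right-hand side of the equation for the front amplitude. -/
theorem norm_front_source_le {P k Λ : ℝ} (hP : 0 < P) (hk : 1 ≤ k) (hΛ : 0 < Λ)
    {rp rm Dp Dm : ℂ} (n1 : ‖rp‖ ≤ k * Λ) (n2 : ‖rm‖ ≤ k * Λ) (hDp : ‖Dp‖ ≤ k * Λ)
    (hDm : ‖Dm‖ ≤ k * Λ) (gp gm b₀ b₁ b₂ : ℂ) :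
    ‖rp * rm * b₂ - rm * gp + rp * gm + P * (rm * Dp * b₁) + P * (rp * Dm * (b₁ - b₀))‖ ≤
      k ^ 2 * (1 + 2 * P) * (Λ * (‖gp‖ + ‖gm‖ + Λ * (‖b₀‖ + ‖b₁‖ + ‖b₂‖))) := by
  have hb10 : ‖b₁ - b₀‖ ≤ ‖b₁‖ + ‖b₀‖ := norm_sub_le _ _
  have hkk : k ≤ k ^ 2 := by nlinarith
  have hk0 : 0 < k := by linarith
  calc _ ≤ ‖rp * rm * b₂‖ + ‖rm * gp‖ + ‖rp * gm‖ + ‖(P : ℂ) * (rm * Dp * b₁)‖ +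
        ‖(P : ℂ) * (rp * Dm * (b₁ - b₀))‖ :=
      norm_add_le_of_le (norm_add_le_of_le (norm_add_le_of_le (norm_sub_le _ _) le_rfl)
        le_rfl) le_rfl
    _ = ‖rp‖ * ‖rm‖ * ‖b₂‖ + ‖rm‖ * ‖gp‖ + ‖rp‖ * ‖gm‖ + P * (‖rm‖ * ‖Dp‖ * ‖b₁‖) +
        P * (‖rp‖ * ‖Dm‖ * ‖b₁ - b₀‖) := by
      simp only [norm_mul, Complex.norm_real, Real.norm_of_nonneg hP.le]
    _ ≤ (k * Λ) * (k * Λ) * ‖b₂‖ + (k * Λ) * ‖gp‖ + (k * Λ) * ‖gm‖ +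
        P * ((k * Λ) * (k * Λ) * ‖b₁‖) +
        P * ((k * Λ) * (k * Λ) * (‖b₁‖ + ‖b₀‖)) := by gcongr
    _ ≤ k ^ 2 * Λ ^ 2 * ‖b₂‖ + k ^ 2 * Λ * ‖gp‖ + k ^ 2 * Λ * ‖gm‖ +
        P * k ^ 2 * Λ ^ 2 * ‖b₁‖ + P * k ^ 2 * Λ ^ 2 * (‖b₁‖ + ‖b₀‖) := by
      have := mul_le_mul_of_nonneg_right hkk (mul_nonneg hΛ.le (norm_nonneg gp))
      have := mul_le_mul_of_nonneg_right hkk (mul_nonneg hΛ.le (norm_nonneg gm))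
      linarith
    _ ≤ _ := by
      have i1 : 0 ≤ k ^ 2 * P * Λ * ‖gp‖ := by positivity
      have i2 : 0 ≤ k ^ 2 * P * Λ * ‖gm‖ := by positivity
      have i3 : 0 ≤ k ^ 2 * P * Λ ^ 2 * ‖b₂‖ := by positivity
      have i4 : 0 ≤ k ^ 2 * P * Λ ^ 2 * ‖b₀‖ := by positivity
      have i5 : 0 ≤ k ^ 2 * Λ ^ 2 * ‖b₀‖ := by positivity
      have i6 : 0 ≤ k ^ 2 * Λ ^ 2 * ‖b₁‖ := by positivity
      linarith

/-- Bound on the right-hand side of the equation for the pressure trace. -/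
theorem norm_pressure_source_le {P k Λ : ℝ} (hP : 0 < P) (hk : 1 ≤ k) (hΛ : 0 < Λ)
    {rm Dp Dm : ℂ} (n2 : ‖rm‖ ≤ k * Λ) (hDp : ‖Dp‖ ≤ k * Λ)
    (hDm : ‖Dm‖ ≤ k * Λ) (gp gm b₀ b₁ b₂ : ℂ) :
    ‖Dm ^ 2 * gp + Dp ^ 2 * gm - P * (Dp * Dm ^ 2 * b₁) + P * (Dp ^ 2 * Dm * (b₁ - b₀)) +
        Dp ^ 2 * rm * b₂‖ ≤
      k ^ 3 * (1 + 2 * P) * (Λ ^ 2 * (‖gp‖ + ‖gm‖ + Λ * (‖b₀‖ + ‖b₁‖ + ‖b₂‖))) := by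
  have hb10 : ‖b₁ - b₀‖ ≤ ‖b₁‖ + ‖b₀‖ := norm_sub_le _ _
  have hkk' : k ^ 2 ≤ k ^ 3 := by nlinarith [sq_nonneg k]
  have hk0 : 0 < k := by linarith
  calc _ ≤ ‖Dm ^ 2 * gp‖ + ‖Dp ^ 2 * gm‖ + ‖(P : ℂ) * (Dp * Dm ^ 2 * b₁)‖ +
        ‖(P : ℂ) * (Dp ^ 2 * Dm * (b₁ - b₀))‖ + ‖Dp ^ 2 * rm * b₂‖ :=
      norm_add_le_of_le (norm_add_le_of_le (norm_sub_le_of_le (norm_add_le _ _) le_rfl)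
        le_rfl) le_rfl
    _ = ‖Dm‖ ^ 2 * ‖gp‖ + ‖Dp‖ ^ 2 * ‖gm‖ + P * (‖Dp‖ * ‖Dm‖ ^ 2 * ‖b₁‖) +
        P * (‖Dp‖ ^ 2 * ‖Dm‖ * ‖b₁ - b₀‖) + ‖Dp‖ ^ 2 * ‖rm‖ * ‖b₂‖ := by
      simp only [norm_mul, norm_pow, Complex.norm_real, Real.norm_of_nonneg hP.le]
    _ ≤ (k * Λ) ^ 2 * ‖gp‖ + (k * Λ) ^ 2 * ‖gm‖ + P * ((k * Λ) * (k * Λ) ^ 2 * ‖b₁‖) +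
        P * ((k * Λ) ^ 2 * (k * Λ) * (‖b₁‖ + ‖b₀‖)) + (k * Λ) ^ 2 * (k * Λ) * ‖b₂‖ := by gcongr
    _ ≤ k ^ 3 * Λ ^ 2 * ‖gp‖ + k ^ 3 * Λ ^ 2 * ‖gm‖ + P * k ^ 3 * Λ ^ 3 * ‖b₁‖ +
        P * k ^ 3 * Λ ^ 3 * (‖b₁‖ + ‖b₀‖) + k ^ 3 * Λ ^ 3 * ‖b₂‖ := by
      have := mul_le_mul_of_nonneg_right hkk' (mul_nonneg (sq_nonneg Λ) (norm_nonneg gp))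
      have := mul_le_mul_of_nonneg_right hkk' (mul_nonneg (sq_nonneg Λ) (norm_nonneg gm))
      linarith
    _ ≤ _ := by
      have i1 : 0 ≤ k ^ 3 * P * Λ ^ 2 * ‖gp‖ := by positivity
      have i2 : 0 ≤ k ^ 3 * P * Λ ^ 2 * ‖gm‖ := by positivity
      have i3 : 0 ≤ k ^ 3 * P * Λ ^ 3 * ‖b₂‖ := by positivity
      have i4 : 0 ≤ k ^ 3 * P * Λ ^ 3 * ‖b₀‖ := by positivity
      have i5 : 0 ≤ k ^ 3 * Λ ^ 3 * ‖b₀‖ := by positivity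
      have i6 : 0 ≤ k ^ 3 * Λ ^ 3 * ‖b₁‖ := by positivity
      linarith

set_option maxHeartbeats 400000 in
/-- The boundary problem at one frequency: the two relations for the growing modes and the three
boundary conditions determine the traces `u±`, `z±` and the front `ψ`, with the loss of the factor
`Re τ / Λ` caused by the zeros of the Lopatinskii determinant. -/
theorem exists_boundary_bound {ε κ v G H : ℝ} (hκ : 0 < κ) (hv0 : 0 < v)
    (hv : ε ^ 2 * v ^ 2 < 1) (hm : 2 < κ * v ^ 2) (hG : 0 < G) (hH : 0 < H) :
    ∃ C > 0, ∀ (τ : ℂ) (η Λ : ℝ) (rp rm : ℂ), 0 < τ.re → ‖τ‖ ≤ Λ → |η| ≤ Λ → Λ ≤ ‖τ‖ + |η| →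
      rp ^ 2 = (η : ℂ) ^ 2 + ε ^ 2 * τ ^ 2 + κ * (τ + Complex.I * v * η) ^ 2 →
      rm ^ 2 = (η : ℂ) ^ 2 + ε ^ 2 * τ ^ 2 + κ * (τ - Complex.I * v * η) ^ 2 →
      Real.sqrt (ε ^ 2 + κ) * τ.re ≤ rp.re → Real.sqrt (ε ^ 2 + κ) * τ.re ≤ rm.re →
      ∀ up um zp zm ψ gp gm b₀ b₁ b₂ : ℂ,
        rp * up - G * (τ + Complex.I * v * η) * zp = gp →
        rm * um + G * (τ - Complex.I * v * η) * zm = gm →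
        2 * v * (Complex.I * η * ψ) - (H : ℂ)⁻¹ * (zp - zm) = b₀ →
        τ * ψ + v * (Complex.I * η * ψ) - (H : ℂ)⁻¹ * zp = b₁ →
        up - um = b₂ →
        ‖up‖ ^ 2 + ‖zp‖ ^ 2 + ‖um‖ ^ 2 + ‖zm‖ ^ 2 + Λ ^ 2 * ‖ψ‖ ^ 2 ≤
          C / τ.re ^ 2 * (‖gp‖ ^ 2 + ‖gm‖ ^ 2 + Λ ^ 2 * (‖b₀‖ ^ 2 + ‖b₁‖ ^ 2 + ‖b₂‖ ^ 2)) := by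
  obtain ⟨c, hc, hlop⟩ := exists_le_norm_lopatinskii hκ hv0 hv hm
  set k : ℝ := (1 + v) + Real.sqrt (1 + ε ^ 2 + κ * (1 + v) ^ 2) with hk
  have hk1 : 1 ≤ k := by
    have := Real.sqrt_nonneg (1 + ε ^ 2 + κ * (1 + v) ^ 2)
    linarith
  have hk0 : 0 < k := by linarith
  set P : ℝ := G * H with hP
  have hP0 : 0 < P := mul_pos hG hH
  set A : ℝ := k ^ 2 * (1 + 2 * P) / (c * P) with hA
  set B : ℝ := k ^ 3 * (1 + 2 * P) / c with hB
  have hA0 : 0 < A := by positivity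
  have hB0 : 0 < B := by positivity
  refine ⟨5 * (B ^ 2 + (H * (k * A + 1)) ^ 2 + (B + 1) ^ 2 + (H * (k * A + 2)) ^ 2 + A ^ 2),
    by positivity, ?_⟩
  intro τ η Λ rp rm hτ h1 h2 h3 hrp hrm hp hmr up um zp zm ψ gp gm b₀ b₁ b₂ e1 e2 e3 e4 e5
  have hlow := hlop τ η Λ rp rm hτ h1 h2 h3 hrp hrm hp hmr
  have hre : τ.re ≤ Λ := (Complex.re_le_norm τ).trans h1
  have hΛ : 0 < Λ := hτ.trans_le hre
  obtain ⟨hDp, hDm⟩ := norm_add_I_mul_le hv0.le h1 h2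
  have n1 := norm_root_le hκ h1 h2 hDp hrp
  have n2 := norm_root_le hκ h1 h2 hDm hrm
  have hkl1 : (1 + v) * Λ ≤ k * Λ := by
    gcongr; rw [hk]; linarith [Real.sqrt_nonneg (1 + ε ^ 2 + κ * (1 + v) ^ 2)]
  have hkl2 : Real.sqrt (1 + ε ^ 2 + κ * (1 + v) ^ 2) * Λ ≤ k * Λ := by
    gcongr; rw [hk]; linarith
  replace hDp := hDp.trans hkl1
  replace hDm := hDm.trans hkl1
  replace n1 := n1.trans hkl2
  replace n2 := n2.trans hkl2
  have hH' : (H : ℂ) ≠ 0 := by exact_mod_cast hH.ne'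
  have ezp : zp = H * ((τ + Complex.I * v * η) * ψ - b₁) := by
    rw [← e4]; field_simp; ring
  have ezm : zm = H * ((τ - Complex.I * v * η) * ψ - b₁ + b₀) := by
    rw [← e4, ← e3]; field_simp; ring
  -- Cramer's rule for the front amplitude and for the pressure trace.
  have eΔψ : (P : ℂ) * ((rp * (τ - Complex.I * v * η) ^ 2 + rm * (τ + Complex.I * v * η) ^ 2) * ψ) =
      rp * rm * b₂ - rm * gp + rp * gm + P * (rm * (τ + Complex.I * v * η) * b₁) +
        P * (rp * (τ - Complex.I * v * η) * (b₁ - b₀)) := by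
    rw [← e1, ← e2, ← e5, ezp, ezm, hP]
    push_cast
    ring
  have eΔu : (rp * (τ - Complex.I * v * η) ^ 2 + rm * (τ + Complex.I * v * η) ^ 2) * up =
      (τ - Complex.I * v * η) ^ 2 * gp + (τ + Complex.I * v * η) ^ 2 * gm -
        P * ((τ + Complex.I * v * η) * (τ - Complex.I * v * η) ^ 2 * b₁) +
        P * ((τ + Complex.I * v * η) ^ 2 * (τ - Complex.I * v * η) * (b₁ - b₀)) +
        (τ + Complex.I * v * η) ^ 2 * rm * b₂ := by
    rw [← e1, ← e2, ← e5, ezp, ezm, hP]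
    push_cast
    ring
  set Dp := τ + Complex.I * v * η
  set Dm := τ - Complex.I * v * η
  set Δ := rp * Dm ^ 2 + rm * Dp ^ 2
  set s : ℝ := ‖gp‖ + ‖gm‖ + Λ * (‖b₀‖ + ‖b₁‖ + ‖b₂‖) with hs
  have hs0 : 0 ≤ s := by positivity
  have hψ : Λ * ‖ψ‖ ≤ A / τ.re * s := by
    have h : P * (‖Δ‖ * ‖ψ‖) ≤ k ^ 2 * (1 + 2 * P) * (Λ * s) := by
      have e : P * (‖Δ‖ * ‖ψ‖) = ‖(P : ℂ) * (Δ * ψ)‖ := by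
        simp only [norm_mul, Complex.norm_real, Real.norm_of_nonneg hP0.le]
      rw [e, eΔψ]
      exact norm_front_source_le hP0 hk1 hΛ n1 n2 hDp hDm _ _ _ _ _
    have h' : P * (c * τ.re * Λ ^ 2 * ‖ψ‖) ≤ k ^ 2 * (1 + 2 * P) * (Λ * s) :=
      le_trans (by gcongr) h
    have : A / τ.re * s = k ^ 2 * (1 + 2 * P) * (Λ * s) / (P * c * τ.re * Λ) := by
      rw [hA]; field_simp
    rw [this, le_div_iff₀ (by positivity)]
    linarith
  have hup : ‖up‖ ≤ B / τ.re * s := by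
    have h : ‖Δ‖ * ‖up‖ ≤ k ^ 3 * (1 + 2 * P) * (Λ ^ 2 * s) := by
      rw [← norm_mul, eΔu]
      exact norm_pressure_source_le hP0 hk1 hΛ n2 hDp hDm _ _ _ _ _
    have h' : c * τ.re * Λ ^ 2 * ‖up‖ ≤ k ^ 3 * (1 + 2 * P) * (Λ ^ 2 * s) :=
      le_trans (by gcongr) h
    have : B / τ.re * s = k ^ 3 * (1 + 2 * P) * (Λ ^ 2 * s) / (c * τ.re * Λ ^ 2) := by
      rw [hB]; field_simp
    rw [this, le_div_iff₀ (by positivity)]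
    linarith
  have hb : ∀ x : ℝ, Λ * x ≤ s → x ≤ 1 / τ.re * s := fun x hx => by
    rw [one_div, ← div_eq_inv_mul, le_div_iff₀ hτ]
    rcases le_total 0 x with hx0 | hx0
    · calc x * τ.re ≤ x * Λ := by gcongr
        _ ≤ s := by rwa [mul_comm]
    · exact (mul_nonpos_of_nonpos_of_nonneg hx0 hτ.le).trans hs0
  have p0 := norm_nonneg gp
  have p1 := norm_nonneg gm
  have q0 := mul_nonneg hΛ.le (norm_nonneg b₀)
  have q1 := mul_nonneg hΛ.le (norm_nonneg b₁)
  have q2 := mul_nonneg hΛ.le (norm_nonneg b₂)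
  have hbb₀ : ‖b₀‖ ≤ 1 / τ.re * s := hb _ (by rw [hs]; linarith)
  have hbb₁ : ‖b₁‖ ≤ 1 / τ.re * s := hb _ (by rw [hs]; linarith)
  have hbb₂ : ‖b₂‖ ≤ 1 / τ.re * s := hb _ (by rw [hs]; linarith)
  have hum : ‖um‖ ≤ (B + 1) / τ.re * s := by
    have : um = up - b₂ := by rw [← e5]; ring
    calc ‖um‖ ≤ ‖up‖ + ‖b₂‖ := by rw [this]; exact norm_sub_le _ _
      _ ≤ B / τ.re * s + 1 / τ.re * s := add_le_add hup hbb₂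
      _ = _ := by ring
  have hDψ : ∀ D : ℂ, ‖D‖ ≤ k * Λ → ‖D * ψ‖ ≤ k * A / τ.re * s := fun D hD => by
    calc ‖D * ψ‖ = ‖D‖ * ‖ψ‖ := norm_mul _ _
      _ ≤ k * (Λ * ‖ψ‖) := by rw [← mul_assoc]; gcongr
      _ ≤ k * (A / τ.re * s) := by gcongr
      _ = _ := by ring
  have hzp : ‖zp‖ ≤ H * (k * A + 1) / τ.re * s := by
    rw [ezp, norm_mul, Complex.norm_real, Real.norm_of_nonneg hH.le]
    calc _ ≤ H * (k * A / τ.re * s + 1 / τ.re * s) := by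
          gcongr; exact norm_sub_le_of_le (hDψ _ hDp) hbb₁
      _ = _ := by ring
  have hzm : ‖zm‖ ≤ H * (k * A + 2) / τ.re * s := by
    rw [ezm, norm_mul, Complex.norm_real, Real.norm_of_nonneg hH.le]
    calc _ ≤ H * (k * A / τ.re * s + 1 / τ.re * s + 1 / τ.re * s) := by
          gcongr; exact norm_add_le_of_le (norm_sub_le_of_le (hDψ _ hDm) hbb₁) hbb₀
      _ = _ := by ring
  have hs2 : s ^ 2 ≤ 5 * (‖gp‖ ^ 2 + ‖gm‖ ^ 2 + Λ ^ 2 * (‖b₀‖ ^ 2 + ‖b₁‖ ^ 2 + ‖b₂‖ ^ 2)) := by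
    have := sq_sum_le_card_mul_sum_sq (s := Finset.univ)
      (f := ![‖gp‖, ‖gm‖, Λ * ‖b₀‖, Λ * ‖b₁‖, Λ * ‖b₂‖])
    simp only [Fin.sum_univ_five, Finset.card_univ, Fintype.card_fin] at this
    simp [mul_pow] at this
    calc s ^ 2 = (‖gp‖ + ‖gm‖ + Λ * ‖b₀‖ + Λ * ‖b₁‖ + Λ * ‖b₂‖) ^ 2 := by rw [hs]; ring
      _ ≤ _ := this
      _ = _ := by ring
  calc _ = ‖up‖ ^ 2 + ‖zp‖ ^ 2 + ‖um‖ ^ 2 + ‖zm‖ ^ 2 + (Λ * ‖ψ‖) ^ 2 := by ring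
    _ ≤ (B / τ.re * s) ^ 2 + (H * (k * A + 1) / τ.re * s) ^ 2 + ((B + 1) / τ.re * s) ^ 2 +
        (H * (k * A + 2) / τ.re * s) ^ 2 + (A / τ.re * s) ^ 2 := by gcongr
    _ = (B ^ 2 + (H * (k * A + 1)) ^ 2 + (B + 1) ^ 2 + (H * (k * A + 2)) ^ 2 + A ^ 2) / τ.re ^ 2 *
        s ^ 2 := by field_simp
    _ ≤ (B ^ 2 + (H * (k * A + 1)) ^ 2 + (B + 1) ^ 2 + (H * (k * A + 2)) ^ 2 + A ^ 2) / τ.re ^ 2 *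
        (5 * (‖gp‖ ^ 2 + ‖gm‖ ^ 2 + Λ ^ 2 * (‖b₀‖ ^ 2 + ‖b₁‖ ^ 2 + ‖b₂‖ ^ 2))) := by gcongr
    _ = _ := by ring

/-! ### Calculus on the half-line -/

theorem absolutelyContinuousOnInterval_primitive {p : ℝ → ℂ} {a b : ℝ}
    (hp : IntervalIntegrable p volume a b) :
    AbsolutelyContinuousOnInterval (fun x => ∫ s in a..x, p s) a b := by
  have hre : IntervalIntegrable (fun s => (p s).re) volume a b := ⟨hp.1.re, hp.2.re⟩
  have him : IntervalIntegrable (fun s => (p s).im) volume a b := ⟨hp.1.im, hp.2.im⟩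
  have h1 := hre.absolutelyContinuousOnInterval_intervalIntegral (c := a) (by simp)
  have h2 := him.absolutelyContinuousOnInterval_intervalIntegral (c := a) (by simp)
  have hc : ∀ z : ℂ, AbsolutelyContinuousOnInterval (fun _ : ℝ => z) a b := fun z =>
    (contDiffOn_const (c := z)).absolutelyContinuousOnInterval
  have h3 := (h1.fun_smul (hc 1)).fun_add (h2.fun_smul (hc Complex.I))
  have hsub : ∀ x ∈ uIcc a b, (∫ s in a..x, p s) = (∫ s in a..x, (p s).re) • (1 : ℂ) +
      (∫ s in a..x, (p s).im) • Complex.I := fun x hx => by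
    have hpx : IntervalIntegrable p volume a x := hp.mono_set (uIcc_subset_uIcc_left hx)
    apply Complex.ext
    · have := (Complex.reCLM.intervalIntegral_comp_comm hpx)
      simp at this
      simp [← this]
    · have := (Complex.imCLM.intervalIntegral_comp_comm hpx)
      simp at this
      simp [← this]
  rw [absolutelyContinuousOnInterval_iff] at h3 ⊢
  intro e he
  obtain ⟨d, hd, h⟩ := h3 e he
  refine ⟨d, hd, fun E hE hE' => ?_⟩
  convert h E hE hE' using 3 with i hi
  · exact hsub _ (hE.1 i hi).1
  · exact hsub _ (hE.1 i hi).2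

/-- Integration by parts for primitives of integrable functions. -/
theorem primitive_mul_primitive {p q : ℝ → ℂ} {a b : ℝ} (f₀ g₀ : ℂ)
    (hp : IntervalIntegrable p volume a b) (hq : IntervalIntegrable q volume a b) :
    (f₀ + ∫ s in a..b, p s) * (g₀ + ∫ s in a..b, q s) - f₀ * g₀ =
      ∫ x in a..b, (p x * (g₀ + ∫ s in a..x, q s) + (f₀ + ∫ s in a..x, p s) * q x) := by
  have hc : ∀ z : ℂ, AbsolutelyContinuousOnInterval (fun _ : ℝ => z) a b := fun z =>
    (contDiffOn_const (c := z)).absolutelyContinuousOnInterval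
  have hF := (hc f₀).fun_add (absolutelyContinuousOnInterval_primitive hp)
  have hG := (hc g₀).fun_add (absolutelyContinuousOnInterval_primitive hq)
  have hint : IntervalIntegrable (fun x => p x * (g₀ + ∫ s in a..x, q s) +
      (f₀ + ∫ s in a..x, p s) * q x) volume a b :=
    (hp.mul_continuousOn hG.continuousOn).add (hq.continuousOn_mul hF.continuousOn)
  have hK := (hF.fun_smul hG).fun_sub (absolutelyContinuousOnInterval_primitive hint)
  obtain ⟨C, hC⟩ := hK.const_of_ae_hasDerivAt_zero (by
    filter_upwards [hp.ae_hasDerivAt_integral, hq.ae_hasDerivAt_integral,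
      hint.ae_hasDerivAt_integral] with x h1 h2 h3 hx
    have d1 := (h1 hx a (by simp)).const_add f₀
    have d2 := (h2 hx a (by simp)).const_add g₀
    have d3 := (d1.mul d2).sub (h3 hx a (by simp))
    rw [sub_self] at d3
    exact d3)
  have h1 := hC a (by simp)
  have h2 := hC b (by simp)
  simp only [smul_eq_mul, intervalIntegral.integral_same, add_zero, sub_zero] at h1 h2
  rw [h1, ← h2]
  ring

theorem MemLp.intervalIntegrable_of_Ioi {p : ℝ → ℂ}
    (hp : MemLp p 2 (volume.restrict (Ioi (0 : ℝ)))) {b : ℝ} (hb : 0 ≤ b) :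
    IntervalIntegrable p volume 0 b := by
  rw [intervalIntegrable_iff_integrableOn_Ioc_of_le hb]
  have h1 : MemLp p 2 (volume.restrict (Ioc 0 b)) :=
    hp.mono_measure (Measure.restrict_mono Ioc_subset_Ioi_self le_rfl)
  exact h1.integrable (by norm_num)

/-- `f` is, almost everywhere on the half-line, the primitive of `p` with the value `f₀` at `0`. -/
def IsPrimitive (f p : ℝ → ℂ) (f₀ : ℂ) : Prop :=
  ∀ᵐ x ∂(volume.restrict (Ioi (0 : ℝ))), f x = f₀ + ∫ s in (0 : ℝ)..x, p s

/-- Integration by parts on the half-line. There is no boundary term at infinity: the product is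
integrable and converges, hence tends to `0`. -/
theorem integral_mul_add_mul_of_isPrimitive {f p g q : ℝ → ℂ} {f₀ g₀ : ℂ}
    (hf : MemLp f 2 (volume.restrict (Ioi (0 : ℝ)))) (hp : MemLp p 2 (volume.restrict (Ioi (0 : ℝ))))
    (hg : MemLp g 2 (volume.restrict (Ioi (0 : ℝ)))) (hq : MemLp q 2 (volume.restrict (Ioi (0 : ℝ))))
    (hfp : IsPrimitive f p f₀) (hgq : IsPrimitive g q g₀) :
    ∫ x in Ioi (0 : ℝ), (p x * g x + f x * q x) = -(f₀ * g₀) := by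
  have hI : IntegrableOn (fun x => p x * g x + f x * q x) (Ioi (0 : ℝ)) :=
    (hp.integrable_mul hg).add (hf.integrable_mul hq)
  have hlim := intervalIntegral_tendsto_integral_Ioi 0 hI tendsto_id
  have hev : ∀ᶠ b in atTop, (∫ x in (0 : ℝ)..id b, (p x * g x + f x * q x)) + f₀ * g₀ =
      (f₀ + ∫ s in (0 : ℝ)..b, p s) * (g₀ + ∫ s in (0 : ℝ)..b, q s) := by
    filter_upwards [eventually_ge_atTop (0 : ℝ)] with b hb
    have h := primitive_mul_primitive f₀ g₀ (MemLp.intervalIntegrable_of_Ioi hp hb)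
      (MemLp.intervalIntegrable_of_Ioi hq hb)
    rw [sub_eq_iff_eq_add.1 h]
    congr 1
    rw [id, intervalIntegral.integral_of_le hb, intervalIntegral.integral_of_le hb]
    refine integral_congr_ae ?_
    have hle : volume.restrict (Ioc (0 : ℝ) b) ≤ volume.restrict (Ioi (0 : ℝ)) :=
      Measure.restrict_mono Ioc_subset_Ioi_self le_rfl
    filter_upwards [ae_mono hle hfp, ae_mono hle hgq] with x h1 h2
    rw [h1, h2]
  have hlim2 := (hlim.add_const (f₀ * g₀)).congr' hev
  have hint : IntegrableOn (fun b => (f₀ + ∫ s in (0 : ℝ)..b, p s) * (g₀ + ∫ s in (0 : ℝ)..b, q s))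
      (Ioi (0 : ℝ)) := by
    refine (hf.integrable_mul hg).congr ?_
    filter_upwards [hfp, hgq] with x h1 h2
    rw [← h1, ← h2, Pi.mul_apply]
  have h0 := IntegrableAtFilter.eq_zero_of_tendsto (l := atTop)
    ⟨Ioi 0, Ioi_mem_atTop _, hint⟩ (by
      intro s hs
      rcases mem_atTop_sets.1 hs with ⟨b, hb⟩
      rw [← top_le_iff, ← Real.volume_Ici (a := b)]
      exact measure_mono hb) hlim2
  exact eq_neg_of_add_eq_zero_left h0

/-- The trace of a square integrable solution of `f' = r f + s` with `Re r > 0` is controlled by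
the source `s`. -/
theorem norm_growing_trace_sq_le {r : ℂ} (hr : 0 < r.re) {f p s : ℝ → ℂ} {f₀ : ℂ}
    (hf : MemLp f 2 (volume.restrict (Ioi (0 : ℝ)))) (hp : MemLp p 2 (volume.restrict (Ioi (0 : ℝ))))
    (hs : MemLp s 2 (volume.restrict (Ioi (0 : ℝ)))) (hfp : IsPrimitive f p f₀)
    (hode : ∀ᵐ x ∂(volume.restrict (Ioi (0 : ℝ))), p x = r * f x + s x) :
    ‖f₀‖ ^ 2 ≤ 1 / (2 * r.re) * ∫ x in Ioi (0 : ℝ), ‖s x‖ ^ 2 := by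
  -- Pair the equation with the decaying solution `exp (-r x)` of the adjoint equation.
  set g : ℝ → ℂ := fun x => Complex.exp (-r * x) with hgdef
  have hgc : Continuous g := by fun_prop
  have hgn : ∀ x, ‖g x‖ ^ 2 = Real.exp (-(2 * r.re) * x) := fun x => by
    rw [hgdef, Complex.norm_exp, ← Real.exp_nat_mul]
    congr 1
    simp
    ring
  have hgi : IntegrableOn (fun x => Real.exp (-(2 * r.re) * x)) (Ioi (0 : ℝ)) :=
    exp_neg_integrableOn_Ioi 0 (by linarith)
  have hg2 : MemLp g 2 (volume.restrict (Ioi (0 : ℝ))) := by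
    rw [memLp_two_iff_integrable_sq_norm hgc.aestronglyMeasurable]
    exact hgi.congr (ae_of_all _ fun x => (hgn x).symm)
  have hgq : IsPrimitive g (fun x => -r * g x) 1 := by
    refine ae_of_all _ fun x => ?_
    have hd : ∀ y ∈ uIcc 0 x, HasDerivAt g (-r * g y) y := fun y _ => by
      have h1 : HasDerivAt (fun y : ℝ => -r * (y : ℂ)) (-r) y := by
        simpa using (Complex.ofRealCLM.hasDerivAt (x := y)).const_mul (-r)
      have := h1.cexp
      rwa [mul_comm] at this
    rw [intervalIntegral.integral_eq_sub_of_hasDerivAt hd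
      ((continuous_const.mul hgc).intervalIntegrable _ _)]
    simp [hgdef]
  have h1 := integral_mul_add_mul_of_isPrimitive hf hp hg2 (hg2.const_mul (-r)) hfp hgq
  have h2 : ∫ x in Ioi (0 : ℝ), s x * g x = -f₀ := by
    rw [← mul_one f₀, ← h1]
    refine integral_congr_ae ?_
    filter_upwards [hode] with x hx
    rw [hx]
    ring
  have h3 : ‖f₀‖ ≤ ∫ x in Ioi (0 : ℝ), ‖s x‖ * ‖g x‖ := by
    rw [← norm_neg, ← h2]
    refine (norm_integral_le_integral_norm _).trans_eq ?_
    simp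
  have h4 := integral_mul_norm_le_Lp_mul_Lq (μ := volume.restrict (Ioi (0 : ℝ))) (f := s) (g := g)
    Real.HolderConjugate.two_two (by simpa using hs) (by simpa using hg2)
  have h5 := h3.trans h4
  simp only [Real.rpow_two] at h5
  have h6 : ∫ x in Ioi (0 : ℝ), ‖g x‖ ^ 2 = 1 / (2 * r.re) := by
    simp only [hgn]
    rw [integral_exp_mul_Ioi (by linarith)]
    simp
  have hS : 0 ≤ ∫ x in Ioi (0 : ℝ), ‖s x‖ ^ 2 := by positivity
  rw [h6, ← Real.sqrt_eq_rpow, ← Real.sqrt_eq_rpow] at h5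
  calc ‖f₀‖ ^ 2 ≤ (Real.sqrt (∫ x in Ioi (0 : ℝ), ‖s x‖ ^ 2) * Real.sqrt (1 / (2 * r.re))) ^ 2 := by
        gcongr
    _ = _ := by rw [mul_pow, Real.sq_sqrt hS, Real.sq_sqrt (by positivity), mul_comm]

/-! ### The equations of a single mode -/

/-- One side of the linearized problem at the frequency `(τ, η)`: the equations, in the normal
variable, for the amplitude `(u, w, z)` of `(V₁, V₂, V₃)`, with source `(f₁, f₂, f₃)`; `p`, `q` are
the normal derivatives of `u`, `z`, and `u₀`, `z₀` their boundary values. The parameters are the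
inverse speed of light `ε`, the sound speed `c`, the Lorentz factor `G`, the signed velocity `v` and
the side `σ = ±1`. -/
structure ModeSystem (ε c G v σ : ℝ) (τ : ℂ) (η : ℝ) (u w z p q f₁ f₂ f₃ : ℝ → ℂ)
    (u₀ z₀ : ℂ) : Prop where
  memLp_u : MemLp u 2 (volume.restrict (Ioi (0 : ℝ)))
  memLp_w : MemLp w 2 (volume.restrict (Ioi (0 : ℝ)))
  memLp_z : MemLp z 2 (volume.restrict (Ioi (0 : ℝ)))
  memLp_p : MemLp p 2 (volume.restrict (Ioi (0 : ℝ)))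
  memLp_q : MemLp q 2 (volume.restrict (Ioi (0 : ℝ)))
  memLp_f₁ : MemLp f₁ 2 (volume.restrict (Ioi (0 : ℝ)))
  memLp_f₂ : MemLp f₂ 2 (volume.restrict (Ioi (0 : ℝ)))
  memLp_f₃ : MemLp f₃ 2 (volume.restrict (Ioi (0 : ℝ)))
  prim_u : IsPrimitive u p u₀
  prim_z : IsPrimitive z q z₀
  eq₁ : ∀ᵐ x ∂(volume.restrict (Ioi (0 : ℝ))), f₁ x =
    G * (1 - ε ^ 4 * c ^ 2 * v ^ 2) * (τ + Complex.I * v * η) * u x +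
      c ^ 2 * (2 * ε ^ 2 * v * τ + (1 + ε ^ 2 * v ^ 2) * (Complex.I * η)) * w x +
      σ * c ^ 2 * q x
  eq₂ : ∀ᵐ x ∂(volume.restrict (Ioi (0 : ℝ))), f₂ x =
    (1 - ε ^ 2 * v ^ 2) * (Complex.I * η * u x + G * (τ + Complex.I * v * η) * w x)
  eq₃ : ∀ᵐ x ∂(volume.restrict (Ioi (0 : ℝ))), f₃ x =
    G * (τ + Complex.I * v * η) * z x + σ * p x

/-- The source of the growing mode: the combination of the three equations that eliminates `w`,
with the root `r` of the characteristic equation. -/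
def growSource (ε c G v σ : ℝ) (τ : ℂ) (η : ℝ) (r F₁ F₂ F₃ : ℂ) : ℂ :=
  σ * r * F₃ - (G * (τ + Complex.I * v * η) / c ^ 2) * F₁ +
    (2 * ε ^ 2 * v * τ + (1 + ε ^ 2 * v ^ 2) * (Complex.I * η)) / (1 - ε ^ 2 * v ^ 2) * F₂

/-- The combination `r u - σ G (τ + i v η) z` is a growing mode: it satisfies `g' = r g + source`. -/
theorem grow_equation {ε c G v σ : ℝ} (hc : c ≠ 0) (hσ : σ ^ 2 = 1)
    (hG : G ^ 2 * (1 - ε ^ 2 * v ^ 2) = 1) {τ r : ℂ} {η : ℝ}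
    (hr : r ^ 2 = (η : ℂ) ^ 2 + ε ^ 2 * τ ^ 2 +
      (G ^ 2 * (1 / c ^ 2 - ε ^ 2) : ℝ) * (τ + Complex.I * v * η) ^ 2)
    (u w z p q : ℂ) :
    r * p - σ * G * (τ + Complex.I * v * η) * q =
      r * (r * u - σ * G * (τ + Complex.I * v * η) * z) +
      growSource ε c G v σ τ η r
        (G * (1 - ε ^ 4 * c ^ 2 * v ^ 2) * (τ + Complex.I * v * η) * u +
          c ^ 2 * (2 * ε ^ 2 * v * τ + (1 + ε ^ 2 * v ^ 2) * (Complex.I * η)) * w + σ * c ^ 2 * q)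
        ((1 - ε ^ 2 * v ^ 2) * (Complex.I * η * u + G * (τ + Complex.I * v * η) * w))
        (G * (τ + Complex.I * v * η) * z + σ * p) := by
  have hc' : (c : ℂ) ≠ 0 := by exact_mod_cast hc
  have hσ' : (σ : ℂ) ^ 2 = 1 := by exact_mod_cast hσ
  have hG' : (G : ℂ) ^ 2 * (1 - ε ^ 2 * v ^ 2) = 1 := by exact_mod_cast hG
  have hne : (1 - ε ^ 2 * v ^ 2 : ℂ) ≠ 0 := fun h => by simp [h] at hG'
  have hr' : r ^ 2 = G ^ 2 * (1 - ε ^ 4 * c ^ 2 * v ^ 2) / c ^ 2 * (τ + Complex.I * v * η) ^ 2 -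
      (2 * ε ^ 2 * v * τ + (1 + ε ^ 2 * v ^ 2) * (Complex.I * η)) * (Complex.I * η) := by
    rw [hr]
    push_cast
    field_simp
    linear_combination (-c ^ 2 * ε ^ 2 * (τ + Complex.I * v * η) ^ 2) * hG' +
      (c ^ 2 * η ^ 2) * Complex.I_sq
  unfold growSource
  have e : (2 * ε ^ 2 * v * τ + (1 + ε ^ 2 * v ^ 2) * (Complex.I * η)) / (1 - ε ^ 2 * v ^ 2) *
      ((1 - ε ^ 2 * v ^ 2) * (Complex.I * η * u + G * (τ + Complex.I * v * η) * w)) =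
      (2 * ε ^ 2 * v * τ + (1 + ε ^ 2 * v ^ 2) * (Complex.I * η)) *
        (Complex.I * η * u + G * (τ + Complex.I * v * η) * w) := by
    field_simp
  rw [e]
  field_simp
  field_simp at hr'
  linear_combination (-u) * hr' - c ^ 2 * p * r * hσ'

theorem exists_growSource_bound {ε c G v κ : ℝ} (hc : 0 < c) (hv : ε ^ 2 * v ^ 2 < 1) (hκ : 0 < κ)
    (hG : 0 < G) : ∃ K > 0, ∀ (σ : ℝ), σ ^ 2 = 1 → ∀ (τ r : ℂ) (η Λ : ℝ), ‖τ‖ ≤ Λ → |η| ≤ Λ →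
      r ^ 2 = (η : ℂ) ^ 2 + ε ^ 2 * τ ^ 2 + κ * (τ + Complex.I * v * η) ^ 2 →
      ∀ F₁ F₂ F₃ : ℂ, ‖growSource ε c G v σ τ η r F₁ F₂ F₃‖ ^ 2 ≤
        K * Λ ^ 2 * (‖F₁‖ ^ 2 + ‖F₂‖ ^ 2 + ‖F₃‖ ^ 2) := by
  set a₁ := G * (1 + |v|) / c ^ 2
  set a₂ := (2 * ε ^ 2 * |v| + (1 + ε ^ 2 * v ^ 2)) / (1 - ε ^ 2 * v ^ 2)
  set a₃ := Real.sqrt (1 + ε ^ 2 + κ * (1 + |v|) ^ 2)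
  have hd : 0 < 1 - ε ^ 2 * v ^ 2 := by linarith
  have ha₁ : 0 < a₁ := by positivity
  have ha₂ : 0 < a₂ := by positivity
  have ha₃ : 0 < a₃ := by positivity
  refine ⟨3 * (a₁ ^ 2 + a₂ ^ 2 + a₃ ^ 2), by positivity, ?_⟩
  intro σ hσ τ r η Λ h1 h2 hr F₁ F₂ F₃
  have hΛ : 0 ≤ Λ := (norm_nonneg _).trans h1
  have hvη : |v| * |η| ≤ |v| * Λ := by gcongr
  have hD : ‖τ + Complex.I * v * η‖ ≤ (1 + |v|) * Λ := by
    refine (norm_add_le _ _).trans ?_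
    simp
    linarith
  have hrn := norm_root_le hκ h1 h2 hD hr
  have hσ1 : |σ| = 1 := by
    rw [← sq_abs] at hσ
    nlinarith [abs_nonneg σ]
  have hE : ‖2 * ε ^ 2 * v * τ + (1 + ε ^ 2 * v ^ 2) * (Complex.I * η)‖ ≤
      (2 * ε ^ 2 * |v| + (1 + ε ^ 2 * v ^ 2)) * Λ := by
    have n : ‖(1 + ε ^ 2 * v ^ 2 : ℂ)‖ = 1 + ε ^ 2 * v ^ 2 := by
      rw [show (1 + ε ^ 2 * v ^ 2 : ℂ) = ((1 + ε ^ 2 * v ^ 2 : ℝ) : ℂ) by push_cast; ring,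
        Complex.norm_real, Real.norm_of_nonneg (by positivity)]
    calc _ ≤ ‖(2 * ε ^ 2 * v * τ : ℂ)‖ + ‖(1 + ε ^ 2 * v ^ 2) * (Complex.I * η)‖ := norm_add_le _ _
      _ = 2 * ε ^ 2 * |v| * ‖τ‖ + (1 + ε ^ 2 * v ^ 2) * |η| := by
        rw [norm_mul (1 + ε ^ 2 * v ^ 2 : ℂ), n]
        simp
      _ ≤ 2 * ε ^ 2 * |v| * Λ + (1 + ε ^ 2 * v ^ 2) * Λ := by gcongr
      _ = _ := by ring
  have hn : ‖(1 - ε ^ 2 * v ^ 2 : ℂ)‖ = 1 - ε ^ 2 * v ^ 2 := by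
    rw [show (1 - ε ^ 2 * v ^ 2 : ℂ) = ((1 - ε ^ 2 * v ^ 2 : ℝ) : ℂ) by push_cast; ring,
      Complex.norm_real, Real.norm_of_nonneg hd.le]
  have hb : ‖growSource ε c G v σ τ η r F₁ F₂ F₃‖ ≤
      a₃ * Λ * ‖F₃‖ + a₁ * Λ * ‖F₁‖ + a₂ * Λ * ‖F₂‖ := by
    unfold growSource
    calc _ ≤ ‖σ * r * F₃‖ + ‖(G * (τ + Complex.I * v * η) / c ^ 2) * F₁‖ +
          ‖(2 * ε ^ 2 * v * τ + (1 + ε ^ 2 * v ^ 2) * (Complex.I * η)) / (1 - ε ^ 2 * v ^ 2) * F₂‖ :=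
          norm_add_le_of_le (norm_sub_le _ _) le_rfl
      _ = ‖r‖ * ‖F₃‖ + G * ‖τ + Complex.I * v * η‖ / c ^ 2 * ‖F₁‖ +
          ‖2 * ε ^ 2 * v * τ + (1 + ε ^ 2 * v ^ 2) * (Complex.I * η)‖ / (1 - ε ^ 2 * v ^ 2) *
            ‖F₂‖ := by
        simp only [norm_mul, norm_div, norm_pow, Complex.norm_real, hn, Real.norm_eq_abs, hσ1,
          abs_of_pos hc, abs_of_pos hG, one_mul]
      _ ≤ a₃ * Λ * ‖F₃‖ + G * ((1 + |v|) * Λ) / c ^ 2 * ‖F₁‖ +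
          ((2 * ε ^ 2 * |v| + (1 + ε ^ 2 * v ^ 2)) * Λ) / (1 - ε ^ 2 * v ^ 2) * ‖F₂‖ := by gcongr
      _ = _ := by simp only [a₁, a₂]; ring
  calc _ ≤ (a₃ * Λ * ‖F₃‖ + a₁ * Λ * ‖F₁‖ + a₂ * Λ * ‖F₂‖) ^ 2 := by gcongr
    _ ≤ 3 * ((a₃ * Λ * ‖F₃‖) ^ 2 + (a₁ * Λ * ‖F₁‖) ^ 2 + (a₂ * Λ * ‖F₂‖) ^ 2) := by
      nlinarith [sq_nonneg (a₃ * Λ * ‖F₃‖ - a₁ * Λ * ‖F₁‖), sq_nonneg (a₃ * Λ * ‖F₃‖ - a₂ * Λ * ‖F₂‖),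
        sq_nonneg (a₁ * Λ * ‖F₁‖ - a₂ * Λ * ‖F₂‖)]
    _ = 3 * Λ ^ 2 * (a₁ ^ 2 * ‖F₁‖ ^ 2 + a₂ ^ 2 * ‖F₂‖ ^ 2 + a₃ ^ 2 * ‖F₃‖ ^ 2) := by ring
    _ ≤ 3 * Λ ^ 2 * ((a₁ ^ 2 + a₂ ^ 2 + a₃ ^ 2) * ‖F₁‖ ^ 2 + (a₁ ^ 2 + a₂ ^ 2 + a₃ ^ 2) * ‖F₂‖ ^ 2 +
        (a₁ ^ 2 + a₂ ^ 2 + a₃ ^ 2) * ‖F₃‖ ^ 2) := by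
      gcongr <;> nlinarith [sq_nonneg a₁, sq_nonneg a₂, sq_nonneg a₃]
    _ = _ := by ring

/-- The energy identity of the symmetrized system at one frequency. Subtracting a multiple of the
second equation from the first removes the coupling `2 ε² v τ w`, after which the coefficients of `τ`
are diagonal and positive, and the tangential coupling is skew-adjoint. -/
theorem energy_identity {ε c G v σ : ℝ} (hG0 : G ≠ 0)
    (τ : ℂ) (η : ℝ) (u w z p q : ℂ) :
    ((G * (1 - ε ^ 4 * c ^ 2 * v ^ 2) * (τ + Complex.I * v * η) * u +
          c ^ 2 * (2 * ε ^ 2 * v * τ + (1 + ε ^ 2 * v ^ 2) * (Complex.I * η)) * w + σ * c ^ 2 * q -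
        (2 * ε ^ 2 * v * c ^ 2 / G : ℝ) * (Complex.I * η * u + G * (τ + Complex.I * v * η) * w)) *
        (starRingEnd ℂ) u).re +
      (c ^ 2 * (1 - ε ^ 2 * v ^ 2) * (Complex.I * η * u + G * (τ + Complex.I * v * η) * w) *
        (starRingEnd ℂ) w).re +
      (c ^ 2 * (G * (τ + Complex.I * v * η) * z + σ * p) * (starRingEnd ℂ) z).re =
    τ.re * (G * (1 - ε ^ 4 * c ^ 2 * v ^ 2) * ‖u‖ ^ 2 +
        c ^ 2 * (1 - ε ^ 2 * v ^ 2) * G * ‖w‖ ^ 2 + c ^ 2 * G * ‖z‖ ^ 2) +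
      σ * c ^ 2 * (p * (starRingEnd ℂ) z + u * (starRingEnd ℂ) q).re := by
  have e : G * (τ + Complex.I * v * η) * w * (2 * ε ^ 2 * v * c ^ 2 / G : ℝ) =
      2 * ε ^ 2 * v * c ^ 2 * (τ + Complex.I * v * η) * w := by
    have : (G : ℂ) ≠ 0 := by exact_mod_cast hG0
    push_cast
    field_simp
  have e2 : G * (1 - ε ^ 4 * c ^ 2 * v ^ 2) * (τ + Complex.I * v * η) * u +
        c ^ 2 * (2 * ε ^ 2 * v * τ + (1 + ε ^ 2 * v ^ 2) * (Complex.I * η)) * w + σ * c ^ 2 * q -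
      (2 * ε ^ 2 * v * c ^ 2 / G : ℝ) * (Complex.I * η * u + G * (τ + Complex.I * v * η) * w) =
      (G * (1 - ε ^ 4 * c ^ 2 * v ^ 2) : ℝ) * ((τ + Complex.I * v * η) * u) +
      (c ^ 2 * (1 - ε ^ 2 * v ^ 2) : ℝ) * (Complex.I * η * w) + (σ * c ^ 2 : ℝ) * q -
        (2 * ε ^ 2 * v * c ^ 2 / G : ℝ) * (Complex.I * η * u) := by
    push_cast at e ⊢
    linear_combination -e
  have e3 : c ^ 2 * (1 - ε ^ 2 * v ^ 2) * (Complex.I * η * u + G * (τ + Complex.I * v * η) * w) =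
      (c ^ 2 * (1 - ε ^ 2 * v ^ 2) : ℝ) *
        (Complex.I * η * u + G * ((τ + Complex.I * v * η) * w)) := by
    push_cast
    ring
  have e4 : c ^ 2 * (G * (τ + Complex.I * v * η) * z + σ * p) =
      (c ^ 2 : ℝ) * (G * ((τ + Complex.I * v * η) * z) + σ * p) := by
    push_cast
    ring
  rw [e2, e3, e4]
  set A₁ : ℝ := 1 - ε ^ 4 * c ^ 2 * v ^ 2
  set A₂ : ℝ := 1 - ε ^ 2 * v ^ 2
  set A₃ : ℝ := 2 * ε ^ 2 * v * c ^ 2 / G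
  set A₄ : ℝ := c ^ 2
  simp only [Complex.sq_norm, Complex.normSq_apply]
  simp
  ring

theorem re_mul_conj_le {a : ℝ} (ha : 0 < a) (x y : ℂ) :
    (x * (starRingEnd ℂ) y).re ≤ a / 2 * ‖y‖ ^ 2 + ‖x‖ ^ 2 / (2 * a) := by
  have h1 : (x * (starRingEnd ℂ) y).re ≤ ‖x‖ * ‖y‖ := by
    refine (Complex.re_le_norm _).trans_eq ?_
    simp
  have h2 : a / 2 * ‖y‖ ^ 2 + ‖x‖ ^ 2 / (2 * a) - ‖x‖ * ‖y‖ = (a * ‖y‖ - ‖x‖) ^ 2 / (2 * a) := by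
    field_simp
    ring
  have h3 : 0 ≤ (a * ‖y‖ - ‖x‖) ^ 2 / (2 * a) := by positivity
  linarith

/-- The energy identity with the source terms absorbed. The definiteness of the coefficients of `τ`
uses that the sound speed and the flow speed are less than the speed of light. -/
theorem exists_pointwise_energy_bound {ε c G v : ℝ} (hc : 0 < c) (hv : ε ^ 2 * v ^ 2 < 1)
    (hG : 0 < G) (hcε : ε ^ 2 * c ^ 2 < 1) :
    ∃ m > 0, ∃ K > 0, ∀ (σ : ℝ) (τ : ℂ) (η : ℝ), 0 < τ.re → ∀ u w z p q F₁ F₂ F₃ : ℂ,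
      F₁ = G * (1 - ε ^ 4 * c ^ 2 * v ^ 2) * (τ + Complex.I * v * η) * u +
        c ^ 2 * (2 * ε ^ 2 * v * τ + (1 + ε ^ 2 * v ^ 2) * (Complex.I * η)) * w + σ * c ^ 2 * q →
      F₂ = (1 - ε ^ 2 * v ^ 2) * (Complex.I * η * u + G * (τ + Complex.I * v * η) * w) →
      F₃ = G * (τ + Complex.I * v * η) * z + σ * p →
      m * τ.re * (‖u‖ ^ 2 + ‖w‖ ^ 2 + ‖z‖ ^ 2) +
        σ * c ^ 2 * (p * (starRingEnd ℂ) z + u * (starRingEnd ℂ) q).re ≤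
        K * τ.re⁻¹ * (‖F₁‖ ^ 2 + ‖F₂‖ ^ 2 + ‖F₃‖ ^ 2) := by
  have hd : 0 < 1 - ε ^ 2 * v ^ 2 := by linarith
  have hd' : 0 < 1 - ε ^ 4 * c ^ 2 * v ^ 2 := by
    have : ε ^ 4 * c ^ 2 * v ^ 2 = (ε ^ 2 * c ^ 2) * (ε ^ 2 * v ^ 2) := by ring
    rw [this]
    nlinarith [mul_nonneg (sq_nonneg ε) (sq_nonneg c), mul_nonneg (sq_nonneg ε) (sq_nonneg v)]
  set a := G * (1 - ε ^ 4 * c ^ 2 * v ^ 2) with ha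
  set b := c ^ 2 * (1 - ε ^ 2 * v ^ 2) * G with hb
  set d := c ^ 2 * G with hdd
  set s := 2 * ε ^ 2 * v * c ^ 2 / G / (1 - ε ^ 2 * v ^ 2) with hs
  have ha0 : 0 < a := by positivity
  have hb0 : 0 < b := by positivity
  have hd0 : 0 < d := by positivity
  refine ⟨min a (min b d) / 2, by positivity,
    (1 + s ^ 2) / a + c ^ 4 / (2 * b) + c ^ 4 / (2 * d), by positivity, ?_⟩
  intro σ τ η hτ u w z p q F₁ F₂ F₃ h1 h2 h3
  have key := energy_identity (ε := ε) (c := c) (v := v) (σ := σ) hG.ne' τ η u w z p q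
  have hne : (1 - ε ^ 2 * v ^ 2 : ℂ) ≠ 0 := by
    have : ((1 - ε ^ 2 * v ^ 2 : ℝ) : ℂ) ≠ 0 := by exact_mod_cast hd.ne'
    simpa using this
  have e2 : (2 * ε ^ 2 * v * c ^ 2 / G : ℝ) * (Complex.I * η * u + G * (τ + Complex.I * v * η) * w) =
      s * F₂ := by
    rw [h2, hs]
    push_cast
    field_simp
  have e3 : c ^ 2 * (1 - ε ^ 2 * v ^ 2) * (Complex.I * η * u + G * (τ + Complex.I * v * η) * w) =
      (c ^ 2 : ℝ) * F₂ := by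
    rw [h2]
    push_cast
    ring
  have e4 : (c : ℂ) ^ 2 * (G * (τ + Complex.I * v * η) * z + σ * p) = (c ^ 2 : ℝ) * F₃ := by
    rw [h3]
    push_cast
    ring
  rw [e2, e3, e4, ← h1, ← ha, ← hb, ← hdd] at key
  have y1 := re_mul_conj_le (mul_pos hτ ha0) (F₁ - s * F₂) u
  have y2 := re_mul_conj_le (mul_pos hτ hb0) ((c ^ 2 : ℝ) * F₂) w
  have y3 := re_mul_conj_le (mul_pos hτ hd0) ((c ^ 2 : ℝ) * F₃) z
  have n1 : ‖F₁ - s * F₂‖ ^ 2 ≤ 2 * (1 + s ^ 2) * (‖F₁‖ ^ 2 + ‖F₂‖ ^ 2) := by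
    have : ‖F₁ - s * F₂‖ ≤ ‖F₁‖ + |s| * ‖F₂‖ := by
      refine (norm_sub_le _ _).trans_eq ?_
      simp
    calc _ ≤ (‖F₁‖ + |s| * ‖F₂‖) ^ 2 := by gcongr
      _ ≤ 2 * (‖F₁‖ ^ 2 + |s| ^ 2 * ‖F₂‖ ^ 2) := by nlinarith [sq_nonneg (‖F₁‖ - |s| * ‖F₂‖)]
      _ ≤ _ := by
        rw [sq_abs]
        nlinarith [mul_nonneg (sq_nonneg s) (sq_nonneg ‖F₁‖), sq_nonneg ‖F₂‖]
  have n2 : ∀ F : ℂ, ‖((c ^ 2 : ℝ) : ℂ) * F‖ ^ 2 = c ^ 4 * ‖F‖ ^ 2 := fun F => by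
    rw [norm_mul, Complex.norm_real, Real.norm_of_nonneg (by positivity)]
    ring
  rw [n2] at y2 y3
  have n1' : ‖F₁ - s * F₂‖ ^ 2 / (2 * (τ.re * a)) ≤
      2 * (1 + s ^ 2) * (‖F₁‖ ^ 2 + ‖F₂‖ ^ 2) / (2 * (τ.re * a)) := by gcongr
  have hsum : min a (min b d) / 2 * τ.re * (‖u‖ ^ 2 + ‖w‖ ^ 2 + ‖z‖ ^ 2) ≤
      τ.re * a / 2 * ‖u‖ ^ 2 + τ.re * b / 2 * ‖w‖ ^ 2 + τ.re * d / 2 * ‖z‖ ^ 2 := by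
    have i1 : min a (min b d) ≤ a := min_le_left _ _
    have i2 : min a (min b d) ≤ b := (min_le_right _ _).trans (min_le_left _ _)
    have i3 : min a (min b d) ≤ d := (min_le_right _ _).trans (min_le_right _ _)
    have j1 := mul_le_mul_of_nonneg_right i1 (mul_nonneg hτ.le (sq_nonneg ‖u‖))
    have j2 := mul_le_mul_of_nonneg_right i2 (mul_nonneg hτ.le (sq_nonneg ‖w‖))
    have j3 := mul_le_mul_of_nonneg_right i3 (mul_nonneg hτ.le (sq_nonneg ‖z‖))
    linarith
  have hK : 2 * (1 + s ^ 2) * (‖F₁‖ ^ 2 + ‖F₂‖ ^ 2) / (2 * (τ.re * a)) +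
      c ^ 4 * ‖F₂‖ ^ 2 / (2 * (τ.re * b)) + c ^ 4 * ‖F₃‖ ^ 2 / (2 * (τ.re * d)) ≤
      ((1 + s ^ 2) / a + c ^ 4 / (2 * b) + c ^ 4 / (2 * d)) * τ.re⁻¹ *
        (‖F₁‖ ^ 2 + ‖F₂‖ ^ 2 + ‖F₃‖ ^ 2) := by
    have k1 : 2 * (1 + s ^ 2) * (‖F₁‖ ^ 2 + ‖F₂‖ ^ 2) / (2 * (τ.re * a)) =
        (1 + s ^ 2) / a * τ.re⁻¹ * (‖F₁‖ ^ 2 + ‖F₂‖ ^ 2) := by field_simp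
    have k2 : c ^ 4 * ‖F₂‖ ^ 2 / (2 * (τ.re * b)) = c ^ 4 / (2 * b) * τ.re⁻¹ * ‖F₂‖ ^ 2 := by
      field_simp
    have k3 : c ^ 4 * ‖F₃‖ ^ 2 / (2 * (τ.re * d)) = c ^ 4 / (2 * d) * τ.re⁻¹ * ‖F₃‖ ^ 2 := by
      field_simp
    rw [k1, k2, k3]
    have l1 : 0 ≤ (1 + s ^ 2) / a * τ.re⁻¹ * ‖F₃‖ ^ 2 := by positivity
    have l2 : 0 ≤ c ^ 4 / (2 * b) * τ.re⁻¹ * (‖F₁‖ ^ 2 + ‖F₃‖ ^ 2) := by positivity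
    have l3 : 0 ≤ c ^ 4 / (2 * d) * τ.re⁻¹ * (‖F₁‖ ^ 2 + ‖F₂‖ ^ 2) := by positivity
    linarith
  linarith

theorem IsPrimitive.conj {f p : ℝ → ℂ} {f₀ : ℂ} (h : IsPrimitive f p f₀) :
    IsPrimitive (fun x => (starRingEnd ℂ) (f x)) (fun x => (starRingEnd ℂ) (p x))
      ((starRingEnd ℂ) f₀) := by
  filter_upwards [h] with x hx
  rw [hx, map_add]
  congr 1
  simp only [intervalIntegral, map_sub, integral_conj]

theorem MemLp.conj {α : Type*} [MeasurableSpace α] {μ : Measure α} {f : α → ℂ} (h : MemLp f 2 μ) :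
    MemLp (fun x => (starRingEnd ℂ) (f x)) 2 μ := h.star

theorem integrable_norm_sq {α : Type*} [MeasurableSpace α] {μ : Measure α} {f : α → ℂ}
    (h : MemLp f 2 μ) : Integrable (fun x => ‖f x‖ ^ 2) μ :=
  (memLp_two_iff_integrable_sq_norm h.1).1 h

theorem ModeSystem.integrable_state {ε c G v σ : ℝ} {τ : ℂ} {η : ℝ}
    {u w z p q f₁ f₂ f₃ : ℝ → ℂ} {u₀ z₀ : ℂ}
    (h : ModeSystem ε c G v σ τ η u w z p q f₁ f₂ f₃ u₀ z₀) :
    IntegrableOn (fun x => ‖u x‖ ^ 2 + ‖w x‖ ^ 2 + ‖z x‖ ^ 2) (Ioi 0) :=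
  ((integrable_norm_sq h.memLp_u).add (integrable_norm_sq h.memLp_w)).add
    (integrable_norm_sq h.memLp_z)

theorem ModeSystem.integrable_source {ε c G v σ : ℝ} {τ : ℂ} {η : ℝ}
    {u w z p q f₁ f₂ f₃ : ℝ → ℂ} {u₀ z₀ : ℂ}
    (h : ModeSystem ε c G v σ τ η u w z p q f₁ f₂ f₃ u₀ z₀) :
    IntegrableOn (fun x => ‖f₁ x‖ ^ 2 + ‖f₂ x‖ ^ 2 + ‖f₃ x‖ ^ 2) (Ioi 0) :=
  ((integrable_norm_sq h.memLp_f₁).add (integrable_norm_sq h.memLp_f₂)).add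
    (integrable_norm_sq h.memLp_f₃)

/-- The interior energy estimate at one frequency. -/
theorem exists_energy_bound {ε c G v : ℝ} (hc : 0 < c) (hv : ε ^ 2 * v ^ 2 < 1)
    (hG : 0 < G) (hcε : ε ^ 2 * c ^ 2 < 1) :
    ∃ C > 0, ∀ (σ : ℝ), σ ^ 2 = 1 → ∀ (τ : ℂ) (η : ℝ), 0 < τ.re →
      ∀ (u w z p q f₁ f₂ f₃ : ℝ → ℂ) (u₀ z₀ : ℂ),
      ModeSystem ε c G v σ τ η u w z p q f₁ f₂ f₃ u₀ z₀ →
      τ.re * ∫ x in Ioi (0 : ℝ), (‖u x‖ ^ 2 + ‖w x‖ ^ 2 + ‖z x‖ ^ 2) ≤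
        C * (τ.re⁻¹ * (∫ x in Ioi (0 : ℝ), (‖f₁ x‖ ^ 2 + ‖f₂ x‖ ^ 2 + ‖f₃ x‖ ^ 2)) +
          (‖u₀‖ ^ 2 + ‖z₀‖ ^ 2)) := by
  obtain ⟨m, hm, K, hK, hpt⟩ := exists_pointwise_energy_bound hc hv hG hcε
  refine ⟨(K + c ^ 2) / m, by positivity, ?_⟩
  intro σ hσ τ η hτ u w z p q f₁ f₂ f₃ u₀ z₀ h
  have hI := integral_mul_add_mul_of_isPrimitive h.memLp_u h.memLp_p (MemLp.conj h.memLp_z)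
    (MemLp.conj h.memLp_q) h.prim_u h.prim_z.conj
  have hint : IntegrableOn (fun x => p x * (starRingEnd ℂ) (z x) + u x * (starRingEnd ℂ) (q x))
      (Ioi 0) := (h.memLp_p.integrable_mul (MemLp.conj h.memLp_z)).add
        (h.memLp_u.integrable_mul (MemLp.conj h.memLp_q))
  have hintre : IntegrableOn (fun x => (p x * (starRingEnd ℂ) (z x) +
      u x * (starRingEnd ℂ) (q x)).re) (Ioi 0) := hint.re
  have hIre : ∫ x in Ioi (0 : ℝ), (p x * (starRingEnd ℂ) (z x) + u x * (starRingEnd ℂ) (q x)).re =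
      -(u₀ * (starRingEnd ℂ) z₀).re := by
    rw [← Complex.neg_re, ← hI]
    exact integral_re hint
  have hmono : ∫ x in Ioi (0 : ℝ), (m * τ.re * (‖u x‖ ^ 2 + ‖w x‖ ^ 2 + ‖z x‖ ^ 2) +
      σ * c ^ 2 * (p x * (starRingEnd ℂ) (z x) + u x * (starRingEnd ℂ) (q x)).re) ≤
      ∫ x in Ioi (0 : ℝ), K * τ.re⁻¹ * (‖f₁ x‖ ^ 2 + ‖f₂ x‖ ^ 2 + ‖f₃ x‖ ^ 2) := by
    refine integral_mono_ae ((h.integrable_state.const_mul _).add (hintre.const_mul _))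
      (h.integrable_source.const_mul _) ?_
    filter_upwards [h.eq₁, h.eq₂, h.eq₃] with x h1 h2 h3
    exact hpt σ τ η hτ _ _ _ _ _ _ _ _ h1 h2 h3
  rw [integral_add (h.integrable_state.const_mul _) (hintre.const_mul _), integral_const_mul,
    integral_const_mul, integral_const_mul, hIre] at hmono
  have hb : σ * c ^ 2 * (u₀ * (starRingEnd ℂ) z₀).re ≤ c ^ 2 * (‖u₀‖ ^ 2 + ‖z₀‖ ^ 2) := by
    have h1 : |(u₀ * (starRingEnd ℂ) z₀).re| ≤ ‖u₀‖ * ‖z₀‖ := by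
      refine (Complex.abs_re_le_norm _).trans_eq ?_
      simp
    have hσ1 : |σ| = 1 := by
      rw [← sq_abs] at hσ
      nlinarith [abs_nonneg σ]
    calc _ ≤ |σ * c ^ 2 * (u₀ * (starRingEnd ℂ) z₀).re| := le_abs_self _
      _ = c ^ 2 * |(u₀ * (starRingEnd ℂ) z₀).re| := by simp [abs_mul, hσ1]
      _ ≤ c ^ 2 * (‖u₀‖ * ‖z₀‖) := by gcongr
      _ ≤ _ := by gcongr; nlinarith [sq_nonneg (‖u₀‖ - ‖z₀‖), sq_nonneg ‖u₀‖, sq_nonneg ‖z₀‖]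
  set X := ∫ x in Ioi (0 : ℝ), (‖u x‖ ^ 2 + ‖w x‖ ^ 2 + ‖z x‖ ^ 2)
  have hY : 0 ≤ ∫ x in Ioi (0 : ℝ), (‖f₁ x‖ ^ 2 + ‖f₂ x‖ ^ 2 + ‖f₃ x‖ ^ 2) := by positivity
  set Y := ∫ x in Ioi (0 : ℝ), (‖f₁ x‖ ^ 2 + ‖f₂ x‖ ^ 2 + ‖f₃ x‖ ^ 2)
  have hr : 0 < τ.re⁻¹ := inv_pos.2 hτ
  rw [div_mul_eq_mul_div, le_div_iff₀ hm]
  have l1 : 0 ≤ c ^ 2 * (τ.re⁻¹ * Y) := by positivity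
  have l2 : 0 ≤ K * (‖u₀‖ ^ 2 + ‖z₀‖ ^ 2) := by positivity
  linarith

/-- The boundary value of the growing mode is controlled by the source. -/
theorem exists_growing_trace_bound {ε c G v : ℝ} (hc : 0 < c) (hv : ε ^ 2 * v ^ 2 < 1)
    (hG : 0 < G) (hGv : G ^ 2 * (1 - ε ^ 2 * v ^ 2) = 1) (hcε : ε ^ 2 * c ^ 2 < 1) :
    ∃ C > 0, ∀ (σ : ℝ), σ ^ 2 = 1 → ∀ (τ r : ℂ) (η Λ : ℝ), 0 < τ.re → ‖τ‖ ≤ Λ → |η| ≤ Λ →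
      r ^ 2 = (η : ℂ) ^ 2 + ε ^ 2 * τ ^ 2 +
        (G ^ 2 * (1 / c ^ 2 - ε ^ 2) : ℝ) * (τ + Complex.I * v * η) ^ 2 →
      Real.sqrt (ε ^ 2 + G ^ 2 * (1 / c ^ 2 - ε ^ 2)) * τ.re ≤ r.re →
      ∀ (u w z p q f₁ f₂ f₃ : ℝ → ℂ) (u₀ z₀ : ℂ),
      ModeSystem ε c G v σ τ η u w z p q f₁ f₂ f₃ u₀ z₀ →
      ‖r * u₀ - σ * G * (τ + Complex.I * v * η) * z₀‖ ^ 2 ≤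
        C * (τ.re⁻¹ * Λ ^ 2 * ∫ x in Ioi (0 : ℝ), (‖f₁ x‖ ^ 2 + ‖f₂ x‖ ^ 2 + ‖f₃ x‖ ^ 2)) := by
  have hκ : 0 < G ^ 2 * (1 / c ^ 2 - ε ^ 2) := by
    have : 0 < 1 / c ^ 2 - ε ^ 2 := by
      rw [sub_pos, lt_div_iff₀ (by positivity)]
      exact hcε
    positivity
  set κ := G ^ 2 * (1 / c ^ 2 - ε ^ 2) with hκdef
  set θ := Real.sqrt (ε ^ 2 + κ)
  have hθ : 0 < θ := Real.sqrt_pos.2 (by positivity)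
  obtain ⟨K, hK, hsrc⟩ := exists_growSource_bound (ε := ε) (v := v) hc hv hκ hG
  refine ⟨K / (2 * θ), by positivity, ?_⟩
  intro σ hσ τ r η Λ hτ h1 h2 hr hre u w z p q f₁ f₂ f₃ u₀ z₀ h
  set s : ℝ → ℂ := fun x => growSource ε c G v σ τ η r (f₁ x) (f₂ x) (f₃ x) with hs
  have hs2 : MemLp s 2 (volume.restrict (Ioi (0 : ℝ))) :=
    ((h.memLp_f₃.const_mul _).sub (h.memLp_f₁.const_mul _)).add (h.memLp_f₂.const_mul _)
  have hr0 : 0 < r.re := (by positivity : 0 < θ * τ.re).trans_le hre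
  set D := τ + Complex.I * v * η with hD
  have hprim : IsPrimitive (fun x => r * u x - σ * G * D * z x) (fun x => r * p x - σ * G * D * q x)
      (r * u₀ - σ * G * D * z₀) := by
    filter_upwards [h.prim_u, h.prim_z, ae_restrict_mem measurableSet_Ioi] with x hx1 hx2 hx
    have hx : (0 : ℝ) ≤ x := le_of_lt hx
    rw [intervalIntegral.integral_sub ((MemLp.intervalIntegrable_of_Ioi h.memLp_p hx).const_mul _)
      ((MemLp.intervalIntegrable_of_Ioi h.memLp_q hx).const_mul _),
      intervalIntegral.integral_const_mul, intervalIntegral.integral_const_mul, hx1, hx2]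
    ring
  have hg := norm_growing_trace_sq_le hr0 (s := s)
    ((h.memLp_u.const_mul r).sub (h.memLp_z.const_mul (σ * G * D)))
    ((h.memLp_p.const_mul r).sub (h.memLp_q.const_mul (σ * G * D))) hs2 hprim (by
      filter_upwards [h.eq₁, h.eq₂, h.eq₃] with x h1 h2 h3
      have := grow_equation hc.ne' hσ hGv hr (u x) (w x) (z x) (p x) (q x)
      rw [← h1, ← h2, ← h3] at this
      exact this)
  have hint : ∫ x in Ioi (0 : ℝ), ‖s x‖ ^ 2 ≤
      K * Λ ^ 2 * ∫ x in Ioi (0 : ℝ), (‖f₁ x‖ ^ 2 + ‖f₂ x‖ ^ 2 + ‖f₃ x‖ ^ 2) := by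
    rw [← integral_const_mul]
    exact integral_mono (integrable_norm_sq hs2) (h.integrable_source.const_mul _)
      fun x => hsrc σ hσ τ r η Λ h1 h2 hr _ _ _
  have hY : 0 ≤ ∫ x in Ioi (0 : ℝ), (‖f₁ x‖ ^ 2 + ‖f₂ x‖ ^ 2 + ‖f₃ x‖ ^ 2) := by positivity
  calc _ ≤ 1 / (2 * r.re) * ∫ x in Ioi (0 : ℝ), ‖s x‖ ^ 2 := hg
    _ ≤ 1 / (2 * (θ * τ.re)) *
        (K * Λ ^ 2 * ∫ x in Ioi (0 : ℝ), (‖f₁ x‖ ^ 2 + ‖f₂ x‖ ^ 2 + ‖f₃ x‖ ^ 2)) := by gcongr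
    _ = _ := by field_simp

/-! ### The a priori estimate at one frequency -/

/-- Combination of the boundary estimate for `S`, the bounds for the growing modes `Gp`, `Gm` and
the energy estimates on both sides. -/
theorem combine_bounds {γ Λ Fp Fm B S Xp Xm Gp Gm tp tm C₁ C₂ C₃ C₄ C₅ : ℝ} (hγ : 0 < γ)
    (hγΛ : γ ≤ Λ) (hFp : 0 ≤ Fp) (hFm : 0 ≤ Fm) (hB : 0 ≤ B)
    (hC₁ : 0 < C₁) (hC₂ : 0 < C₂) (hC₃ : 0 < C₃) (hC₄ : 0 < C₄) (hC₅ : 0 < C₅)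
    (htp : tp ≤ S) (htm : tm ≤ S) (hb : S ≤ C₁ / γ ^ 2 * (Gp + Gm + Λ ^ 2 * B))
    (bp : Gp ≤ C₂ * (γ⁻¹ * Λ ^ 2 * Fp)) (bm : Gm ≤ C₃ * (γ⁻¹ * Λ ^ 2 * Fm))
    (ip : γ * Xp ≤ C₄ * (γ⁻¹ * Fp + tp)) (im : γ * Xm ≤ C₅ * (γ⁻¹ * Fm + tm)) :
    γ * (Xp + Xm) + S ≤ ((C₄ + C₅) + (C₄ + C₅ + 1) * (C₁ * (C₂ + C₃ + 1))) *
      ((γ ^ 3)⁻¹ * (Λ ^ 2 * (Fp + Fm)) + (γ ^ 2)⁻¹ * (Λ ^ 2 * B)) := by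
  have hΛ : 0 < Λ := hγ.trans_le hγΛ
  set T := (γ ^ 3)⁻¹ * (Λ ^ 2 * (Fp + Fm)) + (γ ^ 2)⁻¹ * (Λ ^ 2 * B) with hT
  have k1 : 0 ≤ (γ ^ 3)⁻¹ * (Λ ^ 2 * Fp) := by positivity
  have k2 : 0 ≤ (γ ^ 3)⁻¹ * (Λ ^ 2 * Fm) := by positivity
  have k3 : 0 ≤ (γ ^ 2)⁻¹ * (Λ ^ 2 * B) := by positivity
  have hST : S ≤ C₁ * (C₂ + C₃ + 1) * T := by
    refine hb.trans ?_
    calc _ ≤ C₁ / γ ^ 2 * (C₂ * (γ⁻¹ * Λ ^ 2 * Fp) + C₃ * (γ⁻¹ * Λ ^ 2 * Fm) + Λ ^ 2 * B) := by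
          gcongr
      _ = C₁ * (C₂ * ((γ ^ 3)⁻¹ * (Λ ^ 2 * Fp)) + C₃ * ((γ ^ 3)⁻¹ * (Λ ^ 2 * Fm)) +
          (γ ^ 2)⁻¹ * (Λ ^ 2 * B)) := by field_simp
      _ ≤ _ := by
        rw [mul_assoc, hT]
        gcongr
        have l1 := mul_nonneg hC₂.le k2
        have l2 := mul_nonneg hC₂.le k3
        have l3 := mul_nonneg hC₃.le k1
        have l4 := mul_nonneg hC₃.le k3
        linarith
  have hF : ∀ F : ℝ, 0 ≤ F → γ⁻¹ * F ≤ (γ ^ 3)⁻¹ * (Λ ^ 2 * F) := fun F hF => by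
    have : γ⁻¹ * F = (γ ^ 3)⁻¹ * (γ ^ 2 * F) := by field_simp
    rw [this]
    gcongr
  have jp : γ * Xp ≤ C₄ * (T + S) :=
    ip.trans (mul_le_mul_of_nonneg_left (add_le_add ((hF _ hFp).trans (by linarith)) htp) hC₄.le)
  have jm : γ * Xm ≤ C₅ * (T + S) :=
    im.trans (mul_le_mul_of_nonneg_left (add_le_add ((hF _ hFm).trans (by linarith)) htm) hC₅.le)
  calc _ = γ * Xp + γ * Xm + S := by ring
    _ ≤ (C₄ + C₅) * T + (C₄ + C₅ + 1) * S := by linarith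
    _ ≤ (C₄ + C₅) * T + (C₄ + C₅ + 1) * (C₁ * (C₂ + C₃ + 1) * T) := by gcongr
    _ = _ := by ring

/-- The a priori estimate at one frequency; `Λ` stands for any quantity comparable to the size of
the frequency `(τ, η)`. -/
theorem exists_frequency_bound {ε c G v H : ℝ} (hc : 0 < c) (hv0 : 0 < v)
    (hv : ε ^ 2 * v ^ 2 < 1) (hG : 0 < G) (hGv : G ^ 2 * (1 - ε ^ 2 * v ^ 2) = 1)
    (hcε : ε ^ 2 * c ^ 2 < 1) (hH : 0 < H) (hm : 2 < G ^ 2 * (1 / c ^ 2 - ε ^ 2) * v ^ 2) :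
    ∃ C > 0, ∀ (τ : ℂ) (η Λ : ℝ), 0 < τ.re → ‖τ‖ ≤ Λ → |η| ≤ Λ → Λ ≤ ‖τ‖ + |η| →
      ∀ (up wp zp pp qp fp₁ fp₂ fp₃ um wm zm pm qm fm₁ fm₂ fm₃ : ℝ → ℂ)
        (up₀ zp₀ um₀ zm₀ ψ b₀ b₁ b₂ : ℂ),
        ModeSystem ε c G v 1 τ η up wp zp pp qp fp₁ fp₂ fp₃ up₀ zp₀ →
        ModeSystem ε c G (-v) (-1) τ η um wm zm pm qm fm₁ fm₂ fm₃ um₀ zm₀ →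
        2 * v * (Complex.I * η * ψ) - (H : ℂ)⁻¹ * (zp₀ - zm₀) = b₀ →
        τ * ψ + v * (Complex.I * η * ψ) - (H : ℂ)⁻¹ * zp₀ = b₁ →
        up₀ - um₀ = b₂ →
        τ.re * ((∫ x in Ioi (0 : ℝ), (‖up x‖ ^ 2 + ‖wp x‖ ^ 2 + ‖zp x‖ ^ 2)) +
            ∫ x in Ioi (0 : ℝ), (‖um x‖ ^ 2 + ‖wm x‖ ^ 2 + ‖zm x‖ ^ 2)) +
          (‖up₀‖ ^ 2 + ‖zp₀‖ ^ 2 + ‖um₀‖ ^ 2 + ‖zm₀‖ ^ 2) + Λ ^ 2 * ‖ψ‖ ^ 2 ≤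
        C * ((τ.re ^ 3)⁻¹ * (Λ ^ 2 *
            ((∫ x in Ioi (0 : ℝ), (‖fp₁ x‖ ^ 2 + ‖fp₂ x‖ ^ 2 + ‖fp₃ x‖ ^ 2)) +
              ∫ x in Ioi (0 : ℝ), (‖fm₁ x‖ ^ 2 + ‖fm₂ x‖ ^ 2 + ‖fm₃ x‖ ^ 2))) +
          (τ.re ^ 2)⁻¹ * (Λ ^ 2 * (‖b₀‖ ^ 2 + ‖b₁‖ ^ 2 + ‖b₂‖ ^ 2))) := by
  have hκ : 0 < G ^ 2 * (1 / c ^ 2 - ε ^ 2) := by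
    have : 0 < 1 / c ^ 2 - ε ^ 2 := by
      rw [sub_pos, lt_div_iff₀ (by positivity)]
      exact hcε
    positivity
  have hv' : ε ^ 2 * (-v) ^ 2 < 1 := by rwa [neg_sq]
  obtain ⟨C₁, hC₁, hbd⟩ := exists_boundary_bound (H := H) hκ hv0 hv hm hG hH
  obtain ⟨C₂, hC₂, hgp⟩ := exists_growing_trace_bound hc hv hG hGv hcε
  obtain ⟨C₃, hC₃, hgm⟩ := exists_growing_trace_bound (v := -v) hc hv' hG (by rwa [neg_sq]) hcε
  obtain ⟨C₄, hC₄, hep⟩ := exists_energy_bound hc hv hG hcε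
  obtain ⟨C₅, hC₅, hem⟩ := exists_energy_bound (v := -v) hc hv' hG hcε
  refine ⟨(C₄ + C₅) + (C₄ + C₅ + 1) * (C₁ * (C₂ + C₃ + 1)), by positivity, ?_⟩
  intro τ η Λ hτ h1 h2 h3 up wp zp pp qp fp₁ fp₂ fp₃ um wm zm pm qm fm₁ fm₂ fm₃
    up₀ zp₀ um₀ zm₀ ψ b₀ b₁ b₂ hp hmm e0 e1 e2
  obtain ⟨rp, hrp, hrp'⟩ := exists_sqrt_re_ge hκ hv hτ η
  obtain ⟨rm, hrm, hrm'⟩ := exists_sqrt_re_ge hκ hv' hτ η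
  have hDm : τ + Complex.I * ((-v : ℝ) : ℂ) * η = τ - Complex.I * v * η := by
    push_cast; ring
  have bp := hgp 1 (by norm_num) τ rp η Λ hτ h1 h2 hrp hrp' _ _ _ _ _ _ _ _ _ _ hp
  have bm := hgm (-1) (by norm_num) τ rm η Λ hτ h1 h2 hrm hrm' _ _ _ _ _ _ _ _ _ _ hmm
  rw [hDm] at hrm bm
  have ip := hep 1 (by norm_num) τ η hτ _ _ _ _ _ _ _ _ _ _ hp
  have im := hem (-1) (by norm_num) τ η hτ _ _ _ _ _ _ _ _ _ _ hmm
  have hb := hbd τ η Λ rp rm hτ h1 h2 h3 hrp hrm hrp' hrm' up₀ um₀ zp₀ zm₀ ψ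
    (rp * up₀ - ((1 : ℝ) : ℂ) * G * (τ + Complex.I * v * η) * zp₀)
    (rm * um₀ - ((-1 : ℝ) : ℂ) * G * (τ - Complex.I * v * η) * zm₀) b₀ b₁ b₂
    (by push_cast; ring) (by push_cast; ring) e0 e1 e2
  have hγΛ : τ.re ≤ Λ := (Complex.re_le_norm τ).trans h1
  have s0 := sq_nonneg ‖up₀‖
  have s1 := sq_nonneg ‖zp₀‖
  have s2 := sq_nonneg ‖um₀‖
  have s3 := sq_nonneg ‖zm₀‖
  have s4 := mul_nonneg (sq_nonneg Λ) (sq_nonneg ‖ψ‖)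
  have := combine_bounds hτ hγΛ (by positivity) (by positivity) (by positivity) hC₁ hC₂ hC₃ hC₄ hC₅
    (by linarith) (by linarith) hb bp bm ip im
  rw [add_assoc]
  exact this

open SchwartzMap

/-! ### The Fourier transform on `L²` -/

open Classical in
/-- The `L²` Fourier transform as a function; `0` outside `L²`. -/
def ft (u : Bd → ℂ) : Bd → ℂ :=
  if h : MemLp u 2 volume then (𝓕 (h.toLp u) : Lp ℂ 2 (volume : Measure Bd)) else 0

theorem ft_of_memLp {u : Bd → ℂ} (h : MemLp u 2 volume) :
    ft u = (𝓕 (h.toLp u) : Lp ℂ 2 (volume : Measure Bd)) := dif_pos h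

theorem memLp_ft {u : Bd → ℂ} (h : MemLp u 2 volume) : MemLp (ft u) 2 volume := by
  rw [ft_of_memLp h]
  exact Lp.memLp _

theorem ft_congr_ae {u v : Bd → ℂ} (h : u =ᵐ[volume] v) : ft u = ft v := by
  by_cases hu : MemLp u 2 volume
  · have hv := (memLp_congr_ae h).1 hu
    rw [ft_of_memLp hu, ft_of_memLp hv, (MemLp.toLp_eq_toLp_iff hu hv).2 h]
  · have hv : ¬ MemLp v 2 volume := fun hv => hu ((memLp_congr_ae h).2 hv)
    rw [ft, ft, dif_neg hu, dif_neg hv]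

theorem ft_add {u v : Bd → ℂ} (hu : MemLp u 2 volume) (hv : MemLp v 2 volume) :
    ft (fun y => u y + v y) =ᵐ[volume] fun ξ => ft u ξ + ft v ξ := by
  have h : MemLp (fun y => u y + v y) 2 volume := hu.add hv
  rw [ft_of_memLp h, ft_of_memLp hu, ft_of_memLp hv,
    show h.toLp _ = hu.toLp u + hv.toLp v from MemLp.toLp_add hu hv, FourierAdd.fourier_add]
  exact Lp.coeFn_add _ _

theorem ft_const_mul (a : ℂ) {u : Bd → ℂ} (hu : MemLp u 2 volume) :
    ft (fun y => a * u y) =ᵐ[volume] fun ξ => a * ft u ξ := by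
  have h : MemLp (fun y => a * u y) 2 volume := hu.const_mul a
  rw [ft_of_memLp h, ft_of_memLp hu,
    show h.toLp _ = a • hu.toLp u from MemLp.toLp_const_smul a hu, FourierSMul.fourier_smul]
  exact Lp.coeFn_smul _ _

theorem ft_sub {u v : Bd → ℂ} (hu : MemLp u 2 volume) (hv : MemLp v 2 volume) :
    ft (fun y => u y - v y) =ᵐ[volume] fun ξ => ft u ξ - ft v ξ := by
  have e : (fun y => u y - v y) = fun y => u y + (-1) * v y := by
    funext y; ring
  rw [e]
  filter_upwards [ft_add hu (hv.const_mul (-1)), ft_const_mul (-1) hv] with ξ h1 h2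
  rw [h1, h2]
  ring

/-- Plancherel's theorem. -/
theorem eLpNorm_ft {u : Bd → ℂ} (hu : MemLp u 2 volume) :
    eLpNorm (ft u) 2 volume = eLpNorm u 2 volume := by
  have h := Lp.norm_fourier_eq (hu.toLp u)
  rw [ft_of_memLp hu]
  rw [Lp.norm_def, Lp.norm_toLp, ENNReal.toReal_eq_toReal_iff' (Lp.eLpNorm_ne_top _)
    hu.eLpNorm_ne_top] at h
  exact h

theorem lintegral_enorm_sq_eq {α : Type*} [MeasurableSpace α] {μ : Measure α} (u : α → ℂ) :
    ∫⁻ x, ‖u x‖ₑ ^ 2 ∂μ = eLpNorm u 2 μ ^ 2 := by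
  have := eLpNorm_nnreal_pow_eq_lintegral (f := u) (μ := μ) (p := 2) two_ne_zero
  simp at this
  exact this.symm

theorem lintegral_ft_sq {u : Bd → ℂ} (hu : MemLp u 2 volume) :
    ∫⁻ ξ, ‖ft u ξ‖ₑ ^ 2 = ∫⁻ y, ‖u y‖ₑ ^ 2 := by
  rw [lintegral_enorm_sq_eq, lintegral_enorm_sq_eq, eLpNorm_ft hu]

/-- The multiplication formula. -/
theorem integral_schwartz_mul_ft (φ : 𝓢(Bd, ℂ)) {u : Bd → ℂ} (hu : MemLp u 2 volume) :
    ∫ ξ, φ ξ * ft u ξ = ∫ y, (𝓕 φ) y * u y := by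
  have h := congrArg (fun T => T φ) (Lp.fourier_toTemperedDistribution_eq (hu.toLp u))
  simp only [TemperedDistribution.fourier_apply, Lp.toTemperedDistribution_apply, smul_eq_mul] at h
  rw [ft_of_memLp hu, ← h]
  refine integral_congr_ae ?_
  filter_upwards [hu.coeFn_toLp] with y hy
  rw [hy]

/-- A real test function as a complex Schwartz function. -/
def toSchwartz (φ : Bd → ℝ) (h1 : ContDiff ℝ ∞ φ) (h2 : HasCompactSupport φ) : 𝓢(Bd, ℂ) :=
  HasCompactSupport.toSchwartzMap (f := fun x => ((φ x : ℝ) : ℂ))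
    (h2.comp_left (g := Complex.ofReal) rfl) (Complex.ofRealCLM.contDiff.comp h1)

@[simp]
theorem toSchwartz_apply (φ : Bd → ℝ) (h1 : ContDiff ℝ ∞ φ) (h2 : HasCompactSupport φ) (x : Bd) :
    toSchwartz φ h1 h2 x = φ x := rfl

/-- A locally integrable function satisfying the multiplication formula is the Fourier
transform. -/
theorem eq_ft_of_integral_eq {u v : Bd → ℂ} (hu : MemLp u 2 volume)
    (hv : LocallyIntegrable v volume)
    (h : ∀ φ : 𝓢(Bd, ℂ), HasCompactSupport φ → ∫ ξ, φ ξ * v ξ = ∫ y, (𝓕 φ) y * u y) :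
    v =ᵐ[volume] ft u := by
  refine ae_eq_of_integral_contDiff_smul_eq hv ((memLp_ft hu).locallyIntegrable one_le_two) ?_
  intro φ h1 h2
  have h3 : HasCompactSupport (toSchwartz φ h1 h2) :=
    h2.comp_left (g := Complex.ofReal) rfl
  have h4 := h (toSchwartz φ h1 h2) h3
  rw [← integral_schwartz_mul_ft _ hu] at h4
  simpa using h4

theorem ft_eq_fourier {u : Bd → ℂ} (hu : MemLp u 2 volume) (hu1 : Integrable u volume) :
    𝓕 u =ᵐ[volume] ft u := by
  have hc : Continuous (𝓕 u) := VectorFourier.fourierIntegral_continuous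
    Real.continuous_fourierChar (by exact continuous_inner) hu1
  refine eq_ft_of_integral_eq hu hc.locallyIntegrable fun φ _ => ?_
  have := VectorFourier.integral_fourierIntegral_smul_eq_flip (μ := (volume : Measure Bd))
    (ν := (volume : Measure Bd)) (L := innerₗ Bd) Real.continuous_fourierChar
    (by exact continuous_inner) (φ.integrable) hu1
  rw [flip_innerₗ] at this
  exact this.symm

/-- The definition of a weak derivative extends from test functions to smooth `L²` functions with
`L²` derivative, by cutting off at infinity. -/
theorem IsWeakDeriv.integral_smooth {e : Bd} {u w : Bd → ℂ} (h : IsWeakDeriv univ e u w)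
    (hu : MemLp u 2 volume) (hw : MemLp w 2 volume) {g : Bd → ℝ} (hg : ContDiff ℝ ∞ g)
    (hg2 : MemLp g 2 volume) (hg2' : MemLp (fun x => fderiv ℝ g x e) 2 volume) :
    ∫ x, fderiv ℝ g x e • u x = -∫ x, g x • w x := by
  set χ : ContDiffBump (0 : Bd) := ⟨1, 2, one_pos, one_lt_two⟩
  have hχ : ContDiff ℝ ∞ χ := χ.contDiff
  obtain ⟨C, hC⟩ := (hχ.continuous_fderiv (by simp)).bounded_above_of_compact_support
    (χ.hasCompactSupport.fderiv (𝕜 := ℝ))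
  set s : ℕ → ℝ := fun n => ((n : ℝ) + 1)⁻¹ with hs
  have hs0 : ∀ n, 0 < s n := fun n => by simp only [hs]; positivity
  have hs1 : ∀ n, s n ≤ 1 := fun n => inv_le_one_of_one_le₀ (by simp)
  have hslim : Tendsto s atTop (𝓝 0) := tendsto_inv_atTop_zero.comp
    (tendsto_atTop_add_const_right _ _ tendsto_natCast_atTop_atTop)
  have hχs : ∀ n x, HasFDerivAt (fun x => χ (s n • x)) (s n • fderiv ℝ χ (s n • x)) x :=
    fun n x => by
      have h1 : HasFDerivAt (fun x : Bd => s n • x) (s n • ContinuousLinearMap.id ℝ Bd) x :=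
        (s n • ContinuousLinearMap.id ℝ Bd).hasFDerivAt
      have h2 := ((hχ.differentiable (by simp)) (s n • x)).hasFDerivAt.comp x h1
      exact h2.congr_fderiv (by ext v; simp)
  have hder : ∀ n x, fderiv ℝ (fun x => χ (s n • x) * g x) x e =
      χ (s n • x) * fderiv ℝ g x e + s n * fderiv ℝ χ (s n • x) e * g x := fun n x => by
    have h2 := ((hg.differentiable (by simp)) x).hasFDerivAt
    rw [((hχs n x).fun_mul h2).fderiv]
    simp
    ring
  have hcut : ∀ n, ∫ x, fderiv ℝ (fun x => χ (s n • x) * g x) x e • u x =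
      -∫ x, (χ (s n • x) * g x) • w x := fun n => by
    have h3 : HasCompactSupport (fun x => χ (s n • x)) :=
      χ.hasCompactSupport.comp_smul (hs0 n).ne'
    have := h.2.2 (fun x => χ (s n • x) * g x)
      ((hχ.comp (contDiff_const_smul (s n))).mul hg) (h3.mul_right) (subset_univ _)
    simpa using this
  have hev : ∀ x : Bd, ∀ᶠ n in atTop, χ (s n • x) = 1 := fun x => by
    have : Tendsto (fun n => s n • x) atTop (𝓝 0) := by simpa using hslim.smul_const x
    exact this.eventually χ.eventuallyEq_one
  have i1 : Integrable (fun x => ‖fderiv ℝ g x e‖ * ‖u x‖) := hg2'.norm.integrable_mul hu.norm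
  have i2 : Integrable (fun x => ‖g x‖ * ‖u x‖) := hg2.norm.integrable_mul hu.norm
  have i3 : Integrable (fun x => ‖g x‖ * ‖w x‖) := hg2.norm.integrable_mul hw.norm
  have hχ1 : ∀ x, ‖χ x‖ ≤ 1 := fun x => by
    rw [Real.norm_of_nonneg χ.nonneg]
    exact χ.le_one
  have hcgd : Continuous fun x => fderiv ℝ g x e :=
    (hg.continuous_fderiv (by simp)).clm_apply continuous_const
  have hcχd : Continuous fun x => fderiv ℝ χ x e :=
    (hχ.continuous_fderiv (by simp)).clm_apply continuous_const
  have lim1 : Tendsto (fun n => ∫ x, fderiv ℝ (fun x => χ (s n • x) * g x) x e • u x) atTop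
      (𝓝 (∫ x, fderiv ℝ g x e • u x)) := by
    refine tendsto_integral_of_dominated_convergence
      (fun x => ‖fderiv ℝ g x e‖ * ‖u x‖ + C * ‖e‖ * (‖g x‖ * ‖u x‖)) ?_
      (i1.add (i2.const_mul _)) ?_ ?_
    · intro n
      simp only [hder]
      refine Continuous.aestronglyMeasurable ?_ |>.fun_smul hu.1
      have := hχ.continuous
      have := hg.continuous
      have : Continuous fun x : Bd => fderiv ℝ χ (s n • x) e :=
        hcχd.comp (continuous_const_smul (s n))
      fun_prop
    · intro n
      refine ae_of_all _ fun x => ?_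
      rw [hder, norm_smul]
      have h1 : ‖χ (s n • x) * fderiv ℝ g x e‖ ≤ 1 * ‖fderiv ℝ g x e‖ := by
        rw [norm_mul]
        gcongr
        exact hχ1 _
      have h2 : ‖s n * fderiv ℝ χ (s n • x) e * g x‖ ≤ 1 * (C * ‖e‖) * ‖g x‖ := by
        rw [norm_mul, norm_mul, Real.norm_of_nonneg (hs0 n).le]
        gcongr
        · exact hs1 n
        · exact ((fderiv ℝ χ (s n • x)).le_opNorm e).trans (by gcongr; exact hC _)
      calc _ ≤ (1 * ‖fderiv ℝ g x e‖ + 1 * (C * ‖e‖) * ‖g x‖) * ‖u x‖ := by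
            gcongr
            exact norm_add_le_of_le h1 h2
        _ = _ := by ring
    · refine ae_of_all _ fun x => ?_
      refine Tendsto.smul_const ?_ _
      simp only [hder]
      have t1 : Tendsto (fun n => χ (s n • x) * fderiv ℝ g x e) atTop (𝓝 (fderiv ℝ g x e)) := by
        refine tendsto_const_nhds.congr' ?_
        filter_upwards [hev x] with n hn
        rw [hn, one_mul]
      have t2 : Tendsto (fun n => s n * fderiv ℝ χ (s n • x) e * g x) atTop (𝓝 0) := by
        have t3 : Tendsto (fun n => s n • x) atTop (𝓝 0) := by simpa using hslim.smul_const x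
        have t4 := (hcχd.tendsto 0).comp t3
        simpa using (hslim.mul t4).mul_const (g x)
      simpa using t1.add t2
  have lim2 : Tendsto (fun n => -∫ x, (χ (s n • x) * g x) • w x) atTop (𝓝 (-∫ x, g x • w x)) := by
    refine (tendsto_integral_of_dominated_convergence (fun x => ‖g x‖ * ‖w x‖) ?_ i3 ?_ ?_).neg
    · intro n
      refine Continuous.aestronglyMeasurable ?_ |>.fun_smul hw.1
      have := hχ.continuous
      have := hg.continuous
      fun_prop
    · intro n
      refine ae_of_all _ fun x => ?_
      rw [norm_smul, norm_mul]
      calc _ ≤ 1 * ‖g x‖ * ‖w x‖ := by gcongr; exact hχ1 _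
        _ = _ := by ring
    · refine ae_of_all _ fun x => ?_
      refine Tendsto.smul_const ?_ _
      refine tendsto_const_nhds.congr' ?_
      filter_upwards [hev x] with n hn
      rw [hn, one_mul]
  simp only [hcut] at lim1
  exact tendsto_nhds_unique lim1 lim2

open LineDeriv in
/-- The definition of a weak derivative extends to complex Schwartz functions. -/
theorem IsWeakDeriv.integral_schwartz {e : Bd} {u w : Bd → ℂ} (h : IsWeakDeriv univ e u w)
    (hu : MemLp u 2 volume) (hw : MemLp w 2 volume) (φ : 𝓢(Bd, ℂ)) :
    ∫ x, (∂_{e} φ : 𝓢(Bd, ℂ)) x * u x = -∫ x, φ x * w x := by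
  have hφd : ∀ x, HasFDerivAt φ (fderiv ℝ φ x) x := fun x => φ.differentiableAt.hasFDerivAt
  have hre : ∀ x, fderiv ℝ (fun x => (φ x).re) x e = ((∂_{e} φ : 𝓢(Bd, ℂ)) x).re := fun x => by
    rw [SchwartzMap.lineDerivOp_apply_eq_fderiv]
    have := (Complex.reCLM.hasFDerivAt (x := φ x)).comp x (hφd x)
    exact congrArg (fun L => L e) this.fderiv
  have him : ∀ x, fderiv ℝ (fun x => (φ x).im) x e = ((∂_{e} φ : 𝓢(Bd, ℂ)) x).im := fun x => by
    rw [SchwartzMap.lineDerivOp_apply_eq_fderiv]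
    have := (Complex.imCLM.hasFDerivAt (x := φ x)).comp x (hφd x)
    exact congrArg (fun L => L e) this.fderiv
  have m1 : MemLp φ 2 volume := φ.memLp 2
  have m2 : MemLp (∂_{e} φ : 𝓢(Bd, ℂ)) 2 volume := (∂_{e} φ : 𝓢(Bd, ℂ)).memLp 2
  have r := h.integral_smooth hu hw (g := fun x => (φ x).re)
    (Complex.reCLM.contDiff.comp (φ.smooth _)) m1.re (by simp only [hre]; exact m2.re)
  have i := h.integral_smooth hu hw (g := fun x => (φ x).im)
    (Complex.imCLM.contDiff.comp (φ.smooth _)) m1.im (by simp only [him]; exact m2.im)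
  simp only [hre, him] at r i
  have split : ∀ {f : Bd → ℂ} {k : Bd → ℂ}, MemLp f 2 volume → MemLp k 2 volume →
      ∫ x, f x * k x = (∫ x, (f x).re • k x) + Complex.I * ∫ x, (f x).im • k x := by
    intro f k hf hk
    have j1 : Integrable (fun x => (f x).re • k x) := by
      simpa only [Complex.real_smul] using! hf.re.ofReal.integrable_mul hk
    have j2 : Integrable (fun x => (f x).im • k x) := by
      simpa only [Complex.real_smul] using! hf.im.ofReal.integrable_mul hk
    rw [← integral_const_mul, ← integral_add j1 (j2.const_mul _)]
    congr 1
    funext x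
    conv_lhs => rw [← Complex.re_add_im (f x)]
    simp only [Complex.real_smul]
    ring
  rw [split m2 hu, split m1 hw, r, i]
  ring

/-- The Fourier transform of a weak derivative. -/
theorem ft_weakDeriv {e : Bd} {u w : Bd → ℂ} (h : IsWeakDeriv univ e u w)
    (hu : MemLp u 2 volume) (hw : MemLp w 2 volume) :
    ft w =ᵐ[volume] fun ξ => 2 * Real.pi * Complex.I * inner ℝ ξ e * ft u ξ := by
  symm
  have hcont : Continuous fun ξ : Bd => (2 * Real.pi * Complex.I * inner ℝ ξ e : ℂ) := by fun_prop
  refine eq_ft_of_integral_eq hw ?_ fun φ _ => ?_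
  · have := (memLp_ft hu).locallyIntegrable one_le_two
    rw [← locallyIntegrableOn_univ] at this ⊢
    exact this.continuousOn_mul hcont.continuousOn isOpen_univ.isLocallyClosed
  · have h1 := h.integral_schwartz hu hw (𝓕 φ)
    rw [SchwartzMap.lineDerivOp_fourier_eq] at h1
    have h2 := integral_schwartz_mul_ft
      (-(2 * Real.pi * Complex.I) • smulLeftCLM ℂ (fun x => inner ℝ x e) φ) hu
    rw [h1] at h2
    have h3 : ∀ x, (-(2 * Real.pi * Complex.I) • smulLeftCLM ℂ (fun x => inner ℝ x e) φ) x =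
        -(2 * Real.pi * Complex.I) * (inner ℝ x e * φ x) := fun x => by
      have : (fun x : Bd => inner ℝ x e).HasTemperateGrowth := by fun_prop
      simp [SchwartzMap.smulLeftCLM_apply_apply this]
    simp only [h3] at h2
    rw [← neg_inj, ← h2, ← integral_neg]
    congr 1
    funext x
    ring

/-! ### The partial Fourier transform -/

theorem ae_ae_of_ae_prod_symm {α β : Type*} [MeasurableSpace α] [MeasurableSpace β]
    {μ : Measure α} {ν : Measure β} [SFinite μ] [SFinite ν] {p : α × β → Prop}
    (h : ∀ᵐ z ∂(μ.prod ν), p z) : ∀ᵐ x ∂ν, ∀ᵐ y ∂μ, p (y, x) :=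
  Measure.ae_ae_of_ae_prod
    ((Measure.measurePreserving_swap (μ := ν) (ν := μ)).quasiMeasurePreserving.ae h)

theorem norm_integral_mul_sq_le {β : Type*} [MeasurableSpace β] {ν : Measure β}
    {f g : β → ℂ} (hf : MemLp f 2 ν) (hg : MemLp g 2 ν) :
    ‖∫ x, f x * g x ∂ν‖ ^ 2 ≤ (∫ x, ‖f x‖ ^ 2 ∂ν) * ∫ x, ‖g x‖ ^ 2 ∂ν := by
  have h1 : ‖∫ x, f x * g x ∂ν‖ ≤ ∫ x, ‖f x‖ * ‖g x‖ ∂ν := by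
    refine (norm_integral_le_integral_norm _).trans_eq ?_
    simp only [norm_mul]
  have h2 := integral_mul_le_Lp_mul_Lq_of_nonneg (μ := ν) (p := 2) (q := 2)
    Real.HolderConjugate.two_two (f := fun x => ‖f x‖) (g := fun x => ‖g x‖)
    (ae_of_all _ fun x => norm_nonneg _) (ae_of_all _ fun x => norm_nonneg _)
    (by simpa using hf.norm) (by simpa using hg.norm)
  have p1 : 0 ≤ ∫ x, ‖f x‖ ^ 2 ∂ν := integral_nonneg fun x => by positivity
  have p2 : 0 ≤ ∫ x, ‖g x‖ ^ 2 ∂ν := integral_nonneg fun x => by positivity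
  simp only [Real.rpow_two, ← Real.sqrt_eq_rpow] at h2
  calc _ ≤ (√(∫ x, ‖f x‖ ^ 2 ∂ν) * √(∫ x, ‖g x‖ ^ 2 ∂ν)) ^ 2 := by
        gcongr
        exact h1.trans h2
    _ = _ := by rw [mul_pow, Real.sq_sqrt p1, Real.sq_sqrt p2]

section Slices

variable {α β : Type*} [MeasurableSpace α] [MeasurableSpace β]
    {μ : Measure α} {ν : Measure β} [SFinite μ] [SFinite ν] {u : α × β → ℂ}

theorem MemLp.ae_slice (hu : MemLp u 2 (μ.prod ν)) : ∀ᵐ y ∂μ, MemLp (fun x => u (y, x)) 2 ν := by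
  have h1 := hu.integrable_norm_pow two_ne_zero
  filter_upwards [hu.1.prodMk_left, h1.prod_right_ae] with y h2 h3
  exact (memLp_two_iff_integrable_sq_norm h2).2 h3

theorem MemLp.ae_slice_symm (hu : MemLp u 2 (μ.prod ν)) :
    ∀ᵐ x ∂ν, MemLp (fun y => u (y, x)) 2 μ :=
  MemLp.ae_slice (u := fun z : β × α => u (z.2, z.1))
    (hu.comp_measurePreserving Measure.measurePreserving_swap)

theorem lintegral_slice_symm (hu : MemLp u 2 (μ.prod ν)) :
    ∫⁻ z, ‖u z‖ₑ ^ 2 ∂(μ.prod ν) = ∫⁻ x, ∫⁻ y, ‖u (y, x)‖ₑ ^ 2 ∂μ ∂ν :=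
  lintegral_prod_symm _ (hu.1.enorm.pow_const 2)

theorem memLp_integral_mul (hu : MemLp u 2 (μ.prod ν)) {b : β → ℂ} (hb : MemLp b 2 ν) :
    MemLp (fun y => ∫ x, u (y, x) * b x ∂ν) 2 μ := by
  have hm : AEStronglyMeasurable (fun z : α × β => u z * b z.2) (μ.prod ν) :=
    hu.1.mul hb.1.comp_snd
  have hm' : AEStronglyMeasurable (fun y => ∫ x, u (y, x) * b x ∂ν) μ := hm.integral_prod_right'
  rw [memLp_two_iff_integrable_sq_norm hm']
  refine Integrable.mono' ((hu.integrable_norm_pow two_ne_zero).integral_prod_left.mul_const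
    (∫ x, ‖b x‖ ^ 2 ∂ν)) (hm'.norm.pow 2) ?_
  filter_upwards [MemLp.ae_slice hu] with y hy
  rw [Real.norm_of_nonneg (by positivity)]
  exact norm_integral_mul_sq_le hy hb

end Slices

/-- Cutting off an `L²` function by an increasing sequence of sets exhausting the space. -/
theorem tendsto_eLpNorm_sub_indicator {α : Type*} [MeasurableSpace α] {μ : Measure α} {u : α → ℂ}
    (hu : MemLp u 2 μ) {s : ℕ → Set α} (hs : ∀ n, MeasurableSet (s n))
    (hev : ∀ x, ∀ᶠ n in atTop, x ∈ s n) :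
    Tendsto (fun n => eLpNorm ((s n).indicator u - u) 2 μ) atTop (𝓝 0) := by
  have h : Tendsto (fun n => ∫⁻ x, ‖(s n).indicator u x - u x‖ₑ ^ 2 ∂μ) atTop
      (𝓝 (∫⁻ _, 0 ∂μ)) := by
    refine tendsto_lintegral_of_dominated_convergence' (fun x => ‖u x‖ₑ ^ 2) ?_ ?_ ?_ ?_
    · exact fun n => (((hu.1.indicator (hs n)).sub hu.1).enorm.pow_const 2)
    · refine fun n => ae_of_all _ fun x => ?_
      by_cases hx : x ∈ s n <;> simp [hx]
    · rw [lintegral_enorm_sq_eq]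
      exact (ENNReal.pow_lt_top hu.eLpNorm_lt_top).ne
    · refine ae_of_all _ fun x => tendsto_const_nhds.congr' ?_
      filter_upwards [hev x] with n hn
      simp [hn]
  simp only [lintegral_zero] at h
  have h2 := (ENNReal.continuous_rpow_const (y := 2⁻¹)).tendsto 0 |>.comp h
  rw [ENNReal.zero_rpow_of_pos (by norm_num)] at h2
  refine h2.congr fun n => ?_
  have h3 := lintegral_enorm_sq_eq (μ := μ) ((s n).indicator u - u)
  simp only [Pi.sub_apply] at h3
  simp only [Function.comp, h3]
  rw [← ENNReal.rpow_natCast, ← ENNReal.rpow_mul]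
  norm_num

/-- The partial Fourier transform in the first variable of an `L²` function on a product is an
`L²` function on the product. -/
theorem exists_partialFourier {β : Type*} [MeasurableSpace β] {ν : Measure β} [SFinite ν]
    {u : Bd × β → ℂ} (hu : MemLp u 2 ((volume : Measure Bd).prod ν)) :
    ∃ Φ : Bd × β → ℂ, MemLp Φ 2 ((volume : Measure Bd).prod ν) ∧
      ∀ᵐ x ∂ν, (fun ξ => Φ (ξ, x)) =ᵐ[volume] ft (fun y => u (y, x)) := by
  wlog hsm : StronglyMeasurable u
  · obtain ⟨Φ, h1, h2⟩ := this ((memLp_congr_ae hu.1.ae_eq_mk).1 hu) hu.1.stronglyMeasurable_mk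
    refine ⟨Φ, h1, ?_⟩
    filter_upwards [h2, ae_ae_of_ae_prod_symm hu.1.ae_eq_mk] with x h3 h4
    rwa [ft_congr_ae (v := fun y => hu.1.mk u (y, x)) h4]
  -- Truncated in the first variable, almost every slice is integrable and the Fourier integral is
  -- jointly measurable; Plancherel's theorem on slices makes these transforms a Cauchy sequence.
  set s : ℕ → Set (Bd × β) := fun n => {z | ‖z.1‖ ≤ n} with hs
  have hsm' : ∀ n, MeasurableSet (s n) := fun n =>
    measurableSet_le measurable_fst.norm measurable_const
  have hev : ∀ z : Bd × β, ∀ᶠ n in atTop, z ∈ s n := fun z => by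
    obtain ⟨N, hN⟩ := exists_nat_ge ‖z.1‖
    filter_upwards [eventually_ge_atTop N] with n hn
    exact hN.trans (by exact_mod_cast hn)
  set un : ℕ → Bd × β → ℂ := fun n => (s n).indicator u with hun
  have hunL : ∀ n, MemLp (un n) 2 ((volume : Measure Bd).prod ν) := fun n => hu.indicator (hsm' n)
  have hslice : ∀ n x, (fun y => un n (y, x)) =
      {y : Bd | ‖y‖ ≤ n}.indicator (fun y => u (y, x)) := fun n x => by
    funext y
    rfl
  have hball : ∀ n : ℕ, {y : Bd | ‖y‖ ≤ n} = Metric.closedBall 0 n := fun n => by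
    ext y; simp
  set Φn : ℕ → Bd × β → ℂ := fun n z => 𝓕 (fun y => un n (y, z.2)) z.1 with hΦn
  have hΦm : ∀ n, StronglyMeasurable (Φn n) := fun n => by
    have h1 : StronglyMeasurable (un n) := hsm.indicator (hsm' n)
    have h2 : StronglyMeasurable (fun q : (Bd × β) × Bd =>
        Real.fourierChar (-(inner ℝ q.2 q.1.1)) • un n (q.2, q.1.2)) := by
      have h3 : StronglyMeasurable (fun q : (Bd × β) × Bd => un n (q.2, q.1.2)) :=
        h1.comp_measurable (by fun_prop)
      have h4 : Measurable fun q : (Bd × β) × Bd => -(inner ℝ q.2 q.1.1 : ℝ) := by fun_prop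
      have h5 : StronglyMeasurable fun q : (Bd × β) × Bd =>
          (Real.fourierChar (-(inner ℝ q.2 q.1.1)) : ℂ) :=
        (((by fun_prop : Continuous fun z : Circle => (z : ℂ)).comp
          Real.continuous_fourierChar).measurable.comp h4).stronglyMeasurable
      exact h5.mul h3
    exact h2.integral_prod_right
  have hΦft : ∀ᵐ x ∂ν, ∀ n, (fun ξ => Φn n (ξ, x)) =ᵐ[volume] ft (fun y => un n (y, x)) := by
    filter_upwards [MemLp.ae_slice_symm hu] with x hx n
    have h1 : MemLp (fun y => un n (y, x)) 2 volume := by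
      rw [hslice, hball]
      exact hx.indicator measurableSet_closedBall
    refine ft_eq_fourier h1 ?_
    rw [hslice, hball, integrable_indicator_iff measurableSet_closedBall]
    have : IsFiniteMeasure (volume.restrict (Metric.closedBall (0 : Bd) n)) :=
      ⟨by rw [Measure.restrict_apply_univ]; exact measure_closedBall_lt_top⟩
    exact (hx.restrict _).integrable one_le_two
  have hpl : ∀ n m, eLpNorm (Φn n - Φn m) 2 ((volume : Measure Bd).prod ν) =
      eLpNorm (un n - un m) 2 ((volume : Measure Bd).prod ν) := fun n m => by
    have key : ∫⁻ z, ‖(Φn n - Φn m) z‖ₑ ^ 2 ∂((volume : Measure Bd).prod ν) =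
        ∫⁻ z, ‖(un n - un m) z‖ₑ ^ 2 ∂((volume : Measure Bd).prod ν) := by
      rw [lintegral_slice_symm ((hunL n).sub (hunL m)), lintegral_prod_symm _
        (((hΦm n).sub (hΦm m)).aestronglyMeasurable.enorm.pow_const 2)]
      refine lintegral_congr_ae ?_
      filter_upwards [hΦft, MemLp.ae_slice_symm (hunL n), MemLp.ae_slice_symm (hunL m)]
        with x hx h1 h2
      have h3 := lintegral_ft_sq (h1.sub h2)
      refine Eq.trans (lintegral_congr_ae ?_) h3
      filter_upwards [hx n, hx m, ft_sub h1 h2] with ξ e1 e2 e3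
      rw [Pi.sub_apply]
      rw [e1, e2, ← e3]
      rfl
    rw [lintegral_enorm_sq_eq, lintegral_enorm_sq_eq] at key
    exact (ENNReal.pow_right_strictMono two_ne_zero).injective key
  have hun0 := tendsto_eLpNorm_sub_indicator hu hsm' hev
  have hΦL : ∀ n, MemLp (Φn n) 2 ((volume : Measure Bd).prod ν) := fun n => by
    refine ⟨(hΦm n).aestronglyMeasurable, ?_⟩
    have key : ∫⁻ z, ‖Φn n z‖ₑ ^ 2 ∂((volume : Measure Bd).prod ν) =
        ∫⁻ z, ‖un n z‖ₑ ^ 2 ∂((volume : Measure Bd).prod ν) := by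
      rw [lintegral_slice_symm (hunL n), lintegral_prod_symm _
        ((hΦm n).aestronglyMeasurable.enorm.pow_const 2)]
      refine lintegral_congr_ae ?_
      filter_upwards [hΦft, MemLp.ae_slice_symm (hunL n)] with x hx h1
      refine Eq.trans (lintegral_congr_ae ?_) (lintegral_ft_sq h1)
      filter_upwards [hx n] with ξ e1
      rw [e1]
    rw [lintegral_enorm_sq_eq, lintegral_enorm_sq_eq] at key
    rw [(ENNReal.pow_right_strictMono two_ne_zero).injective key]
    exact (hunL n).eLpNorm_lt_top
  have hU : CauchySeq fun n => (hunL n).toLp (un n) := by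
    have : Tendsto (fun n => (hunL n).toLp (un n)) atTop (𝓝 (hu.toLp u)) :=
      (Lp.tendsto_Lp_iff_tendsto_eLpNorm'' _ hunL _ hu).2 hun0
    exact this.cauchySeq
  have hF : CauchySeq fun n => (hΦL n).toLp (Φn n) := by
    rw [EMetric.cauchySeq_iff] at hU ⊢
    simpa only [Lp.edist_toLp_toLp, hpl] using hU
  obtain ⟨F, hΦ⟩ := cauchySeq_tendsto_of_complete hF
  set Φ : Bd × β → ℂ := (F : Bd × β → ℂ) with hΦdef
  have hΦ' : Tendsto (fun n => eLpNorm (Φn n - Φ) 2 ((volume : Measure Bd).prod ν)) atTop (𝓝 0) := by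
    rw [← Lp.toLp_coeFn F (Lp.memLp F)] at hΦ
    exact (Lp.tendsto_Lp_iff_tendsto_eLpNorm'' _ hΦL _ (Lp.memLp F)).1 hΦ
  -- A subsequence converges almost everywhere; on almost every slice a further subsequence converges
  -- to the Fourier transform of the slice.
  obtain ⟨k, hk, hlim⟩ := (tendstoInMeasure_of_tendsto_eLpNorm two_ne_zero
    (fun n => (hΦL n).1) (Lp.memLp F).1 hΦ').exists_seq_tendsto_ae
  refine ⟨Φ, Lp.memLp F, ?_⟩
  filter_upwards [hΦft, MemLp.ae_slice_symm hu, ae_ae_of_ae_prod_symm hlim] with x h1 h2 h3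
  have hn : ∀ n, MemLp (fun y => un n (y, x)) 2 volume := fun n => by
    rw [hslice, hball]
    exact h2.indicator measurableSet_closedBall
  have h4 : Tendsto (fun n => eLpNorm (ft (fun y => un n (y, x)) - ft (fun y => u (y, x))) 2 volume)
      atTop (𝓝 0) := by
    refine (tendsto_eLpNorm_sub_indicator h2 (s := fun n : ℕ => {y : Bd | ‖y‖ ≤ n})
      (fun n => by rw [hball]; exact measurableSet_closedBall)
      (fun y => hev (y, x))).congr fun n => ?_
    rw [← hslice]
    refine (eLpNorm_ft ((hn n).sub h2)).symm.trans ?_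
    exact eLpNorm_congr_ae (ft_sub (hn n) h2)
  obtain ⟨j, hj, hjlim⟩ := ((tendstoInMeasure_of_tendsto_eLpNorm two_ne_zero
    (fun n => (memLp_ft (hn n)).1) (memLp_ft h2).1 h4).comp hk.tendsto_atTop).exists_seq_tendsto_ae
  filter_upwards [h3, hjlim, ae_all_iff.2 h1] with ξ e1 e2 e3
  refine tendsto_nhds_unique (e1.comp hj.tendsto_atTop) (e2.congr fun n => ?_)
  exact (e3 (k (j n))).symm

theorem integrable_mul_mul {α β : Type*} [MeasurableSpace α] [MeasurableSpace β]
    {μ : Measure α} {ν : Measure β} {u : α × β → ℂ} {f : α → ℂ} {b : β → ℂ}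
    (hu : MemLp u 2 (μ.prod ν)) (hf : MemLp f 2 μ) (hb : MemLp b 2 ν) :
    Integrable (fun z => f z.1 * (u z * b z.2)) (μ.prod ν) := by
  have h1 : AEStronglyMeasurable (fun z : α × β => f z.1 * b z.2) (μ.prod ν) :=
    hf.1.comp_fst.mul hb.1.comp_snd
  have h2 : MemLp (fun z : α × β => f z.1 * b z.2) 2 (μ.prod ν) := by
    rw [memLp_two_iff_integrable_sq_norm h1]
    have := ((hf.integrable_norm_pow two_ne_zero).mul_prod (hb.integrable_norm_pow two_ne_zero))
    simpa [mul_pow] using this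
  refine (h2.integrable_mul hu).congr (ae_of_all _ fun z => ?_)
  simp only [Pi.mul_apply]
  ring

section Fubini

variable {α β : Type*} [MeasurableSpace α] [MeasurableSpace β]
    {μ : Measure α} {ν : Measure β} [SFinite μ] [SFinite ν] {u : α × β → ℂ} {f : α → ℂ} {b : β → ℂ}

theorem integral_prod_mul_mul (hu : MemLp u 2 (μ.prod ν)) (hf : MemLp f 2 μ) (hb : MemLp b 2 ν) :
    ∫ z, f z.1 * (u z * b z.2) ∂(μ.prod ν) = ∫ y, f y * ∫ x, u (y, x) * b x ∂ν ∂μ := by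
  rw [integral_prod _ (integrable_mul_mul hu hf hb)]
  simp only [integral_const_mul]

theorem integral_mul_integral_mul (hu : MemLp u 2 (μ.prod ν)) (hf : MemLp f 2 μ)
    (hb : MemLp b 2 ν) :
    ∫ y, f y * ∫ x, u (y, x) * b x ∂ν ∂μ = ∫ x, (∫ y, f y * u (y, x) ∂μ) * b x ∂ν := by
  rw [← integral_prod_mul_mul hu hf hb, integral_prod_symm _ (integrable_mul_mul hu hf hb)]
  simp only [← integral_mul_const, mul_assoc]

end Fubini

/-- The Fourier transform commutes with integration in the other variable. -/
theorem ft_integral_mul {β : Type*} [MeasurableSpace β] {ν : Measure β} [SFinite ν]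
    {u Φ : Bd × β → ℂ} (hu : MemLp u 2 ((volume : Measure Bd).prod ν))
    (hΦ : MemLp Φ 2 ((volume : Measure Bd).prod ν))
    (h : ∀ᵐ x ∂ν, (fun ξ => Φ (ξ, x)) =ᵐ[volume] ft (fun y => u (y, x)))
    {b : β → ℂ} (hb : MemLp b 2 ν) :
    ft (fun y => ∫ x, u (y, x) * b x ∂ν) =ᵐ[volume] fun ξ => ∫ x, Φ (ξ, x) * b x ∂ν := by
  symm
  refine eq_ft_of_integral_eq (memLp_integral_mul hu hb)
    ((memLp_integral_mul hΦ hb).locallyIntegrable one_le_two) fun φ _ => ?_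
  rw [integral_mul_integral_mul hΦ (φ.memLp 2) hb, integral_mul_integral_mul hu ((𝓕 φ).memLp 2) hb]
  refine integral_congr_ae ?_
  filter_upwards [h, MemLp.ae_slice_symm hu] with x hx hux
  rw [← integral_schwartz_mul_ft φ hux]
  congr 1
  refine integral_congr_ae ?_
  filter_upwards [hx] with ξ hξ
  rw [hξ]

/-- A function on the half-line with vanishing integrals over all rational intervals vanishes. -/
theorem ae_eq_zero_of_intervalIntegral_eq_zero {f : ℝ → ℂ}
    (hf : ∀ r : ℝ, 0 < r → IntervalIntegrable f volume 0 r)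
    (h : ∀ q r : ℚ, 0 < q → q < r → ∫ x in (q : ℝ)..r, f x = 0) :
    ∀ᵐ x ∂(volume.restrict (Ioi (0 : ℝ))), f x = 0 := by
  set F : ℝ → ℂ := fun x => ∫ s in (0 : ℝ)..x, f s with hF
  have hcont : ContinuousOn F (Ioi 0) := by
    intro x hx
    have hx : 0 < x := hx
    have h1 : ContinuousOn F (uIcc 0 (x + 1)) :=
      intervalIntegral.continuousOn_primitive_interval (by
        rw [uIcc_of_le (by linarith)]
        exact (intervalIntegrable_iff_integrableOn_Icc_of_le (by linarith)).1 (hf _ (by linarith)))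
    refine (h1.continuousAt ?_).continuousWithinAt
    rw [uIcc_of_le (by linarith)]
    exact Icc_mem_nhds hx (by linarith)
  have hrat : ∀ q r : ℚ, 0 < q → 0 < r → F q = F r := by
    have key : ∀ q r : ℚ, 0 < q → q < r → F q = F r := fun q r hq hqr => by
      have hr : (0 : ℝ) < r := by exact_mod_cast hq.trans hqr
      have hq' : (0 : ℝ) < q := by exact_mod_cast hq
      have := intervalIntegral.integral_interval_sub_left (hf _ hr) (hf _ hq')
      rw [h q r hq hqr] at this
      exact (sub_eq_zero.1 this).symm
    intro q r hq hr
    rcases lt_trichotomy q r with h1 | h1 | h1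
    · exact key q r hq h1
    · rw [h1]
    · exact (key r q hr h1).symm
  have hconst : EqOn F (fun _ => F 1) (Ioi 0) := by
    have hd : (Ioi (0 : ℝ)) ⊆ closure (Ioi 0 ∩ range ((↑) : ℚ → ℝ)) :=
      Rat.denseRange_cast.open_subset_closure_inter isOpen_Ioi
    refine EqOn.of_subset_closure (s := Ioi 0 ∩ range ((↑) : ℚ → ℝ)) ?_ hcont continuousOn_const
      inter_subset_left hd
    rintro _ ⟨hx, q, rfl⟩
    have hq : (0 : ℚ) < q := by exact_mod_cast (show (0 : ℝ) < q from hx)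
    simpa using hrat q 1 hq one_pos
  have hae : ∀ᵐ x : ℝ, ∀ n : ℕ, x ∈ uIcc (0 : ℝ) (n + 1) → ∀ c ∈ uIcc (0 : ℝ) (n + 1),
      HasDerivAt (fun x => ∫ t in c..x, f t) (f x) x :=
    ae_all_iff.2 fun n => (hf (n + 1) (by positivity)).ae_hasDerivAt_integral
  filter_upwards [ae_restrict_of_ae hae, ae_restrict_mem measurableSet_Ioi] with x hx hx0
  have hx0' : 0 < x := hx0
  obtain ⟨n, hn⟩ := exists_nat_ge x
  have h1 := hx n (by rw [uIcc_of_le (by positivity)]; exact ⟨hx0'.le, by linarith⟩) 0 (by simp)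
  have h2 : HasDerivAt (fun _ : ℝ => F 1) (f x) x := h1.congr_of_eventuallyEq (by
    filter_upwards [Ioi_mem_nhds hx0'] with z hz
    exact (hconst hz).symm)
  exact h2.unique (hasDerivAt_const x (F 1))

/-- If a function on a product with the half-line is orthogonal to each test function of the second
variable, then it vanishes. -/
theorem ae_ae_eq_zero_of_integral_mul {α : Type*} [MeasurableSpace α] {μ : Measure α}
    {R : α × ℝ → ℂ}
    (hR : ∀ᵐ y ∂μ, ∀ r : ℝ, 0 < r → IntervalIntegrable (fun x => R (y, x)) volume 0 r)
    (h : ∀ b : ℝ → ℝ, ContDiff ℝ ∞ b → HasCompactSupport b → tsupport b ⊆ Ioi 0 →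
      ∀ᵐ y ∂μ, ∫ x in Ioi (0 : ℝ), R (y, x) * b x = 0) :
    ∀ᵐ y ∂μ, ∀ᵐ x ∂(volume.restrict (Ioi (0 : ℝ))), R (y, x) = 0 := by
  -- Countably many test functions suffice: smooth approximations of the indicators of rational
  -- intervals. They yield an exceptional null set independent of the test function.
  set b : ℚ → ℚ → ℕ → ℝ → ℝ := fun q r n x =>
    Real.smoothTransition (n * (x - q)) * Real.smoothTransition (n * (r - x)) with hb
  have hb0 : ∀ (q r : ℚ) n x, x ∉ Icc (q : ℝ) r → b q r n x = 0 := by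
    intro q r n x hx
    simp only [hb]
    by_cases h1 : (q : ℝ) ≤ x
    · have h2 : (r : ℝ) - x ≤ 0 := by
        by_contra h3
        exact hx ⟨h1, by linarith⟩
      rw [Real.smoothTransition.zero_of_nonpos (mul_nonpos_of_nonneg_of_nonpos (by positivity) h2),
        mul_zero]
    · rw [Real.smoothTransition.zero_of_nonpos
        (mul_nonpos_of_nonneg_of_nonpos (by positivity) (by linarith)), zero_mul]
  have hbs : ∀ q r n, ContDiff ℝ ∞ (b q r n) := fun q r n =>
    (Real.smoothTransition.contDiff.comp (by fun_prop)).mul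
      (Real.smoothTransition.contDiff.comp (by fun_prop))
  have hb1 : ∀ q r n x, ‖b q r n x‖ ≤ 1 := by
    intro q r n x
    rw [Real.norm_of_nonneg (mul_nonneg (Real.smoothTransition.nonneg _)
      (Real.smoothTransition.nonneg _))]
    exact mul_le_one₀ (Real.smoothTransition.le_one _) (Real.smoothTransition.nonneg _)
      (Real.smoothTransition.le_one _)
  have hlim : ∀ q r x, Tendsto (fun n => b q r n x) atTop
      (𝓝 ((Ioo (q : ℝ) r).indicator (fun _ => 1) x)) := by
    have one : ∀ d : ℝ, 0 < d → ∀ᶠ n : ℕ in atTop, Real.smoothTransition (n * d) = 1 :=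
      fun d hd => by
        filter_upwards [(tendsto_natCast_atTop_atTop.atTop_mul_const hd).eventually_ge_atTop 1]
          with n hn
        exact Real.smoothTransition.one_of_one_le hn
    intro q r x
    by_cases hx : x ∈ Ioo (q : ℝ) r
    · rw [indicator_of_mem hx]
      refine tendsto_const_nhds.congr' ?_
      filter_upwards [one _ (sub_pos.2 hx.1), one _ (sub_pos.2 hx.2)] with n h1 h2
      simp only [hb, h1, h2, mul_one]
    · rw [indicator_of_notMem hx]
      refine tendsto_const_nhds.congr fun n => ?_
      simp only [hb]
      by_cases h1 : (q : ℝ) < x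
      · have h2 : (r : ℝ) - x ≤ 0 := by
          by_contra h3
          exact hx ⟨h1, by linarith⟩
        rw [Real.smoothTransition.zero_of_nonpos (x := n * (r - x))
          (mul_nonpos_of_nonneg_of_nonpos (by positivity) h2), mul_zero]
      · rw [Real.smoothTransition.zero_of_nonpos
          (mul_nonpos_of_nonneg_of_nonpos (by positivity) (by linarith)), zero_mul]
  have hall : ∀ᵐ y ∂μ, ∀ q r : ℚ, 0 < q → q < r → ∀ n,
      ∫ x in Ioi (0 : ℝ), R (y, x) * b q r n x = 0 := by
    refine ae_all_iff.2 fun q => ae_all_iff.2 fun r => ?_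
    by_cases hq : 0 < q ∧ q < r
    · have : ∀ᵐ y ∂μ, ∀ n, ∫ x in Ioi (0 : ℝ), R (y, x) * b q r n x = 0 := by
        refine ae_all_iff.2 fun n => h _ (hbs q r n) ?_ ?_
        · exact HasCompactSupport.intro isCompact_Icc fun x hx => hb0 q r n x hx
        · have hs : tsupport (b q r n) ⊆ Icc (q : ℝ) r :=
            closure_minimal (fun x hx => by_contra fun h => hx (hb0 q r n x h)) isClosed_Icc
          refine hs.trans fun x hx => ?_
          have : (0 : ℝ) < q := by exact_mod_cast hq.1
          exact this.trans_le hx.1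
      filter_upwards [this] with y hy _ _ using hy
    · exact ae_of_all _ fun y h1 h2 => absurd ⟨h1, h2⟩ hq
  filter_upwards [hR, hall] with y h1 h2
  refine ae_eq_zero_of_intervalIntegral_eq_zero h1 fun q r hq hqr => ?_
  have hq' : (0 : ℝ) < q := by exact_mod_cast hq
  have hqr' : (q : ℝ) < r := by exact_mod_cast hqr
  have hr' : (0 : ℝ) < r := hq'.trans hqr'
  have hi : IntegrableOn (fun x => R (y, x)) (Ioc 0 (r : ℝ)) := (h1 r hr').1
  have h3 : Tendsto (fun n => ∫ x in Ioc (0 : ℝ) r, R (y, x) * b q r n x) atTop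
      (𝓝 (∫ x in Ioc (0 : ℝ) r, R (y, x) * ((Ioo (q : ℝ) r).indicator (fun _ => 1) x : ℝ))) := by
    refine tendsto_integral_of_dominated_convergence (fun x => ‖R (y, x)‖) ?_ hi.norm ?_ ?_
    · exact fun n => hi.1.mul
        (Complex.continuous_ofReal.comp (hbs q r n).continuous).aestronglyMeasurable
    · refine fun n => ae_of_all _ fun x => ?_
      rw [norm_mul, Complex.norm_real]
      exact mul_le_of_le_one_right (norm_nonneg _) (hb1 q r n x)
    · exact ae_of_all _ fun x =>
        ((Complex.continuous_ofReal.tendsto _).comp (hlim q r x)).const_mul _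
  have h4 : ∀ n, ∫ x in Ioc (0 : ℝ) r, R (y, x) * b q r n x = 0 := fun n => by
    rw [← h2 q r hq hqr n]
    refine (setIntegral_eq_of_subset_of_forall_sdiff_eq_zero measurableSet_Ioi Ioc_subset_Ioi_self
      ?_).symm
    rintro x ⟨hx, hx'⟩
    rw [hb0 q r n x (fun h => hx' ⟨hx, h.2⟩)]
    simp
  simp only [h4] at h3
  have h5 := tendsto_nhds_unique tendsto_const_nhds h3
  rw [intervalIntegral.integral_of_le hqr'.le, h5]
  have h6 : ∀ x, R (y, x) * ((Ioo (q : ℝ) r).indicator (fun _ => (1 : ℝ)) x : ℝ) =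
      (Ioo (q : ℝ) r).indicator (fun x => R (y, x)) x := fun x => by
    by_cases hx : x ∈ Ioo (q : ℝ) r <;> simp [hx]
  simp only [h6]
  rw [setIntegral_indicator measurableSet_Ioo, integral_Ioc_eq_integral_Ioo]
  congr 2
  ext x
  exact ⟨fun hx => ⟨⟨hq'.trans hx.1, hx.2.le⟩, hx⟩, fun hx => hx.2⟩

/-! ### Weak derivatives under the partial Fourier transform -/
theorem integrable_mul_of_memLp {α : Type*} [MeasurableSpace α] {μ : Measure α} {f g : α → ℂ}
    (hf : MemLp f 2 μ) (hg : MemLp g 2 μ) : Integrable (fun x => f x * g x) μ :=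
  hf.integrable_mul hg

theorem volume_restrict_Om :
    (volume : Measure Sp).restrict Om = (volume : Measure Bd).prod (volume.restrict (Ioi (0 : ℝ))) := by
  have : Om = univ ×ˢ Ioi (0 : ℝ) := by
    ext x; simp [Om]
  rw [this, Measure.volume_eq_prod, ← Measure.prod_restrict, Measure.restrict_univ]

theorem memLp_of_test {E : Type*} [NormedAddCommGroup E] [NormedSpace ℝ E] [MeasurableSpace E]
    [BorelSpace E] {μ : Measure E} [IsFiniteMeasureOnCompacts μ] {b : E → ℝ} (h1 : Continuous b)
    (h2 : HasCompactSupport b) : MemLp (fun x => (b x : ℂ)) 2 μ :=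
  MemLp.ofReal (h1.memLp_of_hasCompactSupport h2)

/-- The derivative of a product test function. -/
theorem fderiv_tensor {a : Bd → ℝ} {B : ℝ → ℝ} (ha : Differentiable ℝ a) (hB : Differentiable ℝ B)
    (z : Sp) (e : Sp) :
    fderiv ℝ (fun z : Sp => a z.1 * B z.2) z e =
      fderiv ℝ a z.1 e.1 * B z.2 + a z.1 * (deriv B z.2 * e.2) := by
  have h1 : HasFDerivAt (fun z : Sp => a z.1)
      ((fderiv ℝ a z.1).comp (ContinuousLinearMap.fst ℝ Bd ℝ)) z :=
    (ha z.1).hasFDerivAt.comp z hasFDerivAt_fst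
  have h2 : HasFDerivAt (fun z : Sp => B z.2)
      ((fderiv ℝ B z.2).comp (ContinuousLinearMap.snd ℝ Bd ℝ)) z :=
    (hB z.2).hasFDerivAt.comp z hasFDerivAt_snd
  rw [(h1.fun_mul h2).fderiv]
  have h3 : fderiv ℝ B z.2 e.2 = deriv B z.2 * e.2 := by
    rw [fderiv_eq_smul_deriv, smul_eq_mul, mul_comm]
  simp [h3]
  ring

theorem hasCompactSupport_tensor {a : Bd → ℝ} {B : ℝ → ℝ} (ha : HasCompactSupport a)
    (hB : HasCompactSupport B) : HasCompactSupport (fun z : Sp => a z.1 * B z.2) := by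
  refine HasCompactSupport.intro (ha.prod hB) fun z hz => ?_
  by_cases h : z.1 ∈ tsupport a
  · rw [image_eq_zero_of_notMem_tsupport (fun h2 => hz ⟨h, h2⟩), mul_zero]
  · rw [image_eq_zero_of_notMem_tsupport h, zero_mul]

theorem tsupport_tensor_subset {a : Bd → ℝ} {B : ℝ → ℝ} (hB : tsupport B ⊆ Ioi 0) :
    tsupport (fun z : Sp => a z.1 * B z.2) ⊆ Om := by
  have : tsupport (fun z : Sp => a z.1 * B z.2) ⊆ Prod.snd ⁻¹' tsupport B := by
    refine closure_minimal (fun z hz => ?_) ((isClosed_tsupport B).preimage continuous_snd)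
    exact subset_closure fun h => hz (by simp [h])
  exact this.trans fun z hz => hB hz

/-- Averaging a tangential weak derivative on the half-space in the normal variable. -/
theorem IsWeakDeriv.integral_normal {e : Bd} {u w : Sp → ℂ} (h : IsWeakDeriv Om (e, 0) u w)
    (hu : MemLp u 2 (volume.restrict Om)) (hw : MemLp w 2 (volume.restrict Om)) {b : ℝ → ℝ}
    (hb : ContDiff ℝ ∞ b) (hbc : HasCompactSupport b) (hbs : tsupport b ⊆ Ioi 0) :
    IsWeakDeriv univ e (fun y => ∫ x in Ioi (0 : ℝ), u (y, x) * b x)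
      (fun y => ∫ x in Ioi (0 : ℝ), w (y, x) * b x) := by
  rw [volume_restrict_Om] at hu hw
  have hbL : MemLp (fun x => (b x : ℂ)) 2 (volume.restrict (Ioi (0 : ℝ))) :=
    (memLp_of_test hb.continuous hbc)
  refine ⟨((memLp_integral_mul hu hbL).locallyIntegrable one_le_two).locallyIntegrableOn _,
    ((memLp_integral_mul hw hbL).locallyIntegrable one_le_two).locallyIntegrableOn _, ?_⟩
  intro a ha hac _
  have had : ContDiff ℝ ∞ fun y => fderiv ℝ a y e :=
    (ha.fderiv_right (m := ∞) (by simp)).clm_apply contDiff_const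
  have hadc : HasCompactSupport fun y => fderiv ℝ a y e := hac.fderiv_apply (𝕜 := ℝ) e
  have key := h.2.2 (fun z => a z.1 * b z.2)
    ((ha.comp contDiff_fst).mul (hb.comp contDiff_snd)) (hasCompactSupport_tensor hac hbc)
    (tsupport_tensor_subset hbs)
  simp only [fderiv_tensor (ha.differentiable (by simp)) (hb.differentiable (by simp)), mul_zero,
    add_zero, volume_restrict_Om] at key
  have e1 := integral_prod_mul_mul hu
    (memLp_of_test (μ := (volume : Measure Bd)) had.continuous hadc) hbL
  have e2 := integral_prod_mul_mul hw
    (memLp_of_test (μ := (volume : Measure Bd)) ha.continuous hac) hbL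
  simp only [Measure.restrict_univ, Complex.real_smul]
  rw [← e1, ← e2]
  simp only [Complex.real_smul, Complex.ofReal_mul] at key
  refine (integral_congr_ae (ae_of_all _ fun z => ?_)).trans (key.trans (congrArg Neg.neg
    (integral_congr_ae (ae_of_all _ fun z => ?_))))
  · ring
  · ring

/-- The partial Fourier transform of a tangential weak derivative. -/
theorem partialFourier_tangential {e : Bd} {u w Φ Ψ : Sp → ℂ} (h : IsWeakDeriv Om (e, 0) u w)
    (hu : MemLp u 2 (volume.restrict Om)) (hw : MemLp w 2 (volume.restrict Om))
    (hΦ : MemLp Φ 2 (volume.restrict Om)) (hΨ : MemLp Ψ 2 (volume.restrict Om))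
    (hΦu : ∀ᵐ x ∂(volume.restrict (Ioi (0 : ℝ))),
      (fun ξ => Φ (ξ, x)) =ᵐ[volume] ft (fun y => u (y, x)))
    (hΨw : ∀ᵐ x ∂(volume.restrict (Ioi (0 : ℝ))),
      (fun ξ => Ψ (ξ, x)) =ᵐ[volume] ft (fun y => w (y, x))) :
    ∀ᵐ ξ : Bd, ∀ᵐ x ∂(volume.restrict (Ioi (0 : ℝ))),
      Ψ (ξ, x) = 2 * Real.pi * Complex.I * inner ℝ ξ e * Φ (ξ, x) := by
  have hu' := hu
  have hw' := hw
  rw [volume_restrict_Om] at hu hw hΦ hΨ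
  have hΦs := MemLp.ae_slice hΦ
  have hΨs := MemLp.ae_slice hΨ
  have := ae_ae_eq_zero_of_integral_mul (μ := (volume : Measure Bd))
    (R := fun z : Bd × ℝ => Ψ z - 2 * Real.pi * Complex.I * inner ℝ z.1 e * Φ z) ?_ ?_
  · filter_upwards [this] with ξ h1
    filter_upwards [h1] with x h2
    exact sub_eq_zero.1 h2
  · filter_upwards [hΦs, hΨs] with ξ h1 h2 r hr
    exact MemLp.intervalIntegrable_of_Ioi (h2.sub (h1.const_mul _)) hr.le
  · intro b hb hbc hbs
    have hbL : MemLp (fun x => (b x : ℂ)) 2 (volume.restrict (Ioi (0 : ℝ))) :=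
      (memLp_of_test hb.continuous hbc)
    have h1 := ft_weakDeriv (h.integral_normal hu' hw' hb hbc hbs) (memLp_integral_mul hu hbL)
      (memLp_integral_mul hw hbL)
    filter_upwards [h1, ft_integral_mul hu hΦ hΦu hbL, ft_integral_mul hw hΨ hΨw hbL, hΦs, hΨs]
      with ξ h2 h3 h4 h5 h6
    rw [h3, h4] at h2
    simp only [sub_mul, mul_assoc]
    rw [integral_sub (integrable_mul_of_memLp h6 hbL), sub_eq_zero, h2]
    · simp only [← integral_const_mul, mul_assoc]
    · simpa only [mul_assoc] using integrable_mul_of_memLp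
        (h5.const_mul (2 * Real.pi * Complex.I * inner ℝ ξ e)) hbL

/-- A compactly supported antiderivative on the half-line of a test function: the antiderivative
vanishing at infinity, cut off on the negative axis, where its values are irrelevant. -/
theorem exists_antideriv {b : ℝ → ℝ} (hb : ContDiff ℝ ∞ b) (hbc : HasCompactSupport b) :
    ∃ (B : ℝ → ℝ) (r : ℝ), 0 < r ∧ ContDiff ℝ ∞ B ∧ HasCompactSupport B ∧ (∀ x, r ≤ x → b x = 0) ∧
      (∀ x, 0 < x → deriv B x = b x) ∧ (∀ x, r ≤ x → B x = 0) ∧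
      ∀ x, 0 ≤ x → B x = (∫ s in (0 : ℝ)..x, b s) - ∫ s in (0 : ℝ)..r, b s := by
  obtain ⟨r, hr, hbr⟩ : ∃ r : ℝ, 0 < r ∧ ∀ x, r ≤ x → b x = 0 := by
    obtain ⟨M, hM⟩ := hbc.isCompact.bddAbove
    refine ⟨max M 0 + 1, by positivity, fun x hx => ?_⟩
    refine image_eq_zero_of_notMem_tsupport fun h => ?_
    have := hM h
    have := le_max_left M 0
    linarith
  have hint : ∀ x y, IntervalIntegrable b volume x y := fun x y => hb.continuous.intervalIntegrable _ _
  set K : ℝ → ℝ := fun x => (∫ s in (0 : ℝ)..x, b s) - ∫ s in (0 : ℝ)..r, b s with hK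
  have hKd : ∀ x, HasDerivAt K (b x) x := fun x =>
    (intervalIntegral.integral_hasDerivAt_right (hint _ _)
      (hb.continuous.stronglyMeasurableAtFilter _ _) hb.continuous.continuousAt).sub_const _
  have hKr : ∀ x, r ≤ x → K x = 0 := fun x hx => by
    simp only [hK]
    rw [intervalIntegral.integral_interval_sub_left (hint _ _) (hint _ _)]
    refine intervalIntegral.integral_zero_ae (ae_of_all _ fun s hs => ?_)
    rw [uIoc_of_le hx] at hs
    exact hbr s hs.1.le
  have hKs : ContDiff ℝ ∞ K := by
    rw [contDiff_infty_iff_deriv]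
    refine ⟨fun x => (hKd x).differentiableAt, ?_⟩
    rwa [show deriv K = b from funext fun x => (hKd x).deriv]
  have hθ : ∀ x : ℝ, 0 ≤ x → Real.smoothTransition (x + 1) = 1 := fun x hx =>
    Real.smoothTransition.one_of_one_le (by linarith)
  refine ⟨fun x => Real.smoothTransition (x + 1) * K x, r, hr,
    (Real.smoothTransition.contDiff.comp (by fun_prop)).mul hKs, ?_, hbr, ?_, ?_, ?_⟩
  · refine HasCompactSupport.intro (isCompact_Icc (a := -1) (b := r)) fun x hx => ?_
    by_cases h1 : r ≤ x
    · rw [hKr x h1, mul_zero]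
    · have h2 : x + 1 ≤ 0 := by
        by_contra h3
        exact hx ⟨by linarith, by linarith⟩
      rw [Real.smoothTransition.zero_of_nonpos h2, zero_mul]
  · intro x hx
    refine HasDerivAt.deriv ((hKd x).congr_of_eventuallyEq ?_)
    filter_upwards [Ioi_mem_nhds hx] with z hz
    rw [hθ z (le_of_lt hz), one_mul]
  · intro x hx
    change _ * K x = 0
    rw [hKr x hx, mul_zero]
  · intro x hx
    change Real.smoothTransition (x + 1) * K x = K x
    rw [hθ x hx, one_mul]

/-- Green's formula on the half-space makes the partial Fourier transform absolutely continuous in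
the normal variable, with the Fourier transform of the trace as its value at the boundary. -/
theorem partialFourier_normal {u w Φ Ψ : Sp → ℂ} {g : Bd → ℂ}
    (hu : MemLp u 2 (volume.restrict Om)) (hw : MemLp w 2 (volume.restrict Om))
    (hg : MemLp g 2 volume)
    (hgreen : ∀ φ : Sp → ℝ, ContDiff ℝ ∞ φ → HasCompactSupport φ →
        ∫ x in Om, (fderiv ℝ φ x (0, 1) • u x + φ x • w x) = -∫ y : Bd, φ (y, 0) • g y)
    (hΦ : MemLp Φ 2 (volume.restrict Om)) (hΨ : MemLp Ψ 2 (volume.restrict Om))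
    (hΦu : ∀ᵐ x ∂(volume.restrict (Ioi (0 : ℝ))),
      (fun ξ => Φ (ξ, x)) =ᵐ[volume] ft (fun y => u (y, x)))
    (hΨw : ∀ᵐ x ∂(volume.restrict (Ioi (0 : ℝ))),
      (fun ξ => Ψ (ξ, x)) =ᵐ[volume] ft (fun y => w (y, x))) :
    ∀ᵐ ξ : Bd, IsPrimitive (fun x => Φ (ξ, x)) (fun x => Ψ (ξ, x)) (ft g ξ) := by
  rw [volume_restrict_Om] at hu hw hΦ hΨ
  have hΦs := MemLp.ae_slice hΦ
  have hΨs := MemLp.ae_slice hΨ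
  have := ae_ae_eq_zero_of_integral_mul (μ := (volume : Measure Bd))
    (R := fun z : Bd × ℝ => Φ z - (ft g z.1 + ∫ s in (0 : ℝ)..z.2, Ψ (z.1, s))) ?_ ?_
  · filter_upwards [this] with ξ h1
    filter_upwards [h1] with x h2
    exact sub_eq_zero.1 h2
  · filter_upwards [hΦs, hΨs] with ξ h1 h2 r hr
    refine (MemLp.intervalIntegrable_of_Ioi h1 hr.le).sub (intervalIntegrable_const.add ?_)
    refine ContinuousOn.intervalIntegrable
      (intervalIntegral.continuousOn_primitive_interval ?_)
    rw [uIcc_of_le hr.le]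
    exact (intervalIntegrable_iff_integrableOn_Icc_of_le hr.le).1
      (MemLp.intervalIntegrable_of_Ioi h2 hr.le)
  · intro b hb hbc hbs
    -- Green's formula is applied to products `a(y) B(x)` with `B` the antiderivative of `b` that
    -- vanishes at infinity.
    obtain ⟨B, r, hr, hB, hBc, hbr, hBd, hBr, hBeq⟩ := exists_antideriv hb hbc
    have hbL : MemLp (fun x => (b x : ℂ)) 2 (volume.restrict (Ioi (0 : ℝ))) :=
      (memLp_of_test hb.continuous hbc)
    have hBL : MemLp (fun x => (B x : ℂ)) 2 (volume.restrict (Ioi (0 : ℝ))) :=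
      (memLp_of_test hB.continuous hBc)
    have hub := memLp_integral_mul hu hbL
    have hwB := memLp_integral_mul hw hBL
    have hphys : (fun y => (∫ x in Ioi (0 : ℝ), u (y, x) * b x) + ∫ x in Ioi (0 : ℝ), w (y, x) * B x)
        =ᵐ[volume] fun y => (-(B 0 : ℂ)) * g y := by
      refine ae_eq_of_integral_contDiff_smul_eq ((hub.add hwB).locallyIntegrable one_le_two)
        ((hg.const_mul _).locallyIntegrable one_le_two) fun a ha hac => ?_
      have haL := memLp_of_test (μ := (volume : Measure Bd)) ha.continuous hac
      have key := hgreen (fun z => a z.1 * B z.2)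
        ((ha.comp contDiff_fst).mul (hB.comp contDiff_snd)) (hasCompactSupport_tensor hac hBc)
      have e1 := integral_prod_mul_mul hu haL hbL
      have e2 := integral_prod_mul_mul hw haL hBL
      simp only [fderiv_tensor (ha.differentiable (by simp)) (hB.differentiable (by simp)), mul_one,
        map_zero, zero_mul, zero_add, volume_restrict_Om, Complex.real_smul,
        Complex.ofReal_mul] at key
      simp only [Complex.real_smul, mul_add]
      rw [integral_add (integrable_mul_of_memLp haL hub) (integrable_mul_of_memLp haL hwB), ← e1, ← e2,
        ← integral_add (integrable_mul_mul hu haL hbL) (integrable_mul_mul hw haL hBL)]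
      trans -∫ y, (a y : ℂ) * B 0 * g y
      · rw [← key]
        refine integral_congr_ae ?_
        have h1 : ∀ᵐ z ∂((volume : Measure Bd).prod (volume.restrict (Ioi (0 : ℝ)))), z ∈ Om := by
          rw [← volume_restrict_Om]
          exact ae_restrict_mem (measurableSet_lt measurable_const measurable_snd)
        filter_upwards [h1] with z hz
        rw [hBd z.2 hz]
        ring
      · rw [← integral_neg]
        congr 1
        funext y
        ring
    have hfour := (ft_add hub hwB).symm.trans
      ((Eq.eventuallyEq (ft_congr_ae hphys)).trans (ft_const_mul _ hg))
    filter_upwards [hfour, ft_integral_mul hu hΦ hΦu hbL, ft_integral_mul hw hΨ hΨw hBL, hΦs, hΨs]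
      with ξ h1 h2 h3 h4 h5
    rw [h2, h3] at h1
    have hΨI := MemLp.intervalIntegrable_of_Ioi h5 hr.le
    have hbI : IntervalIntegrable (fun x => (b x : ℂ)) volume 0 r :=
      MemLp.intervalIntegrable_of_Ioi hbL hr.le
    have hBC : ∀ x, 0 ≤ x → (B x : ℂ) = -(∫ s in (0 : ℝ)..r, (b s : ℂ)) + ∫ s in (0 : ℝ)..x, (b s : ℂ) :=
      fun x hx => by
        rw [hBeq x hx, intervalIntegral.integral_ofReal, intervalIntegral.integral_ofReal]
        push_cast
        ring
    have hparts := primitive_mul_primitive (ft g ξ) (B 0 : ℂ) hΨI hbI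
    have hcut : ∀ {f : ℝ → ℂ}, (∀ x, r < x → f x = 0) →
        ∫ x in Ioi (0 : ℝ), f x = ∫ x in (0 : ℝ)..r, f x := fun {f} hf => by
      rw [intervalIntegral.integral_of_le hr.le]
      refine setIntegral_eq_of_subset_of_forall_sdiff_eq_zero measurableSet_Ioi Ioc_subset_Ioi_self ?_
      rintro x ⟨hx, hx'⟩
      exact hf x (by by_contra h; exact hx' ⟨hx, not_lt.1 h⟩)
    have hprim : IntervalIntegrable (fun x => (ft g ξ + ∫ s in (0 : ℝ)..x, Ψ (ξ, s)) * (b x : ℂ))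
        volume 0 r := by
      refine hbI.continuousOn_mul (continuousOn_const.add
        (intervalIntegral.continuousOn_primitive_interval ?_))
      rw [uIcc_of_le hr.le]
      exact (intervalIntegrable_iff_integrableOn_Icc_of_le hr.le).1 hΨI
    have hΨB : IntervalIntegrable (fun x => Ψ (ξ, x) * (B x : ℂ)) volume 0 r :=
      hΨI.mul_continuousOn (Complex.continuous_ofReal.comp hB.continuous).continuousOn
    have hprim' : IntegrableOn (fun x => (ft g ξ + ∫ s in (0 : ℝ)..x, Ψ (ξ, s)) * (b x : ℂ))
        (Ioi 0) := by
      refine ((intervalIntegrable_iff_integrableOn_Ioc_of_le hr.le).1 hprim).of_forall_sdiff_eq_zero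
        measurableSet_Ioi ?_
      rintro x ⟨hx, hx'⟩
      rw [hbr x (by by_contra h; exact hx' ⟨hx, (not_le.1 h).le⟩)]
      simp
    have hsum : (∫ x in Ioi (0 : ℝ), Ψ (ξ, x) * (B x : ℂ)) +
        ∫ x in Ioi (0 : ℝ), (ft g ξ + ∫ s in (0 : ℝ)..x, Ψ (ξ, s)) * (b x : ℂ) =
        -(ft g ξ * B 0) := by
      rw [hcut (fun x hx => by rw [hBr x hx.le]; simp), hcut (fun x hx => by rw [hbr x hx.le]; simp),
        ← intervalIntegral.integral_add hΨB hprim]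
      have h6 : (B 0 : ℂ) = -∫ s in (0 : ℝ)..r, (b s : ℂ) := by
        rw [hBC 0 le_rfl]; simp
      rw [h6, neg_add_cancel, mul_zero, zero_sub, ← h6] at hparts
      rw [hparts]
      refine intervalIntegral.integral_congr fun x hx => ?_
      rw [uIcc_of_le hr.le] at hx
      rw [hBC x hx.1, ← h6]
    simp only [sub_mul]
    rw [integral_sub (integrable_mul_of_memLp h4 hbL) hprim']
    linear_combination h1 - hsum

/-! ### Weak derivatives and exponential weights -/

theorem integrableOn_smul_test {E : Type*} [NormedAddCommGroup E] [MeasureSpace E] [BorelSpace E]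
    {O : Set E} {u : E → ℂ} (hO : IsOpen O) (hu : LocallyIntegrableOn u O volume) {φ : E → ℝ}
    (hφ : Continuous φ) (hc : HasCompactSupport φ) (hs : tsupport φ ⊆ O) :
    IntegrableOn (fun x => φ x • u x) O volume := by
  have h1 : IntegrableOn u (tsupport φ) volume := hu.integrableOn_compact_subset hs hc.isCompact
  refine (h1.continuousOn_smul hφ.continuousOn hc.isCompact).of_forall_sdiff_eq_zero
    hO.measurableSet fun x hx => ?_
  rw [image_eq_zero_of_notMem_tsupport hx.2, zero_smul]

theorem tsupport_fderiv_apply_subset {E : Type*} [NormedAddCommGroup E] [NormedSpace ℝ E]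
    (φ : E → ℝ) (e : E) :
    tsupport (fun x => fderiv ℝ φ x e) ⊆ tsupport φ :=
  closure_minimal (fun x hx => support_fderiv_subset ℝ (f := φ) fun h => hx (by
    simp only [h, zero_apply])) (isClosed_tsupport φ)

section WeakDeriv

variable {E : Type*} [NormedAddCommGroup E] [NormedSpace ℝ E] [MeasureSpace E] [BorelSpace E]
  [FiniteDimensional ℝ E] {O : Set E} {e : E} {u w : E → ℂ}

/-- Leibniz' rule. -/
theorem IsWeakDeriv.smul (hO : IsOpen O) (h : IsWeakDeriv O e u w) {m : E → ℝ}
    (hm : ContDiff ℝ ∞ m) :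
    IsWeakDeriv O e (fun x => m x • u x) (fun x => fderiv ℝ m x e • u x + m x • w x) := by
  have hmd : ContDiff ℝ ∞ fun x => fderiv ℝ m x e :=
    (hm.fderiv_right (m := ∞) (by simp)).clm_apply contDiff_const
  have loc : ∀ {f : E → ℂ} {k : E → ℝ}, LocallyIntegrableOn f O volume → Continuous k →
      LocallyIntegrableOn (fun x => k x • f x) O volume := fun hf hk =>
    hf.continuousOn_smul hO.isLocallyClosed hk.continuousOn
  refine ⟨loc h.1 hm.continuous, (loc h.1 hmd.continuous).add (loc h.2.1 hm.continuous), ?_⟩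
  intro φ hφ hc hs
  have hφd : Continuous fun x => fderiv ℝ φ x e :=
    (hφ.continuous_fderiv (by simp)).clm_apply continuous_const
  have hder : ∀ x, fderiv ℝ (fun x => m x * φ x) x e = fderiv ℝ m x e * φ x + m x * fderiv ℝ φ x e :=
    fun x => by
      rw [(((hm.differentiable (by simp)) x).hasFDerivAt.fun_mul
        ((hφ.differentiable (by simp)) x).hasFDerivAt).fderiv]
      simp
      ring
  have key := h.2.2 (fun x => m x * φ x) (hm.mul hφ) hc.mul_left
    ((closure_mono (Function.support_mul_subset_right m φ)).trans hs)
  simp only [hder] at key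
  have i1 : IntegrableOn (fun x => φ x • fderiv ℝ m x e • u x) O volume :=
    integrableOn_smul_test hO (loc h.1 hmd.continuous) hφ.continuous hc hs
  have i2 : IntegrableOn (fun x => φ x • m x • w x) O volume :=
    integrableOn_smul_test hO (loc h.2.1 hm.continuous) hφ.continuous hc hs
  have i3 : IntegrableOn (fun x => fderiv ℝ φ x e • m x • u x) O volume :=
    integrableOn_smul_test hO (loc h.1 hm.continuous) hφd (hc.fderiv_apply (𝕜 := ℝ) e)
      ((tsupport_fderiv_apply_subset φ e).trans hs)
  have e1 : ∫ x in O, (fderiv ℝ m x e * φ x + m x * fderiv ℝ φ x e) • u x =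
      (∫ x in O, φ x • fderiv ℝ m x e • u x) + ∫ x in O, fderiv ℝ φ x e • m x • u x := by
    rw [← integral_add i1 i3]
    congr 1
    funext x
    simp only [Complex.real_smul]
    push_cast
    ring
  have e2 : ∫ x in O, (m x * φ x) • w x = ∫ x in O, φ x • m x • w x := by
    congr 1
    funext x
    simp only [Complex.real_smul]
    push_cast
    ring
  rw [e1, e2] at key
  simp only [smul_add]
  rw [integral_add i1 i2]
  linear_combination key

theorem IsWeakDeriv.unique (hO : IsOpen O) {w' : E → ℂ} (h : IsWeakDeriv O e u w)
    (h' : IsWeakDeriv O e u w') : w =ᵐ[volume.restrict O] w' := by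
  rw [Filter.EventuallyEq, ae_restrict_iff' hO.measurableSet]
  have := hO.ae_eq_zero_of_integral_contDiff_smul_eq_zero (h.2.1.sub h'.2.1) fun φ hφ hc hs => by
    have hz : ∫ x, φ x • (w - w') x = ∫ x in O, φ x • (w - w') x :=
      (setIntegral_eq_integral_of_forall_compl_eq_zero fun x hx => by
        rw [image_eq_zero_of_notMem_tsupport fun h => hx (hs h), zero_smul]).symm
    rw [hz]
    simp only [Pi.sub_apply, smul_sub]
    rw [integral_sub (integrableOn_smul_test hO h.2.1 hφ.continuous hc hs)
      (integrableOn_smul_test hO h'.2.1 hφ.continuous hc hs)]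
    have h1 := h.2.2 φ hφ hc hs
    have h2 := h'.2.2 φ hφ hc hs
    linear_combination h1 - h2
  filter_upwards [this] with x hx hxO
  exact sub_eq_zero.1 (hx hxO)

theorem IsWeakDeriv.weakDeriv_ae_eq (hO : IsOpen O) (h : IsWeakDeriv O e u w) :
    weakDeriv O e u =ᵐ[volume.restrict O] w := by
  have hex : ∃ w, IsWeakDeriv O e u w := ⟨w, h⟩
  rw [weakDeriv, dif_pos hex]
  exact hex.choose_spec.unique hO h

/-- Weak derivatives of an exponentially weighted function. -/
theorem weakDeriv_of_weight (hO : IsOpen O) (ℓ : E →L[ℝ] ℝ)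
    (h : IsWeakDeriv O e (fun x => Real.exp (-ℓ x) • u x) w) :
    ∀ᵐ x ∂(volume.restrict O), Real.exp (-ℓ x) • weakDeriv O e u x =
      w x + (ℓ e : ℂ) * (Real.exp (-ℓ x) • u x) := by
  have hm : ContDiff ℝ ∞ fun x => Real.exp (ℓ x) := ℓ.contDiff.exp
  have hd : ∀ x, fderiv ℝ (fun x => Real.exp (ℓ x)) x e = Real.exp (ℓ x) * ℓ e := fun x => by
    rw [(ℓ.hasFDerivAt.exp).fderiv]
    simp
  have hcancel : ∀ x, (Real.exp (ℓ x) : ℂ) * Real.exp (-ℓ x) = 1 := fun x => by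
    rw [← Complex.ofReal_mul, ← Real.exp_add, add_neg_cancel, Real.exp_zero, Complex.ofReal_one]
  have h1 := h.smul hO hm
  have hu : (fun x => Real.exp (ℓ x) • Real.exp (-ℓ x) • u x) = u := by
    funext x
    simp only [Complex.real_smul]
    rw [← mul_assoc, hcancel, one_mul]
  rw [hu] at h1
  filter_upwards [h1.weakDeriv_ae_eq hO] with x hx
  rw [hx, hd]
  simp only [Complex.real_smul, Complex.ofReal_mul]
  linear_combination (w x + ℓ e * (Real.exp (-ℓ x)) * u x) * hcancel x

end WeakDeriv

/-! ### Green's formula and traces -/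

theorem isOpen_Om : IsOpen Om := isOpen_lt continuous_const continuous_snd

/-- Green's formula on the half-space for a function `u` with normal derivative `w` and boundary
values `g`. -/
def Green (u w : Sp → ℂ) (g : Bd → ℂ) : Prop :=
  ∀ φ : Sp → ℝ, ContDiff ℝ ∞ φ → HasCompactSupport φ →
    ∫ x in Om, (fderiv ℝ φ x (0, 1) • u x + φ x • w x) = -∫ y : Bd, φ (y, 0) • g y

theorem integrableOn_smul_of_memLp {f : Sp → ℂ} (hf : MemLp f 2 (volume.restrict Om)) {φ : Sp → ℝ}
    (hφ : Continuous φ) (hc : HasCompactSupport φ) :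
    IntegrableOn (fun x => φ x • f x) Om volume :=
  (hf.locallyIntegrable one_le_two).integrable_smul_left_of_hasCompactSupport hφ hc

/-- The integral in Green's formula vanishes for test functions vanishing on the boundary. -/
theorem IsWeakDeriv.integral_eq_zero_of_boundary_zero {u w : Sp → ℂ}
    (h : IsWeakDeriv Om (0, 1) u w) (hu : MemLp u 2 (volume.restrict Om))
    (hw : MemLp w 2 (volume.restrict Om)) {ψ : Sp → ℝ} (hψ : ContDiff ℝ ∞ ψ)
    (hc : HasCompactSupport ψ) (h0 : ∀ y, ψ (y, 0) = 0) :
    ∫ x in Om, (fderiv ℝ ψ x (0, 1) • u x + ψ x • w x) = 0 := by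
  set χ : ℝ → ℝ := fun s => Real.smoothTransition (s - 1) with hχ
  have hχs : ContDiff ℝ ∞ χ := Real.smoothTransition.contDiff.comp (by fun_prop)
  have hχ0 : ∀ s, s ≤ 1 → χ s = 0 := fun s hs =>
    Real.smoothTransition.zero_of_nonpos (by linarith)
  have hχ1 : ∀ s, 2 ≤ s → χ s = 1 := fun s hs =>
    Real.smoothTransition.one_of_one_le (by linarith)
  have hχd : Continuous (deriv χ) := hχs.continuous_deriv (by simp)
  have hχd0 : ∀ s, 2 < s → deriv χ s = 0 := fun s hs => by
    refine HasDerivAt.deriv ((hasDerivAt_const s (1 : ℝ)).congr_of_eventuallyEq ?_)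
    filter_upwards [Ioi_mem_nhds hs] with z hz
    exact hχ1 z (le_of_lt hz)
  have hχd0' : ∀ s, s < 1 → deriv χ s = 0 := fun s hs => by
    refine HasDerivAt.deriv ((hasDerivAt_const s (0 : ℝ)).congr_of_eventuallyEq ?_)
    filter_upwards [Iio_mem_nhds hs] with z hz
    exact hχ0 z (le_of_lt hz)
  obtain ⟨K, hK⟩ : ∃ K, ∀ s, ‖s * deriv χ s‖ ≤ K := by
    refine (continuous_id.mul hχd).bounded_above_of_compact_support ?_
    refine HasCompactSupport.intro (isCompact_Icc (a := 1) (b := 2)) fun s hs => ?_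
    by_cases h1 : 2 < s
    · simp [hχd0 s h1]
    · have : s < 1 := by
        by_contra h2
        exact hs ⟨by linarith, by linarith⟩
      simp [hχd0' s this]
  obtain ⟨M, hM⟩ := (hψ.continuous_fderiv (by simp)).bounded_above_of_compact_support
    (hc.fderiv (𝕜 := ℝ))
  have hM0 : 0 ≤ M := (norm_nonneg _).trans (hM 0)
  have hψM : ∀ x : Sp, ‖ψ x‖ ≤ M * ‖x.2‖ := fun x => by
    have := Convex.norm_image_sub_le_of_norm_fderiv_le (𝕜 := ℝ) (f := ψ) (s := univ) (x := (x.1, 0))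
      (y := x) (fun z _ => (hψ.differentiable (by simp)) z) (fun z _ => hM z) convex_univ
      (mem_univ _) (mem_univ _)
    rw [h0, sub_zero] at this
    refine this.trans_eq ?_
    congr 1
    simp [Prod.norm_def]
  -- The cut-off near the boundary costs a factor `n`, which is compensated by `|ψ x| ≤ M x₂`.
  set ψn : ℕ → Sp → ℝ := fun n x => χ (n * x.2) * ψ x with hψn
  have hχn : ∀ (n : ℕ) (x : Sp), HasFDerivAt (fun x : Sp => χ (n * x.2))
      (deriv χ (n * x.2) • ((n : ℝ) • ContinuousLinearMap.snd ℝ Bd ℝ)) x := fun n x => by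
    have h1 : HasFDerivAt (fun x : Sp => (n : ℝ) * x.2) ((n : ℝ) • ContinuousLinearMap.snd ℝ Bd ℝ) x :=
      (hasFDerivAt_snd).const_mul _
    exact ((hχs.differentiable (by simp)) _).hasDerivAt.comp_hasFDerivAt x h1
  have hder : ∀ n x, fderiv ℝ (ψn n) x (0, 1) =
      χ (n * x.2) * fderiv ℝ ψ x (0, 1) + n * deriv χ (n * x.2) * ψ x := fun n x => by
    simp only [hψn]
    rw [((hχn n x).fun_mul ((hψ.differentiable (by simp)) x).hasFDerivAt).fderiv]
    simp
    ring
  have hψns : ∀ n, ContDiff ℝ ∞ (ψn n) := fun n => (hχs.comp (by fun_prop)).mul hψ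
  have hsupp : ∀ n, tsupport (ψn n) ⊆ Om := fun n => by
    have h1 : tsupport (ψn n) ⊆ {x : Sp | 1 ≤ n * x.2} := by
      refine closure_minimal (fun x hx => ?_)
        (isClosed_le continuous_const (by fun_prop))
      by_contra h2
      exact hx (by simp only [hψn]; rw [hχ0 _ (le_of_lt (not_le.1 h2)), zero_mul])
    refine h1.trans fun x hx => ?_
    by_contra h2
    have h3 : x.2 ≤ 0 := not_lt.1 h2
    have h4 : (n : ℝ) * x.2 ≤ 0 := mul_nonpos_of_nonneg_of_nonpos (by positivity) h3
    have h5 : 1 ≤ (n : ℝ) * x.2 := hx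
    linarith
  have hdc : ∀ {φ : Sp → ℝ}, ContDiff ℝ ∞ φ → Continuous fun x => fderiv ℝ φ x (0, 1) :=
    fun hφ => (hφ.continuous_fderiv (by simp)).clm_apply continuous_const
  have hcn : ∀ n, HasCompactSupport (ψn n) := fun n => hc.mul_left
  have hzero : ∀ n, ∫ x in Om, (fderiv ℝ (ψn n) x (0, 1) • u x + ψn n x • w x) = 0 := fun n => by
    rw [integral_add (integrableOn_smul_of_memLp hu (hdc (hψns n)) ((hcn n).fderiv_apply (𝕜 := ℝ) _))
      (integrableOn_smul_of_memLp hw (hψns n).continuous (hcn n)),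
      h.2.2 _ (hψns n) (hcn n) (hsupp n), neg_add_cancel]
  have hχle : ∀ s, ‖χ s‖ ≤ 1 := fun s => by
    rw [Real.norm_of_nonneg (Real.smoothTransition.nonneg _)]
    exact Real.smoothTransition.le_one _
  have hindi : IntegrableOn ((tsupport ψ).indicator fun x => u x) Om volume := by
    have : IntegrableOn u (tsupport ψ) (volume.restrict Om) :=
      (hu.locallyIntegrable one_le_two).integrableOn_isCompact hc.isCompact
    exact (integrable_indicator_iff (isClosed_tsupport ψ).measurableSet).2 this
  have i1 := integrableOn_smul_of_memLp hu (hdc hψ) (hc.fderiv_apply (𝕜 := ℝ) _)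
  have i2 := integrableOn_smul_of_memLp hw hψ.continuous hc
  have hlim : Tendsto (fun n => ∫ x in Om, (fderiv ℝ (ψn n) x (0, 1) • u x + ψn n x • w x)) atTop
      (𝓝 (∫ x in Om, (fderiv ℝ ψ x (0, 1) • u x + ψ x • w x))) := by
    refine tendsto_integral_of_dominated_convergence
      (fun x => ‖fderiv ℝ ψ x (0, 1) • u x‖ + M * K * ‖(tsupport ψ).indicator (fun x => u x) x‖ +
        ‖ψ x • w x‖) ?_ ((i1.norm.add (hindi.norm.const_mul _)).add i2.norm) ?_ ?_
    · exact fun n => ((hdc (hψns n)).aestronglyMeasurable.smul hu.1).add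
        ((hψns n).continuous.aestronglyMeasurable.smul hw.1)
    · intro n
      refine ae_of_all _ fun x => ?_
      rw [hder, add_smul]
      refine norm_add_le_of_le (norm_add_le_of_le ?_ ?_) ?_
      · rw [mul_smul, norm_smul]
        exact mul_le_of_le_one_left (norm_nonneg _) (hχle _)
      · by_cases hx : x ∈ tsupport ψ
        · rw [indicator_of_mem hx, norm_smul]
          gcongr
          calc ‖n * deriv χ (n * x.2) * ψ x‖ = ‖(n : ℝ) * deriv χ (n * x.2)‖ * ‖ψ x‖ := norm_mul _ _
            _ ≤ ‖(n : ℝ) * deriv χ (n * x.2)‖ * (M * ‖x.2‖) := by gcongr; exact hψM x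
            _ = M * ‖n * x.2 * deriv χ (n * x.2)‖ := by simp only [norm_mul]; ring
            _ ≤ M * K := by gcongr; exact hK _
        · rw [image_eq_zero_of_notMem_tsupport hx]
          simp [hx]
      · simp only [hψn]
        rw [mul_smul, norm_smul]
        exact mul_le_of_le_one_left (norm_nonneg _) (hχle _)
    · filter_upwards [ae_restrict_mem isOpen_Om.measurableSet] with x hx
      have hx : 0 < x.2 := hx
      refine tendsto_const_nhds.congr' ?_
      filter_upwards [(tendsto_natCast_atTop_atTop.atTop_mul_const hx).eventually_gt_atTop 2]
        with n hn
      rw [hder]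
      simp only [hψn]
      rw [hχ1 _ hn.le, hχd0 _ hn]
      simp
  simp only [hzero] at hlim
  exact (tendsto_nhds_unique tendsto_const_nhds hlim).symm

/-- An `L²` function on the half-space with `L²` normal derivative has an `L²` trace,
given by integrating the equation `(θ u)' = θ' u + θ w` in the normal variable for a cut-off `θ`
equal to `1` at the boundary. -/
theorem IsWeakDeriv.exists_green {u w : Sp → ℂ} (h : IsWeakDeriv Om (0, 1) u w)
    (hu : MemLp u 2 (volume.restrict Om)) (hw : MemLp w 2 (volume.restrict Om)) :
    ∃ g : Bd → ℂ, MemLp g 2 volume ∧ Green u w g := by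
  set θ : ContDiffBump (0 : ℝ) := ⟨1, 2, one_pos, one_lt_two⟩
  have hθs : ContDiff ℝ ∞ θ := θ.contDiff
  have hθc : HasCompactSupport θ := θ.hasCompactSupport
  have hθd : Continuous (deriv θ) := hθs.continuous_deriv (by simp)
  have hθ0 : θ 0 = 1 := θ.eventuallyEq_one.self_of_nhds
  have hθL : MemLp (fun x => (θ x : ℂ)) 2 (volume.restrict (Ioi (0 : ℝ))) :=
    memLp_of_test hθs.continuous hθc
  have hθdL : MemLp (fun x => ((deriv θ x : ℝ) : ℂ)) 2 (volume.restrict (Ioi (0 : ℝ))) :=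
    memLp_of_test hθd hθc.deriv
  have hu' := hu
  have hw' := hw
  rw [volume_restrict_Om] at hu' hw'
  have m1 := memLp_integral_mul hu' hθdL
  have m2 := memLp_integral_mul hw' hθL
  refine ⟨fun y => -((∫ x in Ioi (0 : ℝ), u (y, x) * ((deriv θ x : ℝ) : ℂ)) +
    ∫ x in Ioi (0 : ℝ), w (y, x) * (θ x : ℂ)), (m1.add m2).neg, ?_⟩
  intro φ hφ hc
  set a : Bd → ℝ := fun y => φ (y, 0) with ha
  have has : ContDiff ℝ ∞ a := hφ.comp (by fun_prop)
  have hac : HasCompactSupport a :=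
    hc.comp_isClosedEmbedding (g := fun y : Bd => (y, (0 : ℝ)))
      (Topology.IsClosedEmbedding.of_continuous_injective_isClosedMap (by fun_prop)
        (fun y z h => (Prod.ext_iff.1 h).1) (isClosedMap_prodMk_right 0))
  have haL := memLp_of_test (μ := (volume : Measure Bd)) has.continuous hac
  set κ : Sp → ℝ := fun z => a z.1 * θ z.2 with hκ
  have hκs : ContDiff ℝ ∞ κ := (has.comp contDiff_fst).mul (hθs.comp contDiff_snd)
  have hκc : HasCompactSupport κ := hasCompactSupport_tensor hac hθc
  have hz := h.integral_eq_zero_of_boundary_zero hu hw (hφ.sub hκs) (hc.sub hκc) (fun y => by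
    simp [hκ, ha, hθ0])
  have hdc : ∀ {φ : Sp → ℝ}, ContDiff ℝ ∞ φ → Continuous fun x => fderiv ℝ φ x (0, 1) :=
    fun hφ => (hφ.continuous_fderiv (by simp)).clm_apply continuous_const
  have hint : ∀ {φ : Sp → ℝ}, ContDiff ℝ ∞ φ → HasCompactSupport φ →
      IntegrableOn (fun x => fderiv ℝ φ x (0, 1) • u x + φ x • w x) Om volume := fun hφ hc =>
    (integrableOn_smul_of_memLp hu (hdc hφ) (hc.fderiv_apply (𝕜 := ℝ) _)).add
      (integrableOn_smul_of_memLp hw hφ.continuous hc)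
  have hsplit : ∫ x in Om, (fderiv ℝ φ x (0, 1) • u x + φ x • w x) =
      ∫ x in Om, (fderiv ℝ κ x (0, 1) • u x + κ x • w x) := by
    rw [← sub_eq_zero, ← integral_sub (hint hφ hc) (hint hκs hκc), ← hz]
    congr 1
    funext x
    rw [fderiv_fun_sub ((hφ.differentiable (by simp)) x) ((hκs.differentiable (by simp)) x)]
    simp only [sub_apply, sub_smul]
    ring
  have e1 := integral_prod_mul_mul hu' haL hθdL
  have e2 := integral_prod_mul_mul hw' haL hθL
  rw [hsplit]
  simp only [hκ, fderiv_tensor (has.differentiable (by simp)) (hθs.differentiable (by simp)),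
    map_zero, zero_mul, zero_add, mul_one, volume_restrict_Om, Complex.real_smul,
    Complex.ofReal_mul, mul_neg, mul_add]
  rw [integral_neg, neg_neg,
    integral_add (integrable_mul_of_memLp haL m1) (integrable_mul_of_memLp haL m2), ← e1, ← e2,
    ← integral_add (integrable_mul_mul hu' haL hθdL) (integrable_mul_mul hw' haL hθL)]
  refine integral_congr_ae (ae_of_all _ fun z => ?_)
  simp only
  ring

/-- Traces are unique, because the normal derivative in Green's formula is the weak derivative. -/
theorem IsTrace.unique {u : Sp → ℂ} {g g' : Bd → ℂ} (h : IsTrace u g) (h' : IsTrace u g') :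
    g =ᵐ[volume] g' := by
  obtain ⟨hu, hg, w, hw, hG⟩ := h
  obtain ⟨-, hg', w', hw', hG'⟩ := h'
  have weak : ∀ {w : Sp → ℂ} {g : Bd → ℂ}, LocallyIntegrable w (volume.restrict Om) →
      Green u w g → IsWeakDeriv Om (0, 1) u w := by
    intro w g hw hG
    have hu1 := locallyIntegrableOn_of_locallyIntegrable_restrict hu
    have hw1 := locallyIntegrableOn_of_locallyIntegrable_restrict hw
    refine ⟨hu1, hw1, fun φ hφ hc hs => ?_⟩
    have key := hG φ hφ hc
    have hz : ∀ y : Bd, φ (y, 0) = 0 := fun y =>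
      image_eq_zero_of_notMem_tsupport fun h => lt_irrefl (0 : ℝ) (hs h)
    simp only [hz, zero_smul, integral_zero, neg_zero] at key
    have hφd : Continuous fun x => fderiv ℝ φ x (0, 1) :=
      (hφ.continuous_fderiv (by simp)).clm_apply continuous_const
    rw [integral_add (integrableOn_smul_test isOpen_Om hu1 hφd (hc.fderiv_apply (𝕜 := ℝ) _)
        ((tsupport_fderiv_apply_subset φ _).trans hs))
      (integrableOn_smul_test isOpen_Om hw1 hφ.continuous hc hs)] at key
    linear_combination key
  have hww := (weak hw hG).unique isOpen_Om (weak hw' hG')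
  refine ae_eq_of_integral_contDiff_smul_eq hg hg' fun a ha hac => ?_
  set θ : ContDiffBump (0 : ℝ) := ⟨1, 2, one_pos, one_lt_two⟩
  have hθ0 : θ 0 = 1 := θ.eventuallyEq_one.self_of_nhds
  have k1 := hG (fun z => a z.1 * θ z.2) ((ha.comp contDiff_fst).mul (θ.contDiff.comp contDiff_snd))
    (hasCompactSupport_tensor hac θ.hasCompactSupport)
  have k2 := hG' (fun z => a z.1 * θ z.2) ((ha.comp contDiff_fst).mul (θ.contDiff.comp contDiff_snd))
    (hasCompactSupport_tensor hac θ.hasCompactSupport)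
  simp only [hθ0, mul_one] at k1 k2
  rw [← neg_inj, ← k1, ← k2]
  refine integral_congr_ae ?_
  filter_upwards [hww] with x hx
  rw [hx]

theorem IsTrace.trace_ae_eq {u : Sp → ℂ} {g : Bd → ℂ} (h : IsTrace u g) :
    trace u =ᵐ[volume] g := by
  have hex : ∃ g, IsTrace u g := ⟨g, h⟩
  rw [trace, dif_pos hex]
  exact hex.choose_spec.unique h

/-- Multiplication of Green's formula by a function of the tangential variables. -/
theorem Green.isTrace_smul {u w : Sp → ℂ} {g : Bd → ℂ} (h : Green u w g)
    (hu : MemLp u 2 (volume.restrict Om)) (hw : MemLp w 2 (volume.restrict Om))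
    (hg : MemLp g 2 volume) {m : Bd → ℝ} (hm : ContDiff ℝ ∞ m) :
    IsTrace (fun x => m x.1 • u x) (fun y => m y • g y) := by
  have hm' : ContDiff ℝ ∞ fun x : Sp => m x.1 := hm.comp contDiff_fst
  have loc : ∀ {f : Sp → ℂ}, MemLp f 2 (volume.restrict Om) →
      LocallyIntegrable (fun x => m x.1 • f x) (volume.restrict Om) := fun hf => by
    have := hf.locallyIntegrable one_le_two
    rw [← locallyIntegrableOn_univ] at this ⊢
    exact this.continuousOn_smul isOpen_univ.isLocallyClosed hm'.continuous.continuousOn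
  refine ⟨loc hu, ?_, fun x => m x.1 • w x, loc hw, ?_⟩
  · have := hg.locallyIntegrable one_le_two
    rw [← locallyIntegrableOn_univ] at this ⊢
    exact this.continuousOn_smul isOpen_univ.isLocallyClosed hm.continuous.continuousOn
  · intro φ hφ hc
    have key := h (fun x => m x.1 * φ x) (hm'.mul hφ) hc.mul_left
    have hder : ∀ x, fderiv ℝ (fun x : Sp => m x.1 * φ x) x (0, 1) =
        m x.1 * fderiv ℝ φ x (0, 1) := fun x => by
      have h1 : HasFDerivAt (fun z : Sp => m z.1)
          ((fderiv ℝ m x.1).comp (ContinuousLinearMap.fst ℝ Bd ℝ)) x :=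
        ((hm.differentiable (by simp)) x.1).hasFDerivAt.comp x hasFDerivAt_fst
      rw [(h1.fun_mul ((hφ.differentiable (by simp)) x).hasFDerivAt).fderiv]
      simp
    simp only [hder] at key
    refine (integral_congr_ae (ae_of_all _ fun x => ?_)).trans (key.trans (congrArg Neg.neg
      (integral_congr_ae (ae_of_all _ fun x => ?_))))
    · simp only [Complex.real_smul]
      push_cast
      ring
    · simp only [Complex.real_smul]
      push_cast
      ring

/-! ### The norms on the Fourier side -/

/-- `Φ` is the partial Fourier transform of `u` in the tangential variables; both are square
integrable on the half-space. -/
structure PartialFT (u Φ : Sp → ℂ) : Prop where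
  memLp : MemLp u 2 (volume.restrict Om)
  memLp_ft : MemLp Φ 2 (volume.restrict Om)
  slice : ∀ᵐ x ∂(volume.restrict (Ioi (0 : ℝ))),
    (fun ξ => Φ (ξ, x)) =ᵐ[volume] ft (fun y => u (y, x))

namespace PartialFT

variable {u v Φ Ψ : Sp → ℂ}

theorem exists_of_memLp (hu : MemLp u 2 (volume.restrict Om)) : ∃ Φ, PartialFT u Φ := by
  have hu' := hu
  rw [volume_restrict_Om] at hu'
  obtain ⟨Φ, h1, h2⟩ := exists_partialFourier hu'
  exact ⟨Φ, hu, by rwa [volume_restrict_Om], h2⟩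

theorem ae_memLp (h : PartialFT u Φ) :
    ∀ᵐ x ∂(volume.restrict (Ioi (0 : ℝ))), MemLp (fun y => u (y, x)) 2 volume := by
  have := h.memLp
  rw [volume_restrict_Om] at this
  exact MemLp.ae_slice_symm this

theorem add (h : PartialFT u Φ) (k : PartialFT v Ψ) :
    PartialFT (fun x => u x + v x) (fun x => Φ x + Ψ x) := by
  refine ⟨h.memLp.add k.memLp, h.memLp_ft.add k.memLp_ft, ?_⟩
  filter_upwards [h.slice, k.slice, h.ae_memLp, k.ae_memLp] with x h1 h2 h3 h4
  filter_upwards [h1, h2, ft_add h3 h4] with ξ e1 e2 e3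
  rw [e3, e1, e2]

theorem const_mul (a : ℂ) (h : PartialFT u Φ) :
    PartialFT (fun x => a * u x) (fun x => a * Φ x) := by
  refine ⟨h.memLp.const_mul a, h.memLp_ft.const_mul a, ?_⟩
  filter_upwards [h.slice, h.ae_memLp] with x h1 h2
  filter_upwards [h1, ft_const_mul a h2] with ξ e1 e2
  rw [e2, e1]

theorem ae_memLp_ft (h : PartialFT u Φ) :
    ∀ᵐ ξ : Bd, MemLp (fun x => Φ (ξ, x)) 2 (volume.restrict (Ioi (0 : ℝ))) := by
  have := h.memLp_ft
  rw [volume_restrict_Om] at this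
  exact MemLp.ae_slice this

theorem aemeasurable_lintegral (h : PartialFT u Φ) :
    AEMeasurable (fun ξ : Bd => ∫⁻ x in Ioi (0 : ℝ), ‖Φ (ξ, x)‖ₑ ^ 2) volume := by
  have := h.memLp_ft.1
  rw [volume_restrict_Om] at this
  exact (this.enorm.pow_const 2).lintegral_prod_right'

/-- Weighted form of Plancherel's theorem on the half-space. -/
theorem lintegral_weight (h : PartialFT u Φ) {m : Bd → ℝ≥0∞} (hm : Measurable m) :
    ∫⁻ x in Ioi (0 : ℝ), ∫⁻ ξ : Bd, m ξ * ‖ft (fun y => u (y, x)) ξ‖ₑ ^ 2 =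
      ∫⁻ ξ : Bd, m ξ * ∫⁻ x in Ioi (0 : ℝ), ‖Φ (ξ, x)‖ₑ ^ 2 := by
  have hΦ := h.memLp_ft.1
  rw [volume_restrict_Om] at hΦ
  trans ∫⁻ x in Ioi (0 : ℝ), ∫⁻ ξ : Bd, m ξ * ‖Φ (ξ, x)‖ₑ ^ 2
  · refine lintegral_congr_ae ?_
    filter_upwards [h.slice] with x hx
    refine lintegral_congr_ae ?_
    filter_upwards [hx] with ξ hξ
    rw [hξ]
  · have hmeas : AEMeasurable (fun z : Bd × ℝ => m z.1 * ‖Φ z‖ₑ ^ 2)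
        ((volume : Measure Bd).prod (volume.restrict (Ioi (0 : ℝ)))) :=
      (hm.comp measurable_fst).aemeasurable.mul (hΦ.enorm.pow_const 2)
    rw [← lintegral_prod_symm _ hmeas, lintegral_prod _ hmeas]
    refine lintegral_congr_ae ?_
    filter_upwards [hΦ.prodMk_left] with ξ hξ
    exact lintegral_const_mul'' _ (hξ.enorm.pow_const 2)

theorem lintegral_sq (h : PartialFT u Φ) :
    ∫⁻ x in Om, ‖u x‖ₑ ^ 2 = ∫⁻ ξ : Bd, ∫⁻ x in Ioi (0 : ℝ), ‖Φ (ξ, x)‖ₑ ^ 2 := by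
  have hu := h.memLp
  rw [volume_restrict_Om] at hu
  have := h.lintegral_weight (m := fun _ => 1) measurable_const
  simp only [one_mul] at this
  rw [← this, volume_restrict_Om, lintegral_slice_symm hu]
  refine lintegral_congr_ae ?_
  filter_upwards [h.ae_memLp] with x hx
  exact (lintegral_ft_sq hx).symm

theorem tangential {e : Bd} (h : PartialFT u Φ) (k : PartialFT v Ψ)
    (hd : IsWeakDeriv Om (e, 0) u v) :
    ∀ᵐ ξ : Bd, ∀ᵐ x ∂(volume.restrict (Ioi (0 : ℝ))),
      Ψ (ξ, x) = 2 * Real.pi * Complex.I * inner ℝ ξ e * Φ (ξ, x) :=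
  partialFourier_tangential hd h.memLp k.memLp h.memLp_ft k.memLp_ft h.slice k.slice

theorem normal {g : Bd → ℂ} (h : PartialFT u Φ) (k : PartialFT v Ψ) (hg : MemLp g 2 volume)
    (hd : Green u v g) :
    ∀ᵐ ξ : Bd, IsPrimitive (fun x => Φ (ξ, x)) (fun x => Ψ (ξ, x)) (ft g ξ) :=
  partialFourier_normal h.memLp k.memLp hg hd h.memLp_ft k.memLp_ft h.slice k.slice

end PartialFT

/-- The weight of the norm of `H¹_γ(ℝ²)`. -/
def weight (γ : ℝ) (ξ : Bd) : ℝ := γ ^ 2 + ‖(2 * Real.pi) • ξ‖ ^ 2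

theorem measurable_weight (γ : ℝ) : Measurable fun ξ => ENNReal.ofReal (weight γ ξ) := by
  unfold weight
  fun_prop

theorem sobSq_one_eq {γ : ℝ} {u : Bd → ℂ} (hu : MemLp u 2 volume) :
    sobSq 1 γ u = ∫⁻ ξ : Bd, ENNReal.ofReal (weight γ ξ) * ‖ft u ξ‖ₑ ^ 2 := by
  rw [sobSq, dif_pos hu, ft_of_memLp hu]
  simp only [Real.rpow_one, weight]

theorem sobSq_congr_ae {s γ : ℝ} {u v : Bd → ℂ} (h : u =ᵐ[volume] v) :
    sobSq s γ u = sobSq s γ v := by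
  by_cases hu : MemLp u 2 volume
  · have hv := (memLp_congr_ae h).1 hu
    rw [sobSq, sobSq, dif_pos hu, dif_pos hv, (MemLp.toLp_eq_toLp_iff hu hv).2 h]
  · have hv : ¬ MemLp v 2 volume := fun hv => hu ((memLp_congr_ae h).2 hv)
    rw [sobSq, sobSq, dif_neg hu, dif_neg hv]

theorem hBdSq_one_eq {γ : ℝ} {u v : Bd → ℂ} (h : wtBd γ u =ᵐ[volume] v) (hv : MemLp v 2 volume) :
    hBdSq 1 γ u = ∫⁻ ξ : Bd, ENNReal.ofReal (weight γ ξ) * ‖ft v ξ‖ₑ ^ 2 := by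
  rw [hBdSq, sobSq_congr_ae h, sobSq_one_eq hv]

theorem l2BdSq_eq {γ : ℝ} {u v : Bd → ℂ} (h : wtBd γ u =ᵐ[volume] v) (hv : MemLp v 2 volume) :
    l2BdSq γ u = ∫⁻ ξ : Bd, ‖ft v ξ‖ₑ ^ 2 := by
  rw [l2BdSq, lintegral_ft_sq hv]
  refine lintegral_congr_ae ?_
  filter_upwards [h] with y hy
  rw [hy]

theorem l2hSq_one_eq {γ : ℝ} {u v Φ : Sp → ℂ} (h : wtSp γ u =ᵐ[volume.restrict Om] v)
    (hv : PartialFT v Φ) :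
    l2hSq 1 γ u =
      ∫⁻ ξ : Bd, ENNReal.ofReal (weight γ ξ) * ∫⁻ x in Ioi (0 : ℝ), ‖Φ (ξ, x)‖ₑ ^ 2 := by
  rw [← hv.lintegral_weight (measurable_weight γ), l2hSq]
  refine lintegral_congr_ae ?_
  rw [volume_restrict_Om] at h
  filter_upwards [ae_ae_of_ae_prod_symm h, hv.ae_memLp] with x h1 h2
  exact hBdSq_one_eq h1 h2

/-! ### The linearized operators on the Fourier side -/

theorem PartialFT.congr {u v Φ : Sp → ℂ} (h : PartialFT u Φ) (huv : u =ᵐ[volume.restrict Om] v) :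
    PartialFT v Φ := by
  refine ⟨(memLp_congr_ae huv).1 h.memLp, h.memLp_ft, ?_⟩
  rw [volume_restrict_Om] at huv
  filter_upwards [h.slice, ae_ae_of_ae_prod_symm huv] with x h1 h2
  rwa [← ft_congr_ae h2]

/-- The Laplace–Fourier variable dual to time. The Fourier transform is normalized with
the character `exp (-2πi y·ξ)`, whence the factors `2π`. -/
def tau (γ : ℝ) (ξ : Bd) : ℂ := γ + 2 * Real.pi * ξ 0 * Complex.I

/-- The Fourier variable dual to `x₁`. -/
def eta (ξ : Bd) : ℝ := 2 * Real.pi * ξ 1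

theorem tau_re (γ : ℝ) (ξ : Bd) : (tau γ ξ).re = γ := by simp [tau]

theorem weight_eq (γ : ℝ) (ξ : Bd) : weight γ ξ = ‖tau γ ξ‖ ^ 2 + eta ξ ^ 2 := by
  have h1 : ‖tau γ ξ‖ ^ 2 = γ ^ 2 + (2 * Real.pi * ξ 0) ^ 2 := by
    rw [Complex.sq_norm, Complex.normSq_apply]
    simp [tau]
    ring
  rw [h1, weight, norm_smul, mul_pow, EuclideanSpace.norm_sq_eq, eta]
  simp [mul_pow]
  ring

theorem inner_et (ξ : Bd) : inner ℝ ξ et = ξ 0 := by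
  simp [et, EuclideanSpace.inner_single_right]

theorem inner_e1 (ξ : Bd) : inner ℝ ξ e1 = ξ 1 := by
  simp [e1, EuclideanSpace.inner_single_right]

/-- The exponent of the weight as a linear form on the boundary. -/
def timeBd (γ : ℝ) : Bd →L[ℝ] ℝ := γ • EuclideanSpace.proj (0 : Fin 2)

theorem timeBd_apply (γ : ℝ) (y : Bd) : timeBd γ y = γ * y 0 := rfl

theorem wtBd_eq (γ : ℝ) (u : Bd → ℂ) : wtBd γ u = fun y => Real.exp (-timeBd γ y) • u y := by
  funext y
  rw [timeBd_apply, wtBd, neg_mul]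

theorem wtSp_eq (γ : ℝ) (u : Sp → ℂ) : wtSp γ u = fun x =>
    Real.exp (-((timeBd γ).comp (ContinuousLinearMap.fst ℝ Bd ℝ)) x) • u x := by
  funext x
  rw [ContinuousLinearMap.comp_apply, ContinuousLinearMap.coe_fst', timeBd_apply, wtSp, neg_mul]

theorem wtSp_weakDeriv {γ : ℝ} {v w : Sp → ℂ} {e : Sp} (h : IsWeakDeriv Om e (wtSp γ v) w) :
    (fun x => w x + ((γ * e.1 0 : ℝ) : ℂ) * wtSp γ v x) =ᵐ[volume.restrict Om]
      wtSp γ (weakDeriv Om e v) := by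
  rw [wtSp_eq] at h
  filter_upwards [weakDeriv_of_weight isOpen_Om _ h] with x hx
  rw [wtSp_eq, wtSp_eq]
  exact hx.symm

theorem wtBd_weakDeriv {γ : ℝ} {v w : Bd → ℂ} {e : Bd} (h : IsWeakDeriv univ e (wtBd γ v) w) :
    wtBd γ (weakDeriv univ e v) =ᵐ[volume] fun y => w y + ((γ * e 0 : ℝ) : ℂ) * wtBd γ v y := by
  rw [wtBd_eq] at h
  have := weakDeriv_of_weight isOpen_univ _ h
  rw [Measure.restrict_univ] at this
  filter_upwards [this] with x hx
  rw [wtBd_eq, wtBd_eq]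
  exact hx

/-- The weighted trace of a function in `H²_γ(Ω)` is in `L²`, and given by Green's formula for the
weighted function. -/
theorem Green.wtBd_trace {γ : ℝ} {v w : Sp → ℂ} {g : Bd → ℂ} (h : Green (wtSp γ v) w g)
    (hu : MemLp (wtSp γ v) 2 (volume.restrict Om)) (hw : MemLp w 2 (volume.restrict Om))
    (hg : MemLp g 2 volume) : wtBd γ (trace v) =ᵐ[volume] g := by
  have hm : ContDiff ℝ ∞ fun y : Bd => Real.exp (timeBd γ y) := (timeBd γ).contDiff.exp
  have hcancel : ∀ y : Bd, Real.exp (timeBd γ y) * Real.exp (-timeBd γ y) = 1 := fun y => by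
    rw [← Real.exp_add, add_neg_cancel, Real.exp_zero]
  have h1 := h.isTrace_smul hu hw hg hm
  have h2 : (fun x : Sp => Real.exp (timeBd γ x.1) • wtSp γ v x) = v := by
    funext x
    rw [wtSp_eq]
    change Real.exp (timeBd γ x.1) • Real.exp (-timeBd γ x.1) • v x = v x
    rw [smul_smul, hcancel, one_smul]
  rw [h2] at h1
  filter_upwards [h1.trace_ae_eq] with y hy
  rw [wtBd_eq]
  simp only
  rw [hy, smul_smul, mul_comm, hcancel, one_smul]

/-- Partial Fourier transforms of a function in `H²_γ(Ω)` and of its derivatives. -/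
theorem exists_partialFT_of_memHOm {γ : ℝ} {v : Sp → ℂ} (h : MemHOm γ 2 v) :
    ∃ (Φ Φt Φ1 Φ2 : Sp → ℂ) (g : Bd → ℂ), PartialFT (wtSp γ v) Φ ∧
      PartialFT (wtSp γ (weakDeriv Om (et, 0) v)) Φt ∧
      PartialFT (wtSp γ (weakDeriv Om (e1, 0) v)) Φ1 ∧
      PartialFT (wtSp γ (weakDeriv Om (0, 1) v)) Φ2 ∧
      MemLp g 2 volume ∧ wtBd γ (trace v) =ᵐ[volume] g ∧
      (∀ᵐ ξ : Bd, ∀ᵐ x ∂(volume.restrict (Ioi (0 : ℝ))), Φt (ξ, x) = tau γ ξ * Φ (ξ, x)) ∧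
      (∀ᵐ ξ : Bd, ∀ᵐ x ∂(volume.restrict (Ioi (0 : ℝ))),
        Φ1 (ξ, x) = Complex.I * eta ξ * Φ (ξ, x)) ∧
      ∀ᵐ ξ : Bd, IsPrimitive (fun x => Φ (ξ, x)) (fun x => Φ2 (ξ, x)) (ft g ξ) := by
  obtain ⟨hU, hd⟩ := h
  obtain ⟨T, hT, hT2⟩ := hd (et, 0)
  obtain ⟨X, hX, hX2⟩ := hd (e1, 0)
  obtain ⟨P, hP, hP2⟩ := hd (0, 1)
  obtain ⟨g, hg, hG⟩ := hP.exists_green hU hP2.1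
  obtain ⟨Φ, hΦ⟩ := PartialFT.exists_of_memLp hU
  obtain ⟨Ψt, hΨt⟩ := PartialFT.exists_of_memLp hT2.1
  obtain ⟨Ψ1, hΨ1⟩ := PartialFT.exists_of_memLp hX2.1
  obtain ⟨Ψ2, hΨ2⟩ := PartialFT.exists_of_memLp hP2.1
  have e0 : (et : Bd) 0 = 1 := by simp [et]
  have e0' : (e1 : Bd) 0 = 0 := by simp [e1]
  have k1 : ∀ x, X x = X x + ((γ * (e1 : Bd) 0 : ℝ) : ℂ) * wtSp γ v x := fun x => by
    rw [e0']; simp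
  have k2 : ∀ x, P x = P x + ((γ * (0 : Bd) 0 : ℝ) : ℂ) * wtSp γ v x := fun x => by
    simp
  refine ⟨Φ, fun x => Ψt x + γ * Φ x, Ψ1, Ψ2, g, hΦ, (hΨt.add (hΦ.const_mul γ)).congr ?_,
    hΨ1.congr ?_, hΨ2.congr ?_, hg, hG.wtBd_trace hU hP2.1 hg, ?_, ?_, hΦ.normal hΨ2 hg hG⟩
  · filter_upwards [wtSp_weakDeriv hT] with x hx
    rw [← hx, e0, mul_one]
  · filter_upwards [wtSp_weakDeriv hX] with x hx
    rw [← hx, ← k1]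
  · filter_upwards [wtSp_weakDeriv hP] with x hx
    rw [← hx, ← k2]
  · filter_upwards [hΦ.tangential hΨt hT] with ξ h1
    filter_upwards [h1] with x hx
    rw [hx, inner_et, tau]
    ring
  · filter_upwards [hΦ.tangential hΨ1 hX] with ξ h1
    filter_upwards [h1] with x hx
    rw [hx, inner_e1, eta]
    push_cast
    ring

namespace Sheet

variable {S : Sheet}

/-- The first row of the interior operator, with the coefficients of the background
state `σ` evaluated. -/
theorem Physical.linL_zero (hS : S.Physical) {σ : ℝ} (hσ : σ = 1 ∨ σ = -1) (V : Sp → Fin 3 → ℂ)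
    (x : Sp) : S.linL σ V x 0 =
      (S.Gbar * (1 - S.ε ^ 4 * S.cbar ^ 2 * (σ * S.vbar) ^ 2) : ℝ) * (grad (et, 0) V x 0 +
          (σ * S.vbar : ℝ) * grad (e1, 0) V x 0) +
        ((S.cbar ^ 2 * (2 * S.ε ^ 2 * (σ * S.vbar)) : ℝ) * grad (et, 0) V x 1 +
          (S.cbar ^ 2 * (1 + S.ε ^ 2 * (σ * S.vbar) ^ 2) : ℝ) * grad (e1, 0) V x 1) +
        (σ * S.cbar ^ 2 : ℝ) * grad (0, 1) V x 2 := by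
  simp only [linL, A0, A1, A2, hS.Gam_Ubar hσ, hS.v1_Ubar hσ, v2_Ubar, hS.rho_Ubar, N_rhobar,
    cbar, matA0, matA1, matA2, Pi.add_apply, Matrix.mulVec, dotProduct, Fin.sum_univ_three,
    Matrix.map_apply, Matrix.smul_apply, Matrix.of_apply, Matrix.cons_val]
  push_cast
  simp
  ring

theorem Physical.linL_one (hS : S.Physical) {σ : ℝ} (hσ : σ = 1 ∨ σ = -1) (V : Sp → Fin 3 → ℂ)
    (x : Sp) : S.linL σ V x 1 =
      (1 - S.ε ^ 2 * (σ * S.vbar) ^ 2 : ℝ) * (grad (e1, 0) V x 0 + (S.Gbar : ℂ) *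
        (grad (et, 0) V x 1 + (σ * S.vbar : ℝ) * grad (e1, 0) V x 1)) := by
  simp only [linL, A0, A1, A2, hS.Gam_Ubar hσ, hS.v1_Ubar hσ, v2_Ubar, hS.rho_Ubar, N_rhobar,
    matA0, matA1, matA2, Pi.add_apply, Matrix.mulVec, dotProduct, Fin.sum_univ_three,
    Matrix.map_apply, Matrix.smul_apply, Matrix.of_apply, Matrix.cons_val]
  push_cast
  simp
  ring

theorem Physical.linL_two (hS : S.Physical) {σ : ℝ} (hσ : σ = 1 ∨ σ = -1) (V : Sp → Fin 3 → ℂ)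
    (x : Sp) : S.linL σ V x 2 =
      (S.Gbar : ℂ) * (grad (et, 0) V x 2 + (σ * S.vbar : ℝ) * grad (e1, 0) V x 2) +
        (σ : ℂ) * grad (0, 1) V x 0 := by
  simp only [linL, A0, A1, A2, hS.Gam_Ubar hσ, hS.v1_Ubar hσ, v2_Ubar, hS.rho_Ubar, N_rhobar,
    matA0, matA1, matA2, Pi.add_apply, Matrix.mulVec, dotProduct, Fin.sum_univ_three,
    Matrix.map_apply, Matrix.smul_apply, Matrix.of_apply, Matrix.cons_val]
  push_cast
  simp
  ring

end Sheet

namespace Sheet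

variable {S : Sheet}

/-- After Fourier transformation, each side of the vortex sheet solves the system of ordinary
differential equations of a single mode, for almost every frequency. -/
theorem Physical.exists_modes (hS : S.Physical) {σ : ℝ} (hσ : σ = 1 ∨ σ = -1) {γ : ℝ}
    {V : Sp → Fin 3 → ℂ} (hV : ∀ i, MemHOm γ 2 (fun x => V x i)) :
    ∃ (Φ Ψ : Fin 3 → Sp → ℂ) (P Q : Sp → ℂ) (g : Fin 3 → Bd → ℂ),
      (∀ i, PartialFT (wtSp γ fun x => V x i) (Φ i)) ∧
      (∀ i, PartialFT (wtSp γ fun x => S.linL σ V x i) (Ψ i)) ∧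
      (∀ i, MemLp (g i) 2 volume) ∧ (∀ i, wtBd γ (trace fun x => V x i) =ᵐ[volume] g i) ∧
      ∀ᵐ ξ : Bd, ModeSystem S.ε S.cbar S.Gbar (σ * S.vbar) σ (tau γ ξ) (eta ξ)
        (fun x => Φ 0 (ξ, x)) (fun x => Φ 1 (ξ, x)) (fun x => Φ 2 (ξ, x))
        (fun x => P (ξ, x)) (fun x => Q (ξ, x))
        (fun x => Ψ 0 (ξ, x)) (fun x => Ψ 1 (ξ, x)) (fun x => Ψ 2 (ξ, x))
        (ft (g 0) ξ) (ft (g 2) ξ) := by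
  choose Φ Φt Φ1 Φ2 g hΦ ht h1 h2 hg htr et' e1' hprim using
    fun i => exists_partialFT_of_memHOm (hV i)
  have r0 := (((ht 0).add ((h1 0).const_mul (σ * S.vbar : ℝ))).const_mul
      (S.Gbar * (1 - S.ε ^ 4 * S.cbar ^ 2 * (σ * S.vbar) ^ 2) : ℝ)).add
    (((ht 1).const_mul (S.cbar ^ 2 * (2 * S.ε ^ 2 * (σ * S.vbar)) : ℝ)).add
      ((h1 1).const_mul (S.cbar ^ 2 * (1 + S.ε ^ 2 * (σ * S.vbar) ^ 2) : ℝ))) |>.add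
    ((h2 2).const_mul (σ * S.cbar ^ 2 : ℝ))
  have r1 := ((h1 0).add (((ht 1).add ((h1 1).const_mul (σ * S.vbar : ℝ))).const_mul
    (S.Gbar : ℂ))).const_mul (1 - S.ε ^ 2 * (σ * S.vbar) ^ 2 : ℝ)
  have r2 := (((ht 2).add ((h1 2).const_mul (σ * S.vbar : ℝ))).const_mul (S.Gbar : ℂ)).add
    ((h2 0).const_mul (σ : ℂ))
  have q0 := r0.congr (v := wtSp γ fun x => S.linL σ V x 0) (ae_of_all _ fun x => by
    simp only [wtSp, hS.linL_zero hσ, grad, Complex.real_smul]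
    ring)
  have q1 := r1.congr (v := wtSp γ fun x => S.linL σ V x 1) (ae_of_all _ fun x => by
    simp only [wtSp, hS.linL_one hσ, grad, Complex.real_smul]
    ring)
  have q2 := r2.congr (v := wtSp γ fun x => S.linL σ V x 2) (ae_of_all _ fun x => by
    simp only [wtSp, hS.linL_two hσ, grad, Complex.real_smul]
    ring)
  refine ⟨Φ, ![fun x => (S.Gbar * (1 - S.ε ^ 4 * S.cbar ^ 2 * (σ * S.vbar) ^ 2) : ℝ) *
        (Φt 0 x + (σ * S.vbar : ℝ) * Φ1 0 x) +
      ((S.cbar ^ 2 * (2 * S.ε ^ 2 * (σ * S.vbar)) : ℝ) * Φt 1 x +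
        (S.cbar ^ 2 * (1 + S.ε ^ 2 * (σ * S.vbar) ^ 2) : ℝ) * Φ1 1 x) +
      (σ * S.cbar ^ 2 : ℝ) * Φ2 2 x,
    fun x => (1 - S.ε ^ 2 * (σ * S.vbar) ^ 2 : ℝ) *
      (Φ1 0 x + S.Gbar * (Φt 1 x + (σ * S.vbar : ℝ) * Φ1 1 x)),
    fun x => S.Gbar * (Φt 2 x + (σ * S.vbar : ℝ) * Φ1 2 x) + σ * Φ2 0 x],
    Φ2 0, Φ2 2, g, hΦ, fun i => ?_, hg, htr, ?_⟩
  · fin_cases i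
    exacts [q0, q1, q2]
  · filter_upwards [ae_all_iff.2 fun i => (hΦ i).ae_memLp_ft, (h2 0).ae_memLp_ft, (h2 2).ae_memLp_ft,
      q0.ae_memLp_ft, q1.ae_memLp_ft, q2.ae_memLp_ft, ae_all_iff.2 et', ae_all_iff.2 e1',
      ae_all_iff.2 hprim] with ξ m1 m2 m3 m4 m5 m6 a1 a2 a3
    refine ⟨m1 0, m1 1, m1 2, m2, m3, m4, m5, m6, a3 0, a3 2, ?_, ?_, ?_⟩
    · filter_upwards [a1 0, a2 0, a1 1, a2 1] with x b1 b2 b3 b4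
      simp only [Matrix.cons_val]
      rw [b1, b2, b3, b4]
      push_cast
      ring
    · filter_upwards [a2 0, a1 1, a2 1] with x b1 b2 b3
      simp only [Matrix.cons_val]
      rw [b1, b2, b3]
      push_cast
      ring
    · filter_upwards [a1 2, a2 2] with x b1 b2
      simp only [Matrix.cons_val]
      rw [b1, b2]
      push_cast
      ring

theorem Physical.cbar_pos (hS : S.Physical) : 0 < S.cbar :=
  Real.sqrt_pos.2 (hS.dp_pos _ hS.rho_mem)

theorem Physical.eps_cbar_lt (hS : S.Physical) : S.ε ^ 2 * S.cbar ^ 2 < 1 := by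
  have h1 : S.cbar ^ 2 = deriv S.p S.ρbar := Real.sq_sqrt (hS.dp_pos _ hS.rho_mem).le
  have h2 := hS.dp_lt _ hS.rho_mem
  have h3 : 0 < S.ε ^ 2 := pow_pos hS.eps_pos 2
  rw [h1]
  calc S.ε ^ 2 * deriv S.p S.ρbar < S.ε ^ 2 * (S.ε ^ 2)⁻¹ := by gcongr
    _ = 1 := mul_inv_cancel₀ h3.ne'

theorem Physical.Gbar_sq_mul (hS : S.Physical) : S.Gbar ^ 2 * (1 - S.ε ^ 2 * S.vbar ^ 2) = 1 := by
  linear_combination -hS.Gbar_sq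

/-- The supersonic condition in the form in which it enters the Lopatinskii determinant. -/
theorem Physical.two_lt_of_machCrit_lt (hS : S.Physical) (hM : S.machCrit < S.mach) :
    2 < S.Gbar ^ 2 * (1 / S.cbar ^ 2 - S.ε ^ 2) * S.vbar ^ 2 := by
  have hc := hS.cbar_pos
  have hr := hS.rad_pos
  have hd : 0 < 1 + S.ε ^ 2 * S.cbar ^ 2 := by positivity
  have h1 : 2 / (1 + S.ε ^ 2 * S.cbar ^ 2) < S.vbar ^ 2 / S.cbar ^ 2 := by
    have h2 : S.machCrit ^ 2 < S.mach ^ 2 := by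
      have : 0 ≤ S.machCrit := by unfold machCrit; positivity
      gcongr
    rwa [machCrit, mach, div_pow, div_pow, Real.sq_sqrt zero_le_two, Real.sq_sqrt hd.le, sq_abs]
      at h2
  rw [div_lt_div_iff₀ hd (by positivity)] at h1
  have hG : S.Gbar ^ 2 = 1 / (1 - S.ε ^ 2 * S.vbar ^ 2) := by
    rw [eq_div_iff hr.ne', hS.Gbar_sq_mul]
  have h3 : S.Gbar ^ 2 * (1 / S.cbar ^ 2 - S.ε ^ 2) * S.vbar ^ 2 =
      (S.vbar ^ 2 - S.ε ^ 2 * S.cbar ^ 2 * S.vbar ^ 2) /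
        (S.cbar ^ 2 * (1 - S.ε ^ 2 * S.vbar ^ 2)) := by
    rw [hG]
    field_simp
  rw [h3, lt_div_iff₀ (by positivity)]
  nlinarith

theorem linB_zero (S : Sheet) (W : Bd → Fin 4 → ℂ) (ψ : Bd → ℂ) (y : Bd) :
    S.linB W ψ y 0 = (2 * S.vbar : ℂ) * weakDeriv univ e1 ψ y +
      (-((S.hbar * S.Gbar : ℝ) : ℂ)⁻¹ * W y 1 + ((S.hbar * S.Gbar : ℝ) : ℂ)⁻¹ * W y 3) := by
  simp [linB, bMat, BMat, Matrix.mulVec, dotProduct, Fin.sum_univ_succ]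

theorem linB_one (S : Sheet) (W : Bd → Fin 4 → ℂ) (ψ : Bd → ℂ) (y : Bd) :
    S.linB W ψ y 1 = (weakDeriv univ et ψ y + (S.vbar : ℂ) * weakDeriv univ e1 ψ y) +
      -((S.hbar * S.Gbar : ℝ) : ℂ)⁻¹ * W y 1 := by
  simp [linB, bMat, BMat, Matrix.mulVec, dotProduct, Fin.sum_univ_succ]

theorem linB_two (S : Sheet) (W : Bd → Fin 4 → ℂ) (ψ : Bd → ℂ) (y : Bd) :
    S.linB W ψ y 2 = W y 0 + (-1) * W y 2 := by
  simp [linB, bMat, BMat, Matrix.mulVec, dotProduct, Fin.sum_univ_succ]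

end Sheet

theorem lintegral_enorm_sq_eq_ofReal {α : Type*} [MeasurableSpace α] {μ : Measure α} {f : α → ℂ}
    (hf : MemLp f 2 μ) : ∫⁻ x, ‖f x‖ₑ ^ 2 ∂μ = ENNReal.ofReal (∫ x, ‖f x‖ ^ 2 ∂μ) := by
  rw [ofReal_integral_eq_lintegral_ofReal (hf.integrable_norm_pow two_ne_zero)
    (ae_of_all _ fun x => by positivity)]
  simp only [ENNReal.ofReal_pow (norm_nonneg _), ofReal_norm]

theorem enorm_sq_eq_ofReal (z : ℂ) : ‖z‖ₑ ^ 2 = ENNReal.ofReal (‖z‖ ^ 2) := by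
  rw [ENNReal.ofReal_pow (norm_nonneg _), ofReal_norm]

/-- An inequality between nonnegative reals of the shape of the estimate at one frequency, in
`ℝ≥0∞`. -/
theorem ofReal_bound {γ A B w D C g₃ E g₂ F : ℝ} (hγ : 0 ≤ γ) (hA : 0 ≤ A) (hB : 0 ≤ B) (hw : 0 ≤ w)
    (hD : 0 ≤ D) (hC : 0 ≤ C) (h₃ : 0 ≤ g₃) (hE : 0 ≤ E) (h₂ : 0 ≤ g₂) (hF : 0 ≤ F)
    (h : γ * A + B + w * D ≤ C * (g₃ * (w * E) + g₂ * (w * F))) :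
    ENNReal.ofReal γ * ENNReal.ofReal A + ENNReal.ofReal B + ENNReal.ofReal w * ENNReal.ofReal D ≤
      ENNReal.ofReal C * (ENNReal.ofReal g₃ * (ENNReal.ofReal w * ENNReal.ofReal E) +
        ENNReal.ofReal g₂ * (ENNReal.ofReal w * ENNReal.ofReal F)) := by
  rw [← ENNReal.ofReal_mul hγ, ← ENNReal.ofReal_mul hw, ← ENNReal.ofReal_mul hw,
    ← ENNReal.ofReal_mul hw, ← ENNReal.ofReal_mul h₃, ← ENNReal.ofReal_mul h₂,
    ← ENNReal.ofReal_add (by positivity) (by positivity),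
    ← ENNReal.ofReal_add (by positivity) (by positivity),
    ← ENNReal.ofReal_add (by positivity) (by positivity), ← ENNReal.ofReal_mul hC]
  exact ENNReal.ofReal_le_ofReal h

/-- The Fourier transform of a weighted front and of its weighted derivatives. -/
theorem exists_ft_of_memHBd {γ : ℝ} {ψ : Bd → ℂ} (h : MemHBd γ 2 ψ) :
    ∃ T X : Bd → ℂ, MemLp T 2 volume ∧ MemLp X 2 volume ∧
      wtBd γ (weakDeriv univ et ψ) =ᵐ[volume] T ∧ wtBd γ (weakDeriv univ e1 ψ) =ᵐ[volume] X ∧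
      (∀ᵐ ξ : Bd, ft T ξ = tau γ ξ * ft (wtBd γ ψ) ξ) ∧
      ∀ᵐ ξ : Bd, ft X ξ = Complex.I * eta ξ * ft (wtBd γ ψ) ξ := by
  obtain ⟨hU, hd⟩ := h
  obtain ⟨T, hT, hT2⟩ := hd et
  obtain ⟨X, hX, hX2⟩ := hd e1
  rw [Measure.restrict_univ] at hU
  have hT3 := hT2.1
  have hX3 := hX2.1
  rw [Measure.restrict_univ] at hT3 hX3
  have e0 : (et : Bd) 0 = 1 := by simp [et]
  have e0' : (e1 : Bd) 0 = 0 := by simp [e1]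
  refine ⟨fun y => T y + γ * wtBd γ ψ y, X, hT3.add (hU.const_mul _), hX3, ?_, ?_, ?_, ?_⟩
  · filter_upwards [wtBd_weakDeriv hT] with y hy
    rw [hy, e0, mul_one]
  · filter_upwards [wtBd_weakDeriv hX] with y hy
    rw [hy, e0']
    simp
  · filter_upwards [ft_add hT3 (hU.const_mul (γ : ℂ)), ft_const_mul (γ : ℂ) hU,
      ft_weakDeriv hT hU hT3] with ξ h1 h2 h3
    rw [h1, h2, h3, inner_et, tau]
    ring
  · filter_upwards [ft_weakDeriv hX hU hX3] with ξ h1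
    rw [h1, inner_e1, eta]
    push_cast
    ring

theorem integral_sq_add_sq_add_sq {α : Type*} [MeasurableSpace α] {μ : Measure α} {a b c : α → ℂ}
    (ha : MemLp a 2 μ) (hb : MemLp b 2 μ) (hc : MemLp c 2 μ) :
    ∫ x, (‖a x‖ ^ 2 + ‖b x‖ ^ 2 + ‖c x‖ ^ 2) ∂μ =
      (∫ x, ‖a x‖ ^ 2 ∂μ) + (∫ x, ‖b x‖ ^ 2 ∂μ) + ∫ x, ‖c x‖ ^ 2 ∂μ := by
  have ia : Integrable (fun x => ‖a x‖ ^ 2) μ := ha.integrable_norm_pow two_ne_zero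
  have ib : Integrable (fun x => ‖b x‖ ^ 2) μ := hb.integrable_norm_pow two_ne_zero
  have ic : Integrable (fun x => ‖c x‖ ^ 2) μ := hc.integrable_norm_pow two_ne_zero
  have iab : Integrable (fun x => ‖a x‖ ^ 2 + ‖b x‖ ^ 2) μ := ia.add ib
  rw [integral_add iab ic, integral_add ia ib]

/-- The boundary operator after Fourier transformation, in terms of `L²` representatives `g i` of the
weighted traces. -/
theorem Sheet.exists_ft_linB (S : Sheet) {γ : ℝ} {ψ : Bd → ℂ} (hψ : MemHBd γ 2 ψ)
    {W : Bd → Fin 4 → ℂ} {g : Fin 4 → Bd → ℂ} (hg : ∀ i, MemLp (g i) 2 volume)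
    (hW : ∀ i, wtBd γ (fun y => W y i) =ᵐ[volume] g i) :
    ∃ B : Fin 3 → Bd → ℂ, (∀ i, MemLp (B i) 2 volume) ∧
      (∀ i, wtBd γ (fun y => S.linB W ψ y i) =ᵐ[volume] B i) ∧
      ∀ᵐ ξ : Bd,
        2 * S.vbar * (Complex.I * eta ξ * ft (wtBd γ ψ) ξ) -
            ((S.hbar * S.Gbar : ℝ) : ℂ)⁻¹ * (ft (g 1) ξ - ft (g 3) ξ) = ft (B 0) ξ ∧
        tau γ ξ * ft (wtBd γ ψ) ξ + S.vbar * (Complex.I * eta ξ * ft (wtBd γ ψ) ξ) -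
            ((S.hbar * S.Gbar : ℝ) : ℂ)⁻¹ * ft (g 1) ξ = ft (B 1) ξ ∧
        ft (g 0) ξ - ft (g 2) ξ = ft (B 2) ξ := by
  obtain ⟨T, X, hT, hX, hT', hX', hTf, hXf⟩ := exists_ft_of_memHBd hψ
  set k : ℂ := ((S.hbar * S.Gbar : ℝ) : ℂ)⁻¹ with hk
  have hsum : MemLp (fun y => (-k) * g 1 y + k * g 3 y) 2 volume :=
    ((hg 1).const_mul (-k)).add ((hg 3).const_mul k)
  have hTX : MemLp (fun y => T y + (S.vbar : ℂ) * X y) 2 volume :=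
    hT.add (hX.const_mul (S.vbar : ℂ))
  have m0 := (hX.const_mul (2 * S.vbar : ℂ)).add hsum
  have m1 := hTX.add ((hg 1).const_mul (-k))
  have m2 := (hg 0).add ((hg 2).const_mul (-1))
  refine ⟨![fun y => (2 * S.vbar : ℂ) * X y + ((-k) * g 1 y + k * g 3 y),
    fun y => (T y + (S.vbar : ℂ) * X y) + (-k) * g 1 y, fun y => g 0 y + (-1) * g 2 y], ?_, ?_, ?_⟩
  · intro i
    fin_cases i
    exacts [m0, m1, m2]
  · intro i
    fin_cases i
    · filter_upwards [hX', hW 1, hW 3] with y h1 h2 h3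
      simp only [Fin.zero_eta, Matrix.cons_val, wtBd, S.linB_zero] at h1 h2 h3 ⊢
      rw [← h1, ← h2, ← h3, hk]
      simp only [Complex.real_smul]
      ring
    · filter_upwards [hT', hX', hW 1] with y h1 h2 h3
      simp only [Fin.mk_one, Matrix.cons_val, wtBd, S.linB_one] at h1 h2 h3 ⊢
      rw [← h1, ← h2, ← h3, hk]
      simp only [Complex.real_smul]
      ring
    · filter_upwards [hW 0, hW 2] with y h1 h2
      simp only [Fin.reduceFinMk, Matrix.cons_val, wtBd, S.linB_two] at h1 h2 ⊢
      rw [← h1, ← h2]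
      simp only [Complex.real_smul]
      ring
  · filter_upwards [hTf, hXf, ft_add (hX.const_mul (2 * S.vbar : ℂ)) hsum,
      ft_add ((hg 1).const_mul (-k)) ((hg 3).const_mul k),
      ft_add hTX ((hg 1).const_mul (-k)),
      ft_add hT (hX.const_mul (S.vbar : ℂ)), ft_add (hg 0) ((hg 2).const_mul (-1)),
      ft_const_mul (2 * S.vbar : ℂ) hX, ft_const_mul (-k) (hg 1), ft_const_mul k (hg 3),
      ft_const_mul (S.vbar : ℂ) hX, ft_const_mul (-1) (hg 2)]
      with ξ a1 a2 a3 a4 a5 a6 a7 a8 a9 a10 a11 a12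
    refine ⟨?_, ?_, ?_⟩
    · simp only [Matrix.cons_val]
      rw [a3, a4, a8, a9, a10, a2]
      ring
    · simp only [Matrix.cons_val]
      rw [a5, a6, a9, a11, a1, a2]
      ring
    · simp only [Matrix.cons_val]
      rw [a7, a12]
      ring

end VortexSheet

end

open VortexSheet in
theorem theorem3p1 (S : Sheet) (hS : S.Physical) (hM : S.machCrit < S.mach) :
    ∃ C : ℝ≥0, ∀ γ : ℝ, 1 ≤ γ →
      ∀ (Vp Vm : Sp → Fin 3 → ℂ) (ψ : Bd → ℂ),
        (∀ i, MemHOm γ 2 (fun x => Vp x i)) → (∀ i, MemHOm γ 2 (fun x => Vm x i)) →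
        MemHBd γ 2 ψ →
        ENNReal.ofReal γ *
              (∑ i, l2OmSq γ (fun x => Vp x i) + ∑ i, l2OmSq γ (fun x => Vm x i)) +
            ∑ i, l2BdSq γ (fun y => trNc Vp Vm y i) + hBdSq 1 γ ψ ≤
          C * (ENNReal.ofReal (γ ^ (-3 : ℤ)) *
                (∑ i, l2hSq 1 γ (fun x => S.linL 1 Vp x i) +
                  ∑ i, l2hSq 1 γ (fun x => S.linL (-1) Vm x i)) +
              ENNReal.ofReal (γ ^ (-2 : ℤ)) *
                ∑ i, hBdSq 1 γ (fun y => S.linB (trNc Vp Vm) ψ y i)) := by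
  obtain ⟨C, hC, hbound⟩ := exists_frequency_bound (ε := S.ε) (H := S.hbar * S.Gbar) hS.cbar_pos
    hS.vbar_pos (by linarith [hS.rad_pos]) hS.Gbar_pos hS.Gbar_sq_mul hS.eps_cbar_lt
    (mul_pos hS.hbar_pos hS.Gbar_pos) (hS.two_lt_of_machCrit_lt hM)
  refine ⟨C.toNNReal, fun γ hγ Vp Vm ψ hVp hVm hψ => ?_⟩
  have hγ0 : 0 < γ := one_pos.trans_le hγ
  obtain ⟨Φp, Ψp, Pp, Qp, gp, hΦp, hΨp, hgp, htp, hmp⟩ := hS.exists_modes (Or.inl rfl) hVp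
  obtain ⟨Φm, Ψm, Pm, Qm, gm, hΦm, hΨm, hgm, htm, hmm⟩ := hS.exists_modes (Or.inr rfl) hVm
  set g : Fin 4 → Bd → ℂ := ![gp 0, gp 2, gm 0, gm 2] with hgdef
  have hg : ∀ i, MemLp (g i) 2 volume := fun i => by
    fin_cases i
    exacts [hgp 0, hgp 2, hgm 0, hgm 2]
  have htr : ∀ i, wtBd γ (fun y => trNc Vp Vm y i) =ᵐ[volume] g i := fun i => by
    fin_cases i
    exacts [htp 0, htp 2, htm 0, htm 2]
  obtain ⟨B, hB, hBw, hBf⟩ := S.exists_ft_linB hψ hg htr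
  have hψL : MemLp (wtBd γ ψ) 2 volume := by
    have := hψ.1
    rwa [Measure.restrict_univ] at this
  set ψh : Bd → ℂ := ft (wtBd γ ψ) with hψh
  set I : (Sp → ℂ) → Bd → ℝ≥0∞ := fun Φ ξ => ∫⁻ x in Ioi (0 : ℝ), ‖Φ (ξ, x)‖ₑ ^ 2 with hI
  set m : Bd → ℝ≥0∞ := fun ξ => ENNReal.ofReal (weight γ ξ) with hm
  have hmm' : Measurable m := measurable_weight γ
  have sq_meas : ∀ {u : Bd → ℂ}, MemLp u 2 volume → AEMeasurable (fun ξ => ‖ft u ξ‖ₑ ^ 2) volume :=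
    fun hu => (memLp_ft hu).1.enorm.pow_const 2
  -- The estimate at almost every frequency, in `ℝ≥0∞`; integrating it gives the theorem by Plancherel.
  have key : ∀ᵐ ξ : Bd, ENNReal.ofReal γ * (∑ i, I (Φp i) ξ + ∑ i, I (Φm i) ξ) +
        ∑ i, ‖ft (g i) ξ‖ₑ ^ 2 + m ξ * ‖ψh ξ‖ₑ ^ 2 ≤
      C.toNNReal * (ENNReal.ofReal (γ ^ (-3 : ℤ)) *
          (∑ i, m ξ * I (Ψp i) ξ + ∑ i, m ξ * I (Ψm i) ξ) +
        ENNReal.ofReal (γ ^ (-2 : ℤ)) * ∑ i, m ξ * ‖ft (B i) ξ‖ₑ ^ 2) := by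
    filter_upwards [hmp, hmm, hBf] with ξ h1 h2 h3
    rw [one_mul] at h1
    rw [neg_one_mul] at h2
    obtain ⟨b0, b1, b2⟩ := h3
    have hw := weight_eq γ ξ
    have hw0 : 0 ≤ weight γ ξ := by rw [hw]; positivity
    have hΛ : √(weight γ ξ) ^ 2 = weight γ ξ := Real.sq_sqrt hw0
    have hre : 0 < (tau γ ξ).re := by rwa [tau_re]
    have bd := hbound (tau γ ξ) (eta ξ) (√(weight γ ξ)) hre
      (Real.le_sqrt_of_sq_le (by rw [hw]; nlinarith [sq_nonneg (eta ξ)]))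
      (Real.le_sqrt_of_sq_le (by rw [hw, sq_abs]; nlinarith [sq_nonneg ‖tau γ ξ‖]))
      (Real.sqrt_le_iff.2 ⟨by positivity, by
        rw [hw, ← sq_abs (eta ξ)]
        nlinarith [mul_nonneg (norm_nonneg (tau γ ξ)) (abs_nonneg (eta ξ))]⟩)
      _ _ _ _ _ _ _ _ _ _ _ _ _ _ _ _ _ _ _ _ (ψh ξ) _ _ _ h1 h2 b0 b1 b2
    rw [hΛ, tau_re] at bd
    rw [integral_sq_add_sq_add_sq h1.memLp_u h1.memLp_w h1.memLp_z,
      integral_sq_add_sq_add_sq h2.memLp_u h2.memLp_w h2.memLp_z,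
      integral_sq_add_sq_add_sq h1.memLp_f₁ h1.memLp_f₂ h1.memLp_f₃,
      integral_sq_add_sq_add_sq h2.memLp_f₁ h2.memLp_f₂ h2.memLp_f₃] at bd
    have nn : ∀ a : ℝ → ℂ, 0 ≤ ∫ x in Ioi (0 : ℝ), ‖a x‖ ^ 2 := fun a =>
      integral_nonneg fun x => by positivity
    have e3 : ∀ {a b c : ℝ}, 0 ≤ a → 0 ≤ b → 0 ≤ c →
        ENNReal.ofReal a + ENNReal.ofReal b + ENNReal.ofReal c = ENNReal.ofReal (a + b + c) :=
      fun ha hb hc => by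
        rw [ENNReal.ofReal_add (add_nonneg ha hb) hc, ENNReal.ofReal_add ha hb]
    have fin := ofReal_bound hγ0.le (add_nonneg
        (add_nonneg (add_nonneg (nn _) (nn _)) (nn _)) (add_nonneg (add_nonneg (nn _) (nn _)) (nn _)))
      (by positivity) hw0 (sq_nonneg _) hC.le (by positivity) (add_nonneg
        (add_nonneg (add_nonneg (nn _) (nn _)) (nn _)) (add_nonneg (add_nonneg (nn _) (nn _)) (nn _)))
      (by positivity) (by positivity) bd
    have z3 : γ ^ (-3 : ℤ) = (γ ^ 3)⁻¹ := by
      rw [zpow_neg]; norm_cast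
    have z2 : γ ^ (-2 : ℤ) = (γ ^ 2)⁻¹ := by
      rw [zpow_neg]; norm_cast
    have hI' : ∀ {Φ : Sp → ℂ}, MemLp (fun x => Φ (ξ, x)) 2 (volume.restrict (Ioi (0 : ℝ))) →
        I Φ ξ = ENNReal.ofReal (∫ x in Ioi (0 : ℝ), ‖Φ (ξ, x)‖ ^ 2) := fun hΦ =>
      lintegral_enorm_sq_eq_ofReal hΦ
    simp only [Fin.sum_univ_three, Fin.sum_univ_four, ← mul_add]
    rw [hI' h1.memLp_u, hI' h1.memLp_w, hI' h1.memLp_z, hI' h2.memLp_u, hI' h2.memLp_w,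
      hI' h2.memLp_z, hI' h1.memLp_f₁, hI' h1.memLp_f₂, hI' h1.memLp_f₃, hI' h2.memLp_f₁,
      hI' h2.memLp_f₂, hI' h2.memLp_f₃, e3 (nn _) (nn _) (nn _), e3 (nn _) (nn _) (nn _),
      e3 (nn _) (nn _) (nn _), e3 (nn _) (nn _) (nn _),
      ← ENNReal.ofReal_add (add_nonneg (add_nonneg (nn _) (nn _)) (nn _))
        (add_nonneg (add_nonneg (nn _) (nn _)) (nn _)),
      ← ENNReal.ofReal_add (add_nonneg (add_nonneg (nn _) (nn _)) (nn _))
        (add_nonneg (add_nonneg (nn _) (nn _)) (nn _)), z2, z3]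
    simp only [enorm_sq_eq_ofReal]
    rw [e3 (by positivity) (by positivity) (by positivity),
      e3 (by positivity) (by positivity) (by positivity),
      ← ENNReal.ofReal_add (by positivity) (by positivity)]
    exact fin
  have int := lintegral_mono_ae key
  have hLHS : ENNReal.ofReal γ *
        (∑ i, l2OmSq γ (fun x => Vp x i) + ∑ i, l2OmSq γ (fun x => Vm x i)) +
      ∑ i, l2BdSq γ (fun y => trNc Vp Vm y i) + hBdSq 1 γ ψ =
      ∫⁻ ξ : Bd, (ENNReal.ofReal γ * (∑ i, I (Φp i) ξ + ∑ i, I (Φm i) ξ) +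
        ∑ i, ‖ft (g i) ξ‖ₑ ^ 2 + m ξ * ‖ψh ξ‖ₑ ^ 2) := by
    have n1 : ∀ i, AEMeasurable (I (Φp i)) volume := fun i => (hΦp i).aemeasurable_lintegral
    have n2 : ∀ i, AEMeasurable (I (Φm i)) volume := fun i => (hΦm i).aemeasurable_lintegral
    have s1 : AEMeasurable (fun ξ => ∑ i, I (Φp i) ξ) volume :=
      Finset.aemeasurable_fun_sum _ fun i _ => n1 i
    have s2 : AEMeasurable (fun ξ => ∑ i, I (Φm i) ξ) volume :=
      Finset.aemeasurable_fun_sum _ fun i _ => n2 i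
    have s3 : AEMeasurable (fun ξ => ∑ i, ‖ft (g i) ξ‖ₑ ^ 2) volume :=
      Finset.aemeasurable_fun_sum _ fun i _ => sq_meas (hg i)
    have s12 : AEMeasurable (fun ξ => ∑ i, I (Φp i) ξ + ∑ i, I (Φm i) ξ) volume := s1.add s2
    have s12' : AEMeasurable
        (fun ξ => ENNReal.ofReal γ * (∑ i, I (Φp i) ξ + ∑ i, I (Φm i) ξ)) volume :=
      s12.const_mul _
    have s123 : AEMeasurable (fun ξ => ENNReal.ofReal γ * (∑ i, I (Φp i) ξ + ∑ i, I (Φm i) ξ) +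
        ∑ i, ‖ft (g i) ξ‖ₑ ^ 2) volume := s12'.add s3
    rw [lintegral_add_left' s123, lintegral_add_left' s12', lintegral_const_mul'' _ s12,
      lintegral_add_left' s1, lintegral_finsetSum' _ fun i _ => n1 i,
      lintegral_finsetSum' _ fun i _ => n2 i, lintegral_finsetSum' _ fun i _ => sq_meas (hg i),
      ← hBdSq_one_eq (EventuallyEq.refl _ _) hψL]
    have t1 : ∀ i, l2OmSq γ (fun x => Vp x i) = ∫⁻ ξ : Bd, I (Φp i) ξ := fun i =>
      (hΦp i).lintegral_sq
    have t2 : ∀ i, l2OmSq γ (fun x => Vm x i) = ∫⁻ ξ : Bd, I (Φm i) ξ := fun i =>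
      (hΦm i).lintegral_sq
    have t3 : ∀ i, l2BdSq γ (fun y => trNc Vp Vm y i) = ∫⁻ ξ : Bd, ‖ft (g i) ξ‖ₑ ^ 2 := fun i =>
      l2BdSq_eq (htr i) (hg i)
    simp only [t1, t2, t3]
  have hRHS : (C.toNNReal : ℝ≥0∞) * (ENNReal.ofReal (γ ^ (-3 : ℤ)) *
        (∑ i, l2hSq 1 γ (fun x => S.linL 1 Vp x i) + ∑ i, l2hSq 1 γ (fun x => S.linL (-1) Vm x i)) +
      ENNReal.ofReal (γ ^ (-2 : ℤ)) * ∑ i, hBdSq 1 γ (fun y => S.linB (trNc Vp Vm) ψ y i)) =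
      ∫⁻ ξ : Bd, C.toNNReal * (ENNReal.ofReal (γ ^ (-3 : ℤ)) *
          (∑ i, m ξ * I (Ψp i) ξ + ∑ i, m ξ * I (Ψm i) ξ) +
        ENNReal.ofReal (γ ^ (-2 : ℤ)) * ∑ i, m ξ * ‖ft (B i) ξ‖ₑ ^ 2) := by
    have n1 : ∀ i, AEMeasurable (fun ξ => m ξ * I (Ψp i) ξ) volume := fun i =>
      hmm'.aemeasurable.mul (hΨp i).aemeasurable_lintegral
    have n2 : ∀ i, AEMeasurable (fun ξ => m ξ * I (Ψm i) ξ) volume := fun i =>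
      hmm'.aemeasurable.mul (hΨm i).aemeasurable_lintegral
    have n3 : ∀ i, AEMeasurable (fun ξ => m ξ * ‖ft (B i) ξ‖ₑ ^ 2) volume := fun i =>
      hmm'.aemeasurable.mul (sq_meas (hB i))
    have s1 : AEMeasurable (fun ξ => ∑ i, m ξ * I (Ψp i) ξ) volume :=
      Finset.aemeasurable_fun_sum _ fun i _ => n1 i
    have s2 : AEMeasurable (fun ξ => ∑ i, m ξ * I (Ψm i) ξ) volume :=
      Finset.aemeasurable_fun_sum _ fun i _ => n2 i
    have s3 : AEMeasurable (fun ξ => ∑ i, m ξ * ‖ft (B i) ξ‖ₑ ^ 2) volume :=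
      Finset.aemeasurable_fun_sum _ fun i _ => n3 i
    have s12 : AEMeasurable (fun ξ => ∑ i, m ξ * I (Ψp i) ξ + ∑ i, m ξ * I (Ψm i) ξ) volume :=
      s1.add s2
    have s12' : AEMeasurable (fun ξ => ENNReal.ofReal (γ ^ (-3 : ℤ)) *
        (∑ i, m ξ * I (Ψp i) ξ + ∑ i, m ξ * I (Ψm i) ξ)) volume := s12.const_mul _
    have s123 : AEMeasurable (fun ξ => ENNReal.ofReal (γ ^ (-3 : ℤ)) *
        (∑ i, m ξ * I (Ψp i) ξ + ∑ i, m ξ * I (Ψm i) ξ) +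
        ENNReal.ofReal (γ ^ (-2 : ℤ)) * ∑ i, m ξ * ‖ft (B i) ξ‖ₑ ^ 2) volume :=
      s12'.add (s3.const_mul _)
    rw [lintegral_const_mul'' _ s123, lintegral_add_left' s12', lintegral_const_mul'' _ s12,
      lintegral_const_mul'' _ s3, lintegral_add_left' s1, lintegral_finsetSum' _ fun i _ => n1 i,
      lintegral_finsetSum' _ fun i _ => n2 i, lintegral_finsetSum' _ fun i _ => n3 i]
    have t1 : ∀ i, l2hSq 1 γ (fun x => S.linL 1 Vp x i) = ∫⁻ ξ : Bd, m ξ * I (Ψp i) ξ := fun i =>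
      l2hSq_one_eq (EventuallyEq.refl _ _) (hΨp i)
    have t2 : ∀ i, l2hSq 1 γ (fun x => S.linL (-1) Vm x i) = ∫⁻ ξ : Bd, m ξ * I (Ψm i) ξ :=
      fun i => l2hSq_one_eq (EventuallyEq.refl _ _) (hΨm i)
    have t3 : ∀ i, hBdSq 1 γ (fun y => S.linB (trNc Vp Vm) ψ y i) =
        ∫⁻ ξ : Bd, m ξ * ‖ft (B i) ξ‖ₑ ^ 2 := fun i => hBdSq_one_eq (hBw i) (hB i)
    simp only [t1, t2, t3]
  rw [hLHS, hRHS]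
  exact int
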